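/- Let $m\in\{4,6\}$ and let $F=F_1x_1^3+\dots+F_mx_m^3$ with nonzero $F_1,\dots,F_m\in\mathbb Z$. Let $F^\vee\in\mathbb Q[c_1,\dots,c_m]$ be a dual (discriminant) form of $F$, i.e. a square-free polynomial such that for $\boldsymbol c\in\mathbb C^m\setminus\{\boldsymbol 0\}$ one has $F^\vee(\boldsymbol c)=0$ if and only if the hyperplane section $F(\boldsymbol x)=\boldsymbol c\cdot\boldsymbol x=0$ in $\mathbb P^{m-1}_{\mathbb C}$ is singular (this determines $F^\vee$ up to a factor in $\mathbb Q^\times$; fix one choice). Let $w\colon\mathbb R^m\to\mathbb R$ be smooth and compactly supported, with $\det(\partial_i\partial_jF(\boldsymbol x))\neq0$ for all $\boldsymbol x\in\operatorname{Supp}w$ (closed support). Let $\omega_0(x)=\exp(-(1-x^2)^{-1})$ for $|x|<1$ and $\omega_0(x)=0$ otherwise, let $\omega(x)=4\left(\int_{\mathbb R}\omega_0\right)^{-1}\omega_0(4x-3)$, and for $x>0$, $y\in\mathbb R$ let $h(x,y)=\sum_{j\ge1}\frac1{xj}\left(\omega(xj)-\omega\left(\frac{|y|}{xj}\right)\right)$.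 For $X,n>0$ and $\boldsymbol c\in\mathbb R^m$ put $Y=X^{3/2}$ and $$I_{\boldsymbol c,X,Y}(n)=\int_{\mathbb R^m}w(\boldsymbol x/X)\,h\left(\frac nY,\frac{F(\boldsymbol x)}{Y^2}\right)e^{-2\pi i\,\boldsymbol c\cdot\boldsymbol x/n}\,d\boldsymbol x,\qquad J_{\boldsymbol c,X}(n)=Y^{-2}I_{\boldsymbol c,X,Y}(n)/X^{m-3}.$$ Let $\|\cdot\|$ be the maximum norm on $\mathbb R^m$, and $\tilde{\boldsymbol c}=\boldsymbol c/\|\boldsymbol c\|$ for $\boldsymbol c\ne\boldsymbol0$. Write $\partial_{\log n}=n\,\partial_n$ and $\partial_{\log\boldsymbol c}^{\boldsymbol\alpha}=\prod_{i=1}^m(c_i\,\partial_{c_i})^{\alpha_i}$ for $\boldsymbol\alpha\in\mathbb Z_{\ge0}^m$. Then for each $X>0$ the function $(\boldsymbol c,n)\mapsto J_{\boldsymbol c,X}(n)$ is smooth on $\mathbb R^m\times\mathbb R_{>0}$, and there is a Schwartz function $\nu_m\colon\mathbb R^m\to\mathbb R_{>0}$, depending only on $F,F^\vee,w$, such that,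 with $$B_{\boldsymbol c,X}(n)=\min\left[1,\left(\frac{X\|\boldsymbol c\|}n\right)^{1-m/2}\right]\cdot\nu_m\left(\frac{\boldsymbol c}{X^{1/2}}\right)^3\cdot\nu_m\left(\frac{X\boldsymbol c}{n\,|F^\vee(\tilde{\boldsymbol c})|^{-1}}\right)$$ (where the minimum is $1$ if $\boldsymbol c=\boldsymbol 0$, and the last argument is $\boldsymbol 0$ if $\boldsymbol c=\boldsymbol0$ or $F^\vee(\tilde{\boldsymbol c})=0$), the following hold uniformly over all $X>0$, $\boldsymbol c\in\mathbb R^m$, $n>0$: 1. There is a constant $C=C_{F,w}>0$ such that $J_{\boldsymbol c,X}(n)=0$ whenever $n>CY$. 2. $|J_{\boldsymbol c,X}(n)|\ll_{F,F^\vee,w}B_{\boldsymbol c,X}(n)$. 3. For each integer $j\ge0$, $|\partial_{\log n}^jJ_{\boldsymbol c,X}(n)|\ll_{F,F^\vee,w,j}B_{\boldsymbol c,X}(n)$. 4. For each integer $j\ge0$ and each $\boldsymbol\alpha\in\mathbb Z_{\ge0}^m$, $$|\partial_{\log n}^j\,\partial_{\log\boldsymbol c}^{\boldsymbol\alpha}J_{\boldsymbol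 c,X}(n)|\ll_{F,F^\vee,w,j,\boldsymbol\alpha}B_{\boldsymbol c,X}(n)\cdot\prod_{i=1}^m\left(1+\frac{X|c_i|}n\right)^{\alpha_i}.$$ -/

import Mathlib

open scoped ContDiff

noncomputable section

namespace CubicDelta

/-! Cubic forms, Hessian locus, dual form. -/

/-- The diagonal cubic form `a 0 * x_0 ^ 3 + ... + a (m-1) * x_(m-1) ^ 3`. -/
def diagonalCubic {m : ℕ} (a : Fin m → ℤ) : MvPolynomial (Fin m) ℤ :=
  ∑ i, MvPolynomial.C (a i) * MvPolynomial.X i ^ 3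

/-- The real points of the (affine) Hessian hypersurface `det (∂_i ∂_j F) = 0`. -/
def realHessianLocus {m : ℕ} (F : MvPolynomial (Fin m) ℤ) : Set (Fin m → ℝ) :=
  {x | (Matrix.of fun i j : Fin m =>
    MvPolynomial.aeval x (MvPolynomial.pderiv i (MvPolynomial.pderiv j F))).det = 0}

/-- The gradient of `F` at a complex point. -/
def gradient {m : ℕ} (F : MvPolynomial (Fin m) ℤ) (x : Fin m → ℂ) : Fin m → ℂ :=
  fun i => MvPolynomial.aeval x (MvPolynomial.pderiv i F)

/-- The hyperplane section `F(x) = 0, c · x = 0` in complex projective space has a singular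
point (Jacobian criterion). -/
def SectionSingular {m : ℕ} (F : MvPolynomial (Fin m) ℤ) (c : Fin m → ℂ) : Prop :=
  ∃ x : Fin m → ℂ, x ≠ 0 ∧ MvPolynomial.aeval x F = 0 ∧ c ⬝ᵥ x = 0 ∧
    ¬ LinearIndependent ℂ ![gradient F x, c]

/-- `Fd` is a dual form `F^∨` of `F`: a square-free rational polynomial whose complex zeros
`c ≠ 0` are exactly the `c` for which the hyperplane section of `F = 0` by `c · x = 0` is
singular. This determines `Fd` up to a factor in `ℚˣ`. -/
structure IsDualForm {m : ℕ} (F : MvPolynomial (Fin m) ℤ) (Fd : MvPolynomial (Fin m) ℚ) :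
    Prop where
  squarefree : Squarefree Fd
  zero_iff : ∀ c : Fin m → ℂ, c ≠ 0 → (MvPolynomial.aeval c Fd = 0 ↔ SectionSingular F c)

/-! The delta method integrals. -/

/-- `exp (-1 / (1 - x ^ 2))` for `|x| < 1`, and `0` otherwise. -/
def omegaZero (x : ℝ) : ℝ := if |x| < 1 then Real.exp (-(1 - x ^ 2)⁻¹) else 0

/-- The normalized bump function on `[1/2, 1]`. -/
def omega (x : ℝ) : ℝ := 4 * (∫ t, omegaZero t)⁻¹ * omegaZero (4 * x - 3)

/-- Heath-Brown's function
`h(x, y) = ∑_{j ≥ 1} (x j)⁻¹ (ω(x j) - ω(|y| / (x j)))` for `x > 0`;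
only finitely many terms are nonzero. -/
def deltaH (x y : ℝ) : ℝ :=
  ∑' k : ℕ, (x * (k + 1 : ℝ))⁻¹ *
    (omega (x * (k + 1 : ℝ)) - omega (|y| / (x * (k + 1 : ℝ))))

/-- `I_{c,X,Y}(n) = ∫ w(x / X) h(n / Y, F(x) / Y ^ 2) e(-(c · x) / n) dx`,
with `e(t) = exp(2 π i t)`. -/
def deltaI {m : ℕ} (F : MvPolynomial (Fin m) ℤ) (w : (Fin m → ℝ) → ℝ)
    (X Y : ℝ) (c : Fin m → ℝ) (n : ℝ) : ℂ :=
  ∫ x : Fin m → ℝ,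
    ((w (X⁻¹ • x) * deltaH (n / Y) (MvPolynomial.aeval x F / Y ^ 2) : ℝ) : ℂ) *
      Complex.exp (((-(2 * Real.pi * ((c ⬝ᵥ x) / n)) : ℝ) : ℂ) * Complex.I)

/-- The modulus cutoff `Y = X ^ (3 / 2)`. -/
def cutoffY (X : ℝ) : ℝ := X ^ (3 / 2 : ℝ)

/-- `J_{c,X}(n) = Y⁻² I_{c,X,Y}(n) / X ^ (m - 3)`, where `Y = X ^ (3 / 2)`. -/
def deltaJ {m : ℕ} (F : MvPolynomial (Fin m) ℤ) (w : (Fin m → ℝ) → ℝ)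
    (X : ℝ) (c : Fin m → ℝ) (n : ℝ) : ℂ :=
  (((cutoffY X ^ 2)⁻¹ : ℝ) : ℂ) * deltaI F w X (cutoffY X) c n /
    ((X ^ ((m : ℤ) - 3) : ℝ) : ℂ)

/-! Logarithmic derivatives. -/

/-- `∂_{log n} = n ∂_n`. -/
def logDerivMod (g : ℝ → ℂ) : ℝ → ℂ := fun n => (n : ℂ) * deriv g n

/-- `∂_{log c_i} = c_i ∂_{c_i}`. -/
def logDerivCoord {m : ℕ} (i : Fin m) (G : (Fin m → ℝ) → ℂ) : (Fin m → ℝ) → ℂ :=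
  fun c => (c i : ℂ) * deriv (fun t : ℝ => G (Function.update c i t)) (c i)

/-- `∂_{log c}^α = ∏_i ∂_{log c_i}^{α_i}`. -/
def logDerivMulti {m : ℕ} (α : Fin m → ℕ) (G : (Fin m → ℝ) → ℂ) : (Fin m → ℝ) → ℂ :=
  (List.finRange m).foldr (fun i H => (logDerivCoord i)^[α i] H) G

/-! The majorant. -/

/-- `min [1, t ^ (1 - m / 2)]` for `t ≥ 0` and `m > 2`, where `0 ^ (1 - m / 2) = ∞`. -/
def dimensionFactor (m : ℕ) (t : ℝ) : ℝ :=
  if t = 0 then 1 else min 1 (t ^ (1 - (m : ℝ) / 2))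

/-- `min [1, (X‖c‖/n)^(1 - m/2)] ν(c / X^(1/2))^3 ν(X c / (n |F^∨(c̃)|⁻¹))` with
`c̃ = c / ‖c‖`; the last argument is written as `(X / n) |F^∨(c̃)| c`, which is `0` when
`c = 0` or `F^∨(c̃) = 0`. -/
def majorant {m : ℕ} (Fd : MvPolynomial (Fin m) ℚ) (ν : (Fin m → ℝ) → ℝ)
    (X : ℝ) (c : Fin m → ℝ) (n : ℝ) : ℝ :=
  dimensionFactor m (X * ‖c‖ / n) *
    ν ((X ^ (1 / 2 : ℝ))⁻¹ • c) ^ 3 *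
    ν ((X / n * |MvPolynomial.aeval (‖c‖⁻¹ • c) Fd|) • c)

end CubicDelta

end

open CubicDelta

open scoped ContDiff

noncomputable section

namespace CubicDelta

open MeasureTheory Set

/-! Oscillatory integrals in one variable. -/

/-! After the substitution x = Xu the integral depends only on r = n/Y and v = (X/n)c: it is ∫ w(u)
h(r, F(u)) e(-v·u) du (`deltaJ_eq_deltaOsc`). In these variables the target is `decayWeight`: the
factor (1+‖v‖)^(1-m/2), times arbitrary polynomial decay in r‖v‖ = ‖c‖/X^(1/2) and in ‖v‖
|F^∨(v/‖v‖)|.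

Poisson summation splits h(r, y) into a function of r alone that is O(r^N), and r⁻¹Ψ(y/r) with Ψ
Schwartz (`deltaH_eq`). The first piece only multiplies the Fourier transform of w. For the second,
Fourier inversion gives r⁻¹Ψ(F(u)/r) = ∫ P(rt) e(tF(u)) dt. Since F is diagonal, cutting w to
orthants and expanding it by Fourier inversion turns the u-integral into a product of one-variable
integrals ∫ χ(x) e(α_i t x³ - β_i x) dx, where β is v up to signs and a shift by the frequency ξ; a
Peetre-type inequality absorbs the shift (`orthant_bound`).

A nonzero Hessian determinant means that no coordinate vanishes on the support of w, so χ lives on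
some [p, q] with p > 0 and critical points are nondegenerate. Unless t is comparable to ‖β‖ and
every factor can have a critical point, some factor is nonstationary and the product decays to any
order (`prod_cubicInt_nonstationary`). In the remaining range put t = ‖β‖ exp(-2η). All critical
points then move by the same factor exp η, and each cubic integral is e(constant · exp η) times an
amplitude that is O(‖β‖^(-1/2)) together with all its η-derivatives (`cubicInt_eq_of_crit`,
`norm_iteratedDeriv_statInt_le`). The Jacobian contributes ‖β‖, whence ‖β‖^(1-m/2). Integration by
parts against the total phase e(κ exp η) saves any power of |κ| (`stationary_part`).

Up to constants, κ is ‖β‖F(z), where z is the vector of critical points at unit scale, whose Gauss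
image is the direction of β. The dual form vanishes on the Gauss image of F = 0, so by the mean
value inequality its value in that direction is O(|F(z)|) (`abs_dualForm_le`). This converts decay
in κ into decay in ‖v‖ |F^∨(v/‖v‖)|.

For derivatives, n∂_n at fixed c is differentiation along (xr, x⁻¹v). Substituting u = xz removes x
from the character, so the derivative falls only on the weight and the kernel and yields integrals
of the same kind (`oscClass_dilate`). Each c_i∂_{c_i} costs at most one factor v_i
(`oscClass_coord`). The resulting countably many bounds, of every order of decay, are dominated by
one Schwartz function through a diagonal construction (`exists_schwartz_majorant`). -/

/-- The additive character `e(x) = exp (2 π i x)`. -/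
def ee (x : ℝ) : ℂ := Complex.exp (((2 * Real.pi * x : ℝ) : ℂ) * Complex.I)

lemma norm_ee (x : ℝ) : ‖ee x‖ = 1 := Complex.norm_exp_ofReal_mul_I _

lemma ee_add (x y : ℝ) : ee (x + y) = ee x * ee y := by
  unfold ee; rw [← Complex.exp_add]; congr 1; push_cast; ring

@[simp] lemma ee_zero : ee 0 = 1 := by simp [ee]

lemma ee_sum {ι : Type*} (s : Finset ι) (f : ι → ℝ) : ee (∑ i ∈ s, f i) = ∏ i ∈ s, ee (f i) := by
  classical
  induction s using Finset.induction_on with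
  | empty => simp
  | insert i s hi ih => rw [Finset.sum_insert hi, Finset.prod_insert hi, ee_add, ih]

lemma contDiff_ee : ContDiff ℝ ∞ ee := by
  unfold ee
  refine ContDiff.cexp (ContDiff.mul ?_ contDiff_const)
  exact Complex.ofRealCLM.contDiff.comp (contDiff_const.mul contDiff_id)

lemma continuous_ee : Continuous ee := contDiff_ee.continuous

@[fun_prop] lemma Continuous.ee {E : Type*} [TopologicalSpace E] {f : E → ℝ}
    (hf : Continuous f) : Continuous (fun x => ee (f x)) := continuous_ee.comp hf

lemma hasDerivAt_ee {f : ℝ → ℝ} {f' x : ℝ} (hf : HasDerivAt f f' x) :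
    HasDerivAt (fun x => ee (f x)) (2 * Real.pi * Complex.I * f' * ee (f x)) x := by
  have h1 : HasDerivAt (fun x => (((2 * Real.pi * f x : ℝ) : ℂ) * Complex.I))
      (((2 * Real.pi * f' : ℝ) : ℂ) * Complex.I) x :=
    ((hf.const_mul (2 * Real.pi)).ofReal_comp).mul_const _
  have h2 := h1.cexp
  unfold CubicDelta.ee
  convert h2 using 1
  push_cast; ring

lemma integral_mul_deriv_ee {u u' : ℝ → ℂ} {φ φ' : ℝ → ℝ} (hu : ∀ x, HasDerivAt u (u' x) x)
    (hu' : Continuous u') (hc : HasCompactSupport u) (hφ : ∀ x, HasDerivAt φ (φ' x) x)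
    (hφ' : Continuous φ') :
    ∫ x, u x * (2 * Real.pi * Complex.I * φ' x * ee (φ x)) = - ∫ x, u' x * ee (φ x) := by
  have hcu : Continuous u := continuous_iff_continuousAt.2 fun x => (hu x).continuousAt
  have hcφ : Continuous φ := continuous_iff_continuousAt.2 fun x => (hφ x).continuousAt
  have hcu' : HasCompactSupport u' := by
    have : u' = deriv u := funext fun x => (hu x).deriv.symm
    rw [this]; exact hc.deriv
  refine integral_mul_deriv_eq_deriv_mul_of_integrable (fun x _ => hu x)
    (fun x _ => hasDerivAt_ee (hφ x)) ?_ ?_ ?_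
  · refine Continuous.integrable_of_hasCompactSupport ?_ hc.mul_right
    fun_prop
  · refine Continuous.integrable_of_hasCompactSupport ?_ hcu'.mul_right
    fun_prop
  · refine Continuous.integrable_of_hasCompactSupport ?_ hc.mul_right
    fun_prop

/-- A smooth function times a power of `3 α x² - β`, with the latter nonzero on the support. -/
lemma hasDerivAt_mul_inv_pow {f : ℝ → ℂ} (hf : ContDiff ℝ ∞ f) {α β : ℝ}
    (h : ∀ x ∈ tsupport f, 3 * α * x ^ 2 - β ≠ 0) (l n : ℕ) (x : ℝ) :
    HasDerivAt (fun x => f x * ((α ^ l * ((3 * α * x ^ 2 - β)⁻¹) ^ n : ℝ) : ℂ))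
      (deriv f x * ((α ^ l * ((3 * α * x ^ 2 - β)⁻¹) ^ n : ℝ) : ℂ) -
        6 * n * ((x * f x) * ((α ^ (l + 1) * ((3 * α * x ^ 2 - β)⁻¹) ^ (n + 1) : ℝ) : ℂ))) x := by
  by_cases hx : x ∈ tsupport f
  · have hd := h x hx
    have h1 : HasDerivAt f (deriv f x) x := (hf.differentiable (by simp) x).hasDerivAt
    have h2 : HasDerivAt (fun x : ℝ => 3 * α * x ^ 2 - β) (6 * α * x) x := by
      have := (((hasDerivAt_id x).pow 2).const_mul (3 * α)).sub_const β
      exact HasDerivAt.congr_deriv this (by simp; ring)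
    have h3 := ((h2.inv hd).pow n).const_mul (α ^ l)
    have h4 := h1.mul h3.ofReal_comp
    refine HasDerivAt.congr_deriv h4 ?_
    rcases n with _ | n
    · simp
    · simp only [Pi.inv_apply, Pi.pow_apply, Nat.add_sub_cancel]
      push_cast
      generalize (3 * (α : ℂ) * x ^ 2 - β) = D
      ring
  · have h0 : f x = 0 := image_eq_zero_of_notMem_tsupport hx
    have h1 : deriv f x = 0 := by
      by_contra hne
      exact hx (tsupport_deriv_subset (f := f) (subset_tsupport _ hne))
    rw [h0, h1]
    simp only [zero_mul, mul_zero, sub_zero]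
    refine (hasDerivAt_const x (0 : ℂ)).congr_of_eventuallyEq ?_
    filter_upwards [(isClosed_tsupport f).isOpen_compl.mem_nhds hx] with y hy
    rw [image_eq_zero_of_notMem_tsupport hy, zero_mul]

lemma continuous_mul_inv_pow {f : ℝ → ℂ} (hf : ContDiff ℝ ∞ f) {α β : ℝ}
    (h : ∀ x ∈ tsupport f, 3 * α * x ^ 2 - β ≠ 0) (l n : ℕ) :
    Continuous (fun x => f x * ((α ^ l * ((3 * α * x ^ 2 - β)⁻¹) ^ n : ℝ) : ℂ)) :=
  continuous_iff_continuousAt.2 fun x => (hasDerivAt_mul_inv_pow hf h l n x).continuousAt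

/-- Repeated integration by parts. Amplitudes f · α^l · D^(-n) with D = 3αx² - β form a family
closed under it: the derivative of D^(-n) brings out xα, which is recorded by passing from f to xf
and from l to l+1. The hypotheses |α| ≤ 1 and |D| ≥ c then suffice for uniformity, with no bound on
β. -/
theorem nonstationary_aux {p q c : ℝ} (hc : 0 < c) (N : ℕ) :
    ∀ (f : ℝ → ℂ), ContDiff ℝ ∞ f → tsupport f ⊆ Icc p q → ∀ l n : ℕ,
    ∃ C : ℝ, 0 ≤ C ∧ ∀ α β Λ : ℝ, |α| ≤ 1 → 0 < Λ →
      (∀ x ∈ Icc p q, c ≤ |3 * α * x ^ 2 - β|) →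
      ‖∫ x, f x * ((α ^ l * ((3 * α * x ^ 2 - β)⁻¹) ^ n : ℝ) : ℂ) *
        ee (Λ * (α * x ^ 3 - β * x))‖ * Λ ^ N ≤ C := by
  induction N with
  | zero =>
    intro f hf hs l n
    have hcs : HasCompactSupport f := HasCompactSupport.of_support_subset_isCompact isCompact_Icc
      ((subset_tsupport f).trans hs)
    refine ⟨∫ x, ‖f x‖ * c⁻¹ ^ n, integral_nonneg fun x => by positivity, ?_⟩
    intro α β Λ hα hΛ hd
    rw [pow_zero, mul_one]
    refine (norm_integral_le_integral_norm _).trans (integral_mono_of_nonneg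
      (Filter.Eventually.of_forall fun x => norm_nonneg _) ?_ (Filter.Eventually.of_forall ?_))
    · exact (hf.continuous.norm.integrable_of_hasCompactSupport hcs.norm).mul_const _
    · intro x
      simp only [norm_mul, norm_ee, mul_one, Complex.norm_real, Real.norm_eq_abs, abs_pow,
        abs_inv]
      by_cases hx : x ∈ Icc p q
      · refine mul_le_mul_of_nonneg_left ?_ (norm_nonneg _)
        calc |α| ^ l * |3 * α * x ^ 2 - β|⁻¹ ^ n ≤ 1 * c⁻¹ ^ n := by
              gcongr
              · exact pow_le_one₀ (abs_nonneg _) hα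
              · exact hd x hx
          _ = c⁻¹ ^ n := one_mul _
      · have : f x = 0 := image_eq_zero_of_notMem_tsupport fun h => hx (hs h)
        simp [this]
  | succ N ih =>
    intro f hf hs l n
    have hcs : HasCompactSupport f := HasCompactSupport.of_support_subset_isCompact isCompact_Icc
      ((subset_tsupport f).trans hs)
    have hxf : ContDiff ℝ ∞ (fun x : ℝ => (x : ℂ) * f x) :=
      Complex.ofRealCLM.contDiff.mul hf
    have hxs : tsupport (fun x : ℝ => (x : ℂ) * f x) ⊆ tsupport f :=
      tsupport_mul_subset_right
    have hf' : ContDiff ℝ ∞ (deriv f) := (contDiff_infty_iff_deriv.1 hf).2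
    obtain ⟨C1, hC1, h1⟩ := ih (deriv f) hf' (tsupport_deriv_subset.trans hs) l (n + 1)
    obtain ⟨C2, hC2, h2⟩ := ih (fun x => x * f x) hxf (hxs.trans hs) (l + 1) (n + 2)
    refine ⟨C1 + 6 * (n + 1) * C2, by positivity, ?_⟩
    intro α β Λ hα hΛ hd
    -- D is bounded below only on the interval carrying f, so every division by D has to be licensed
    -- by the topological support.
    have hne : ∀ x ∈ tsupport f, 3 * α * x ^ 2 - β ≠ 0 := fun x hx h0 => by
      have := hd x (hs hx); rw [h0, abs_zero] at this; linarith
    have hne1 : ∀ x ∈ tsupport (deriv f), 3 * α * x ^ 2 - β ≠ 0 :=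
      fun x hx => hne x (tsupport_deriv_subset hx)
    have hne2 : ∀ x ∈ tsupport (fun x : ℝ => (x : ℂ) * f x), 3 * α * x ^ 2 - β ≠ 0 :=
      fun x hx => hne x (hxs hx)
    have k1 := h1 α β Λ hα hΛ hd
    have k2 := h2 α β Λ hα hΛ hd
    have hφ : ∀ x : ℝ, HasDerivAt (fun x => Λ * (α * x ^ 3 - β * x))
        (Λ * (3 * α * x ^ 2 - β)) x := by
      intro x
      have := ((((hasDerivAt_id x).pow 3).const_mul α).sub
        ((hasDerivAt_id x).const_mul β)).const_mul Λ
      exact HasDerivAt.congr_deriv this (by simp only [id]; push_cast; ring)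
    have c1 := continuous_mul_inv_pow hf' hne1 l (n + 1)
    have c2 := continuous_mul_inv_pow hxf hne2 (l + 1) (n + 2)
    have ibp := integral_mul_deriv_ee (fun x => hasDerivAt_mul_inv_pow hf hne l (n + 1) x)
      (c1.sub (continuous_const.mul c2)) hcs.mul_right hφ (by fun_prop)
    have i1 : Integrable (fun x => deriv f x *
        ((α ^ l * ((3 * α * x ^ 2 - β)⁻¹) ^ (n + 1) : ℝ) : ℂ) * ee (Λ * (α * x ^ 3 - β * x))) :=
      (c1.mul (by fun_prop)).integrable_of_hasCompactSupport hcs.deriv.mul_right.mul_right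
    have i2 : Integrable (fun x : ℝ => (x * f x) *
        ((α ^ (l + 1) * ((3 * α * x ^ 2 - β)⁻¹) ^ (n + 2) : ℝ) : ℂ) *
          ee (Λ * (α * x ^ 3 - β * x))) :=
      (c2.mul (by fun_prop)).integrable_of_hasCompactSupport hcs.mul_left.mul_right.mul_right
    set I := ∫ x, f x * ((α ^ l * ((3 * α * x ^ 2 - β)⁻¹) ^ n : ℝ) : ℂ) *
        ee (Λ * (α * x ^ 3 - β * x)) with hI
    set I1 := ∫ x, deriv f x * ((α ^ l * ((3 * α * x ^ 2 - β)⁻¹) ^ (n + 1) : ℝ) : ℂ) *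
        ee (Λ * (α * x ^ 3 - β * x)) with hI1
    set I2 := ∫ x : ℝ, (x * f x) * ((α ^ (l + 1) * ((3 * α * x ^ 2 - β)⁻¹) ^ (n + 2) : ℝ) : ℂ) *
        ee (Λ * (α * x ^ 3 - β * x)) with hI2
    have e1 : 2 * Real.pi * Complex.I * Λ * I = -(I1 - 6 * (n + 1) * I2) := by
      rw [hI, hI1, hI2, ← integral_const_mul, ← integral_const_mul,
        ← integral_sub i1 (i2.const_mul _)]
      refine Eq.trans (integral_congr_ae (Filter.Eventually.of_forall fun x => ?_))
        (ibp.trans (congrArg Neg.neg (integral_congr_ae (Filter.Eventually.of_forall fun x => ?_))))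
      · dsimp only
        by_cases hx : x ∈ tsupport f
        · have hd' : (3 * (α : ℂ) * x ^ 2 - β) ≠ 0 := by exact_mod_cast hne x hx
          push_cast
          generalize (3 * (α : ℂ) * x ^ 2 - β) = D at hd'
          linear_combination (-(2 * Real.pi * Complex.I * Λ * f x * α ^ l * D⁻¹ ^ n *
            ee (Λ * (α * x ^ 3 - β * x)))) * inv_mul_cancel₀ hd'
        · rw [image_eq_zero_of_notMem_tsupport hx]; simp
      · dsimp only
        push_cast
        ring
    have e2 : 2 * Real.pi * Λ * ‖I‖ ≤ ‖I1‖ + 6 * (n + 1) * ‖I2‖ := by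
      have := congrArg norm e1
      rw [norm_neg] at this
      simp only [norm_mul, Complex.norm_I, Complex.norm_real, Real.norm_eq_abs, mul_one,
        Complex.norm_ofNat, abs_of_pos hΛ, abs_of_pos Real.pi_pos] at this
      rw [this]
      refine (norm_sub_le _ _).trans (le_of_eq ?_)
      congr 1
      rw [norm_mul, norm_mul]
      congr 2
      · simp
      · rw [← Nat.cast_succ, Complex.norm_natCast, Nat.cast_succ]
    have e3 : Λ * ‖I‖ ≤ ‖I1‖ + 6 * (n + 1) * ‖I2‖ := by
      refine le_trans ?_ e2
      have : 1 ≤ 2 * Real.pi := by linarith [Real.pi_gt_three]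
      have h0 : 0 ≤ Λ * ‖I‖ := by positivity
      nlinarith
    calc ‖I‖ * Λ ^ (N + 1) = (Λ * ‖I‖) * Λ ^ N := by ring
      _ ≤ (‖I1‖ + 6 * (n + 1) * ‖I2‖) * Λ ^ N := by gcongr
      _ = ‖I1‖ * Λ ^ N + 6 * (n + 1) * (‖I2‖ * Λ ^ N) := by ring
      _ ≤ C1 + 6 * (n + 1) * C2 := by gcongr

/-- The cubic oscillatory integral `∫ f(x) e(A x³ - B x) dx`. -/
def cubicInt (f : ℝ → ℂ) (A B : ℝ) : ℂ := ∫ x, f x * ee (A * x ^ 3 - B * x)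

lemma norm_cubicInt_le (f : ℝ → ℂ) (A B : ℝ) : ‖cubicInt f A B‖ ≤ ∫ x, ‖f x‖ := by
  refine (norm_integral_le_integral_norm _).trans (le_of_eq ?_)
  simp [norm_ee]

/-- The scaled statement applies with Λ = |A| + |B| once Λ > 1; for Λ ≤ 1 the trivial bound is
enough. The factor 2^N covers the passage from 1 + Λ to 2Λ, or to 2. -/
theorem nonstationary {p q c : ℝ} (hc : 0 < c) (N : ℕ) {f : ℝ → ℂ} (hf : ContDiff ℝ ∞ f)
    (hs : tsupport f ⊆ Icc p q) :
    ∃ C : ℝ, 0 ≤ C ∧ ∀ A B : ℝ,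
      (∀ x ∈ Icc p q, c * (|A| + |B|) ≤ |3 * A * x ^ 2 - B|) →
      ‖cubicInt f A B‖ * (1 + |A| + |B|) ^ N ≤ C := by
  obtain ⟨C, hC, h⟩ := nonstationary_aux hc N f hf hs 0 0
  refine ⟨2 ^ N * (C + ∫ x, ‖f x‖), by positivity, ?_⟩
  intro A B hAB
  rcases le_or_gt (|A| + |B|) 1 with h1 | h1
  · calc ‖cubicInt f A B‖ * (1 + |A| + |B|) ^ N ≤ (∫ x, ‖f x‖) * 2 ^ N := by
          gcongr
          · exact norm_cubicInt_le _ _ _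
          · linarith
      _ ≤ _ := by rw [mul_comm]; gcongr; linarith
  · set Λ := |A| + |B| with hΛ
    have hΛ0 : 0 < Λ := by linarith
    have k := h (A / Λ) (B / Λ) Λ ?_ hΛ0 ?_
    · have : cubicInt f A B = ∫ x, f x * (((A / Λ) ^ 0 * ((3 * (A / Λ) * x ^ 2 - B / Λ)⁻¹) ^ 0 : ℝ) : ℂ) *
          ee (Λ * (A / Λ * x ^ 3 - B / Λ * x)) := by
        unfold cubicInt
        congr 1; ext x
        simp only [pow_zero, mul_one, Complex.ofReal_one]
        congr 2
        field_simp
      rw [← this] at k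
      calc ‖cubicInt f A B‖ * (1 + |A| + |B|) ^ N ≤ ‖cubicInt f A B‖ * (2 * Λ) ^ N := by
            gcongr; linarith
        _ = 2 ^ N * (‖cubicInt f A B‖ * Λ ^ N) := by rw [mul_pow]; ring
        _ ≤ 2 ^ N * (C + ∫ x, ‖f x‖) := by
            gcongr
            have : 0 ≤ ∫ x, ‖f x‖ := by positivity
            linarith
    · rw [abs_div, abs_of_pos hΛ0, div_le_one hΛ0]; simp [hΛ]
    · intro x hx
      have := hAB x hx
      have e : 3 * (A / Λ) * x ^ 2 - B / Λ = (3 * A * x ^ 2 - B) / Λ := by ring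
      rw [e, abs_div, abs_of_pos hΛ0, le_div_iff₀ hΛ0]
      exact this

end CubicDelta

end

/-! ### A van der Corput bound for the normalized phase ψ -/

open scoped ContDiff

noncomputable section

namespace CubicDelta

open MeasureTheory Set

/-- The normalized phase `(x - 1) ^ 2 (x + 2) = x ^ 3 - 3 x + 2` at `x = exp y`. -/
def psi (y : ℝ) : ℝ := (Real.exp y - 1) ^ 2 * (Real.exp y + 2)

/-- The derivative of `psi`. -/
def psi' (y : ℝ) : ℝ := 3 * Real.exp y * (Real.exp y ^ 2 - 1)

/-- The quotient `psi / psi'`. -/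
def psiQuot (y : ℝ) : ℝ :=
  (Real.exp y - 1) * (Real.exp y + 2) / (3 * Real.exp y * (Real.exp y + 1))

lemma hasDerivAt_psi (y : ℝ) : HasDerivAt psi (psi' y) y := by
  have h := Real.hasDerivAt_exp y
  have := ((h.sub_const 1).pow 2).mul (h.add_const 2)
  refine HasDerivAt.congr_deriv this ?_
  simp only [psi', Pi.pow_apply]
  push_cast
  ring

lemma contDiff_psi' : ContDiff ℝ ∞ psi' := by unfold psi'; fun_prop

lemma contDiff_psi : ContDiff ℝ ∞ psi := by unfold psi; fun_prop

lemma contDiff_psiQuot : ContDiff ℝ ∞ psiQuot := by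
  unfold psiQuot
  refine ContDiff.div (by fun_prop) (by fun_prop) fun y => by positivity

/-- ψ has a double zero at 0, where ψ' has its only, simple zero, so the quotient is smooth. A
factor ψ in an integrand can therefore be traded for ψ' and integrated by parts. -/
lemma psiQuot_mul_psi' (y : ℝ) : psiQuot y * psi' y = psi y := by
  unfold psiQuot psi' psi
  have := Real.exp_pos y
  field_simp
  ring

lemma exp_mul_abs_le_abs_exp_sq_sub_one {B y : ℝ} (hy : |y| ≤ B) :
    Real.exp (-B) * |y| ≤ |Real.exp y ^ 2 - 1| := by
  have hB : 0 ≤ B := (abs_nonneg _).trans hy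
  have e1 : Real.exp (-B) ≤ 1 := Real.exp_le_one_iff.2 (by linarith)
  have hf : Real.exp y ^ 2 - 1 = (Real.exp y - 1) * (Real.exp y + 1) := by ring
  have hp := Real.exp_pos y
  rw [hf, abs_mul, abs_of_pos (by linarith : 0 < Real.exp y + 1)]
  have key : Real.exp (-B) * |y| ≤ |Real.exp y - 1| := by
    rcases le_or_gt 0 y with h | h
    · rw [abs_of_nonneg h, abs_of_nonneg (by linarith [Real.one_le_exp h])]
      nlinarith [Real.add_one_le_exp y]
    · rw [abs_of_neg h, abs_of_nonpos (by linarith [Real.exp_le_one_iff.2 h.le])]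
      have h1 := Real.add_one_le_exp (-y)
      have h2 : Real.exp (-B) ≤ Real.exp y := Real.exp_le_exp.2 (by
        rw [abs_of_neg h] at hy; linarith)
      have h3 : Real.exp y * Real.exp (-y) = 1 := by rw [← Real.exp_add]; simp
      nlinarith
  nlinarith [abs_nonneg (Real.exp y - 1)]

lemma div_one_add_mul_sq_le {M s : ℝ} (hM : 0 < M) :
    |s| / (1 + M * s ^ 2) ≤ (√M)⁻¹ := by
  have h : 0 < √M := Real.sqrt_pos.2 hM
  rw [div_le_iff₀ (by positivity), ← sq_abs s]
  nth_rw 2 [← Real.sq_sqrt hM.le]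
  rw [inv_mul_eq_div, le_div_iff₀ h]
  nlinarith [sq_nonneg (√M * |s| - 1), abs_nonneg s]

/-- Van der Corput's estimate for the phase `M ψ`, which has its only critical point at `0`. -/
theorem vanDerCorput_psi {B : ℝ} (hB : 0 < B) :
    ∃ C : ℝ, 0 ≤ C ∧ ∀ (h h' : ℝ → ℂ) (H M : ℝ), (∀ y, HasDerivAt h (h' y) y) →
      Continuous h' → tsupport h ⊆ Icc (-B) B → (∀ y, ‖h y‖ ≤ H) → (∀ y, ‖h' y‖ ≤ H) → M ≠ 0 →
      ‖∫ y, h y * ee (M * psi y)‖ * √|M| ≤ C * H := by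
  set c := Real.exp (-B) with hc
  set K1 := 1 + Real.exp B ^ 3 with hK1
  set K2 := Real.exp B with hK2
  have hc0 : 0 < c := Real.exp_pos _
  have hK20 : 0 < K2 := Real.exp_pos _
  refine ⟨K1 * (Real.pi / c) + K2 * (2 * B), by positivity, ?_⟩
  intro h h' H M hd hcont hsupp hH hH' hM
  have hM0 : 0 < |M| := abs_pos.2 hM
  have hsM : 0 < √|M| := Real.sqrt_pos.2 hM0
  have hH0 : 0 ≤ H := (norm_nonneg _).trans (hH 0)
  have hcs : HasCompactSupport h := HasCompactSupport.of_support_subset_isCompact isCompact_Icc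
    ((subset_tsupport h).trans hsupp)
  have hch : Continuous h := continuous_iff_continuousAt.2 fun x => (hd x).continuousAt
  have hsupp' : tsupport h' ⊆ Icc (-B) B := by
    have : h' = deriv h := funext fun x => (hd x).deriv.symm
    rw [this]; exact tsupport_deriv_subset.trans hsupp
  set s : ℝ → ℝ := fun y => Real.exp y ^ 2 - 1 with hs
  -- Smooth substitute for splitting at |y| ≈ |M|^(-1/2): since ψ' = 3 exp(y) s, the choice of g
  -- makes 1 = (1 + |M|s²)⁻¹ + g·Mψ'. The first summand is concentrated near the critical point; the
  -- second is integrated by parts.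
  set g : ℝ → ℝ := fun y => |M| / M / 3 * (Real.exp (-y) * (s y / (1 + |M| * s y ^ 2))) with hg
  set g' : ℝ → ℝ := fun y => |M| / M / 3 * (-Real.exp (-y) * (s y / (1 + |M| * s y ^ 2)) +
    Real.exp (-y) * (2 * Real.exp y ^ 2 * (1 - |M| * s y ^ 2) / (1 + |M| * s y ^ 2) ^ 2)) with hg'
  have hpos : ∀ y, 0 < 1 + |M| * s y ^ 2 := fun y => by positivity
  have hgd : ∀ y, HasDerivAt g (g' y) y := by
    intro y
    have hs' : HasDerivAt s (2 * Real.exp y ^ 2) y := by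
      have := ((Real.hasDerivAt_exp y).pow 2).sub_const 1
      exact HasDerivAt.congr_deriv this (by push_cast; ring)
    have h1 := hs'.div (((hs'.pow 2).const_mul |M|).const_add 1) (hpos y).ne'
    have h2 : HasDerivAt (fun y => Real.exp (-y)) (-Real.exp (-y)) y := by
      have := (hasDerivAt_neg y).exp
      exact HasDerivAt.congr_deriv this (by ring)
    have h3 := (h2.mul h1).const_mul (|M| / M / 3)
    refine HasDerivAt.congr_deriv h3 ?_
    simp only [hg', Pi.pow_apply, Pi.div_apply]
    push_cast
    ring
  have hsc : Continuous s := by fun_prop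
  have hgc : Continuous g := continuous_iff_continuousAt.2 fun x => (hgd x).continuousAt
  have hgc' : Continuous g' := by
    refine continuous_const.mul (Continuous.add (Continuous.mul (by fun_prop) ?_)
      (Continuous.mul (by fun_prop) ?_))
    · exact hsc.div (by fun_prop) fun y => (hpos y).ne'
    · exact Continuous.div (by fun_prop) (by fun_prop) fun y => pow_ne_zero _ (hpos y).ne'
  have hud : ∀ y, HasDerivAt (fun y => h y * (g y : ℂ)) (h' y * g y + h y * g' y) y :=
    fun y => (hd y).mul (hgd y).ofReal_comp
  have ibp := integral_mul_deriv_ee hud (by fun_prop) hcs.mul_right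
    (fun y => (hasDerivAt_psi y).const_mul M) (contDiff_psi'.continuous.const_mul M)
  have hpc := contDiff_psi.continuous
  have hpc' := contDiff_psi'.continuous
  have hic : Continuous (fun y => (((1 + |M| * s y ^ 2)⁻¹ : ℝ) : ℂ)) :=
    Complex.continuous_ofReal.comp (Continuous.inv₀ (by fun_prop) fun y => (hpos y).ne')
  have split : ∫ y, h y * ee (M * psi y) = (∫ y, h y * (((1 + |M| * s y ^ 2)⁻¹ : ℝ) : ℂ) *
      ee (M * psi y)) - (2 * Real.pi * Complex.I)⁻¹ *
        ∫ y, (h' y * g y + h y * g' y) * ee (M * psi y) := by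
    rw [sub_eq_add_neg, ← mul_neg, ← ibp, ← integral_const_mul, ← integral_add]
    · refine integral_congr_ae (Filter.Eventually.of_forall fun y => ?_)
      dsimp only
      have key : (1 : ℝ) = (1 + |M| * s y ^ 2)⁻¹ + g y * (M * psi' y) := by
        have := hpos y
        have e1 : Real.exp (-y) * Real.exp y = 1 := by rw [← Real.exp_add]; simp
        have e2 : g y * (M * psi' y) = |M| * s y ^ 2 / (1 + |M| * s y ^ 2) := by
          simp only [hg, psi']
          change _ * (M * (3 * Real.exp y * s y)) = _
          field_simp
          linear_combination (s y ^ 2) * e1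
        rw [e2]; field_simp
      have key' : (1 : ℂ) = (((1 + |M| * s y ^ 2)⁻¹ : ℝ) : ℂ) + g y * ((M * psi' y : ℝ) : ℂ) := by
        exact_mod_cast key
      have hpi : (2 * Real.pi * Complex.I : ℂ) ≠ 0 := Complex.two_pi_I_ne_zero
      calc h y * ee (M * psi y) = h y * ee (M * psi y) * 1 := by ring
        _ = _ := by rw [key']; field_simp
    · exact ((hch.mul hic).mul (by fun_prop)).integrable_of_hasCompactSupport
        hcs.mul_right.mul_right
    · refine (Continuous.integrable_of_hasCompactSupport ?_ hcs.mul_right.mul_right).const_mul _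
      fun_prop
  have hint1 : Integrable (fun y => (1 + |M| * (c * y) ^ 2)⁻¹) := by
    have := (integrable_inv_one_add_sq).comp_mul_left' (R := √|M| * c) (by positivity)
    refine this.congr (Filter.Eventually.of_forall fun y => ?_)
    dsimp only
    rw [mul_assoc, mul_pow, Real.sq_sqrt hM0.le]
  have hval1 : ∫ y, (1 + |M| * (c * y) ^ 2)⁻¹ = (√|M| * c)⁻¹ * Real.pi := by
    rw [← integral_univ_inv_one_add_sq]
    have := Measure.integral_comp_mul_left (fun y : ℝ => (1 + y ^ 2)⁻¹) (√|M| * c)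
    rw [abs_of_pos (by positivity : 0 < (√|M| * c)⁻¹), smul_eq_mul] at this
    rw [← this]
    congr 1; ext y
    rw [mul_assoc (√|M|), mul_pow (√|M|), Real.sq_sqrt hM0.le]
  have hint2 : Integrable (fun y => (Icc (-B) B).indicator (fun _ => (√|M|)⁻¹) y) :=
    (integrable_indicator_iff measurableSet_Icc).2 (by simp)
  have hval2 : ∫ y, (Icc (-B) B).indicator (fun _ => (√|M|)⁻¹) y = 2 * B * (√|M|)⁻¹ := by
    rw [integral_indicator measurableSet_Icc, setIntegral_const]
    simp only [Real.volume_real_Icc, smul_eq_mul]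
    rw [max_eq_left (by linarith)]; ring
  have hbound : ∀ y, ‖h y * (((1 + |M| * s y ^ 2)⁻¹ : ℝ) : ℂ)‖ + ‖h' y * g y + h y * g' y‖ ≤
      H * (K1 * (1 + |M| * (c * y) ^ 2)⁻¹ + K2 * (Icc (-B) B).indicator (fun _ => (√|M|)⁻¹) y) := by
    intro y
    by_cases hy : y ∈ Icc (-B) B
    · have hy' : |y| ≤ B := abs_le.2 hy
      rw [indicator_of_mem hy]
      have i1 : (1 + |M| * s y ^ 2)⁻¹ ≤ (1 + |M| * (c * y) ^ 2)⁻¹ := by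
        gcongr (1 + |M| * ?_)⁻¹
        rw [← sq_abs (s y), ← sq_abs (c * y), abs_mul, abs_of_pos hc0]
        gcongr
        exact exp_mul_abs_le_abs_exp_sq_sub_one hy'
      have i2 := div_one_add_mul_sq_le (s := s y) hM0
      have e1 : Real.exp (-y) ≤ K2 := Real.exp_le_exp.2 (by linarith [hy.1])
      have e2 : Real.exp y ≤ K2 := Real.exp_le_exp.2 hy.2
      have sg : |(|M| / M / 3)| = 1 / 3 := by
        rw [abs_div, abs_div, abs_abs, div_self hM0.ne']; norm_num
      have bg : |g y| ≤ 1 / 3 * (K2 * (√|M|)⁻¹) := by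
        simp only [hg]
        rw [abs_mul, sg, abs_mul, abs_div, abs_of_pos (hpos y), abs_of_pos (Real.exp_pos _)]
        gcongr
      -- The derivative of s/(1 + |M|s²) is not O(|M|^(-1/2)) pointwise, but it is dominated by (1 +
      -- |M|s²)⁻¹, whose integral is of that size.
      have bg' : |g' y| ≤ 1 / 3 * (K2 * (√|M|)⁻¹ + 2 * K2 ^ 3 * (1 + |M| * s y ^ 2)⁻¹) := by
        simp only [hg']
        rw [abs_mul, sg]
        gcongr
        refine (abs_add_le _ _).trans (add_le_add ?_ ?_)
        · rw [abs_mul, abs_div, abs_of_pos (hpos y), abs_neg, abs_of_pos (Real.exp_pos _)]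
          gcongr
        · rw [abs_mul, abs_div, abs_mul, abs_of_pos (Real.exp_pos _),
            abs_of_pos (by positivity : 0 < 2 * Real.exp y ^ 2),
            abs_of_pos (by positivity : 0 < (1 + |M| * s y ^ 2) ^ 2)]
          have j1 : |1 - |M| * s y ^ 2| ≤ 1 + |M| * s y ^ 2 := by
            have : 0 ≤ |M| * s y ^ 2 := by positivity
            rw [abs_le]; constructor <;> linarith
          have hp := hpos y
          calc Real.exp (-y) * (2 * Real.exp y ^ 2 * |1 - |M| * s y ^ 2| / (1 + |M| * s y ^ 2) ^ 2)
              ≤ K2 * (2 * K2 ^ 2 * (1 + |M| * s y ^ 2) / (1 + |M| * s y ^ 2) ^ 2) := by gcongr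
            _ = _ := by field_simp
      have n1 : ‖h y * (((1 + |M| * s y ^ 2)⁻¹ : ℝ) : ℂ)‖ ≤ H * (1 + |M| * s y ^ 2)⁻¹ := by
        rw [norm_mul, Complex.norm_real, Real.norm_eq_abs, abs_of_pos (inv_pos.2 (hpos y))]
        exact mul_le_mul_of_nonneg_right (hH y) (inv_pos.2 (hpos y)).le
      have n2 : ‖h' y * g y + h y * g' y‖ ≤ H * |g y| + H * |g' y| := by
        refine (norm_add_le _ _).trans ?_
        rw [norm_mul, norm_mul, Complex.norm_real, Complex.norm_real, Real.norm_eq_abs,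
          Real.norm_eq_abs]
        gcongr
        · exact hH' y
        · exact hH y
      have hi0 : 0 ≤ (√|M|)⁻¹ := by positivity
      calc _ ≤ H * (1 + |M| * s y ^ 2)⁻¹ + (H * (1 / 3 * (K2 * (√|M|)⁻¹)) +
            H * (1 / 3 * (K2 * (√|M|)⁻¹ + 2 * K2 ^ 3 * (1 + |M| * s y ^ 2)⁻¹))) :=
          add_le_add n1 (n2.trans (by gcongr))
        _ = H * ((1 + 2 / 3 * K2 ^ 3) * (1 + |M| * s y ^ 2)⁻¹ + 2 / 3 * K2 * (√|M|)⁻¹) := by ring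
        _ ≤ H * (K1 * (1 + |M| * (c * y) ^ 2)⁻¹ + K2 * (√|M|)⁻¹) := by
          have hp := hpos y
          gcongr
          · rw [hK1]
            have : 0 < K2 ^ 3 := by positivity
            linarith
          · linarith
    · have z1 : h y = 0 := image_eq_zero_of_notMem_tsupport fun hx => hy (hsupp hx)
      have z2 : h' y = 0 := image_eq_zero_of_notMem_tsupport fun hx => hy (hsupp' hx)
      rw [z1, z2, indicator_of_notMem hy]
      simp only [zero_mul, norm_zero, add_zero, mul_zero]
      positivity
  have hintb := ((hint1.const_mul K1).add (hint2.const_mul K2)).const_mul H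
  have hci : HasCompactSupport (fun y => h' y * (g y : ℂ) + h y * g' y) :=
    (HasCompactSupport.of_support_subset_isCompact isCompact_Icc
      ((subset_tsupport h').trans hsupp')).mul_right.add hcs.mul_right
  have ii1 : Integrable fun y => ‖h y * (((1 + |M| * s y ^ 2)⁻¹ : ℝ) : ℂ)‖ :=
    ((hch.mul hic).integrable_of_hasCompactSupport hcs.mul_right).norm
  have ii2 : Integrable fun y => ‖h' y * g y + h y * g' y‖ :=
    (Continuous.integrable_of_hasCompactSupport (by fun_prop) hci).norm
  have fin : ‖∫ y, h y * ee (M * psi y)‖ ≤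
      H * (K1 * ((√|M| * c)⁻¹ * Real.pi) + K2 * (2 * B * (√|M|)⁻¹)) := by
    rw [split]
    refine (norm_sub_le _ _).trans ?_
    have a1 : ‖∫ y, h y * (((1 + |M| * s y ^ 2)⁻¹ : ℝ) : ℂ) * ee (M * psi y)‖ ≤
        ∫ y, ‖h y * (((1 + |M| * s y ^ 2)⁻¹ : ℝ) : ℂ)‖ := by
      refine (norm_integral_le_integral_norm _).trans (le_of_eq ?_)
      simp [norm_ee]
    have a2 : ‖(2 * Real.pi * Complex.I)⁻¹ *
        ∫ y, (h' y * g y + h y * g' y) * ee (M * psi y)‖ ≤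
        ∫ y, ‖h' y * g y + h y * g' y‖ := by
      rw [norm_mul]
      have p1 : ‖(2 * Real.pi * Complex.I : ℂ)⁻¹‖ ≤ 1 := by
        rw [norm_inv]
        simp only [norm_mul, Complex.norm_I, Complex.norm_real, Real.norm_eq_abs, mul_one,
          Complex.norm_ofNat, abs_of_pos Real.pi_pos]
        exact inv_le_one_of_one_le₀ (by linarith [Real.pi_gt_three])
      have p2 : ‖∫ y, (h' y * g y + h y * g' y) * ee (M * psi y)‖ ≤
          ∫ y, ‖h' y * g y + h y * g' y‖ := by
        refine (norm_integral_le_integral_norm _).trans (le_of_eq ?_)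
        simp only [norm_mul, norm_ee, mul_one]
      calc _ ≤ 1 * _ := mul_le_mul_of_nonneg_right p1 (norm_nonneg _)
        _ ≤ _ := by rw [one_mul]; exact p2
    refine (add_le_add a1 a2).trans ?_
    rw [← integral_add ii1 ii2, ← hval1, ← hval2, ← integral_const_mul, ← integral_const_mul,
      ← integral_add (hint1.const_mul K1) (hint2.const_mul K2), ← integral_const_mul]
    exact integral_mono (ii1.add ii2) hintb hbound
  calc ‖∫ y, h y * ee (M * psi y)‖ * √|M| ≤
      H * (K1 * ((√|M| * c)⁻¹ * Real.pi) + K2 * (2 * B * (√|M|)⁻¹)) * √|M| := by gcongr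
    _ = _ := by field_simp

end CubicDelta

end

/-! ### Uniform families, integration by parts against e(κ exp x), stationary phase -/

open scoped ContDiff

noncomputable section

namespace CubicDelta

open MeasureTheory Set

/-- Differentiation under the integral sign for integrands of locally uniform compact support. -/
theorem hasDerivAt_integral_of_compact {E : Type*} [NormedAddCommGroup E] [MeasurableSpace E]
    [BorelSpace E] [SecondCountableTopology E] {μ : Measure E} [IsFiniteMeasureOnCompacts μ]
    {H H' : ℝ → E → ℂ} {U : Set ℝ} (hU : IsOpen U) {x₀ : ℝ} (hx₀ : x₀ ∈ U) {K : Set E}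
    (hK : IsCompact K) (hsupp : ∀ x ∈ U, ∀ y, y ∉ K → H x y = 0)
    (hd : ∀ x ∈ U, ∀ y, HasDerivAt (fun x => H x y) (H' x y) x)
    (hc' : ContinuousOn (fun p : ℝ × E => H' p.1 p.2) (U ×ˢ univ))
    (hc : ∀ x ∈ U, Continuous (H x)) :
    HasDerivAt (fun x => ∫ y, H x y ∂μ) (∫ y, H' x₀ y ∂μ) x₀ := by
  have hz : ∀ x ∈ U, ∀ y, y ∉ K → H' x y = 0 := by
    intro x hx y hy
    refine (hd x hx y).unique ?_
    refine (hasDerivAt_const x (0 : ℂ)).congr_of_eventuallyEq ?_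
    filter_upwards [hU.mem_nhds hx] with z hz
    exact hsupp z hz y hy
  obtain ⟨ε, hε, hb⟩ := Metric.nhds_basis_closedBall.mem_iff.1 (hU.mem_nhds hx₀)
  have hcomp : IsCompact (Metric.closedBall x₀ ε ×ˢ K) := (isCompact_closedBall x₀ ε).prod hK
  obtain ⟨C, hC⟩ := hcomp.exists_bound_of_continuousOn
    (hc'.mono (prod_mono hb (subset_univ K)))
  have hcx : ∀ x ∈ U, Continuous (H' x) := fun x hx => by
    have := hc'.comp_continuous (f := fun y : E => (x, y)) (by fun_prop) fun y => ⟨hx, mem_univ _⟩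
    exact this
  refine (hasDerivAt_integral_of_dominated_loc_of_deriv_le (F := H) (F' := H')
    (bound := K.indicator fun _ => C) (Metric.closedBall_mem_nhds x₀ hε) ?_ ?_ ?_ ?_ ?_ ?_).2
  · filter_upwards [hU.mem_nhds hx₀] with x hx
    exact (hc x hx).aestronglyMeasurable
  · exact (hc x₀ hx₀).integrable_of_hasCompactSupport (HasCompactSupport.intro hK (hsupp x₀ hx₀))
  · exact (hcx x₀ hx₀).aestronglyMeasurable
  · refine Filter.Eventually.of_forall fun y x hx => ?_
    by_cases hy : y ∈ K
    · rw [indicator_of_mem hy]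
      exact hC (x, y) ⟨hx, hy⟩
    · rw [indicator_of_notMem hy, hz x (hb hx) y hy, norm_zero]
  · exact (integrable_indicator_iff hK.measurableSet).2
      (by simp [hK.measure_lt_top])
  · exact Filter.Eventually.of_forall fun y x hx => hd x (hb hx) y

/-! Families of smooth functions on the line, with all derivatives uniformly bounded on a set. -/

/-- A family of smooth functions, all of whose derivatives are `O(W p)` on `K`. -/
def UnifSmooth {P : Type*} (K : Set ℝ) (W : P → ℝ) (f : P → ℝ → ℂ) : Prop :=
  (∀ p, ContDiff ℝ ∞ (f p)) ∧
    ∀ j : ℕ, ∃ C : ℝ, ∀ p, ∀ x ∈ K, ‖iteratedDeriv j (f p) x‖ ≤ C * W p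

namespace UnifSmooth

variable {P : Type*} {K : Set ℝ} {W W₁ W₂ : P → ℝ} {f g : P → ℝ → ℂ}

lemma deriv (hf : UnifSmooth K W f) : UnifSmooth K W (fun p => deriv (f p)) := by
  refine ⟨fun p => (contDiff_infty_iff_deriv.1 (hf.1 p)).2, fun j => ?_⟩
  obtain ⟨C, hC⟩ := hf.2 (j + 1)
  refine ⟨C, fun p x hx => ?_⟩
  rw [← iteratedDeriv_succ']
  exact hC p x hx

lemma of_isCompact (hK : IsCompact K) {f : ℝ → ℂ} (hf : ContDiff ℝ ∞ f) :
    UnifSmooth K (fun _ : P => 1) (fun _ => f) := by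
  refine ⟨fun _ => hf, fun j => ?_⟩
  obtain ⟨C, hC⟩ := hK.exists_bound_of_continuousOn
    (hf.continuous_iteratedDeriv j (by exact_mod_cast le_top)).continuousOn
  exact ⟨C, fun _ x hx => by simpa using hC x hx⟩

lemma mul (hf : UnifSmooth K W₁ f) (hg : UnifSmooth K W₂ g) :
    UnifSmooth K (fun p => W₁ p * W₂ p) (fun p x => f p x * g p x) := by
  refine ⟨fun p => (hf.1 p).mul (hg.1 p), fun j => ?_⟩
  induction j generalizing f g with
  | zero =>
    obtain ⟨C, hC⟩ := hf.2 0
    obtain ⟨D, hD⟩ := hg.2 0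
    refine ⟨C * D, fun p x hx => ?_⟩
    have h1 := hC p x hx
    have h2 := hD p x hx
    simp only [iteratedDeriv_zero] at h1 h2 ⊢
    rw [norm_mul]
    calc _ ≤ (C * W₁ p) * (D * W₂ p) :=
          mul_le_mul h1 h2 (norm_nonneg _) ((norm_nonneg _).trans h1)
      _ = _ := by ring
  | succ j ih =>
    obtain ⟨C, hC⟩ := ih hf.deriv hg
    obtain ⟨D, hD⟩ := ih hf hg.deriv
    refine ⟨C + D, fun p x hx => ?_⟩
    have e : _root_.deriv (fun x => f p x * g p x) =
        fun x => _root_.deriv (f p) x * g p x + f p x * _root_.deriv (g p) x := by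
      ext y
      exact (((hf.1 p).differentiable (by simp) y).hasDerivAt.mul
        ((hg.1 p).differentiable (by simp) y).hasDerivAt).deriv
    rw [iteratedDeriv_succ', e, iteratedDeriv_fun_add, add_mul]
    · exact (norm_add_le _ _).trans (add_le_add (hC p x hx) (hD p x hx))
    · exact ((hf.deriv.1 p).mul (hg.1 p)).contDiffAt.of_le (by exact_mod_cast le_top)
    · exact ((hf.1 p).mul (hg.deriv.1 p)).contDiffAt.of_le (by exact_mod_cast le_top)

lemma of_eq (hf : UnifSmooth K W₁ f) (h : ∀ p, W₁ p = W₂ p) (h' : ∀ p, f p = g p) :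
    UnifSmooth K W₂ g := by
  obtain rfl : W₁ = W₂ := funext h
  obtain rfl : f = g := funext h'
  exact hf

lemma smooth_mul (hK : IsCompact K) {u : ℝ → ℂ} (hu : ContDiff ℝ ∞ u) (hf : UnifSmooth K W f) :
    UnifSmooth K W (fun p x => u x * f p x) :=
  ((of_isCompact (P := P) hK hu).mul hf).of_eq (fun _ => one_mul _) fun _ => rfl

lemma prod {ι : Type*} (hK : IsCompact K) (s : Finset ι) {W : ι → P → ℝ} {f : ι → P → ℝ → ℂ}
    (h : ∀ i ∈ s, UnifSmooth K (W i) (f i)) :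
    UnifSmooth K (fun p => ∏ i ∈ s, W i p) (fun p x => ∏ i ∈ s, f i p x) := by
  classical
  induction s using Finset.induction_on with
  | empty =>
    simpa using of_isCompact (P := P) hK (contDiff_const (c := (1 : ℂ)))
  | insert i s hi ih =>
    refine ((h i (Finset.mem_insert_self _ _)).mul
      (ih fun j hj => h j (Finset.mem_insert_of_mem hj))).of_eq (fun p => ?_) fun p => ?_
    · rw [Finset.prod_insert hi]
    · ext x; rw [Finset.prod_insert hi]

end UnifSmooth

/-- Repeated integration by parts against `e(κ exp x)`. -/
theorem integral_ee_exp_decay {P : Type*} {p q : ℝ} {W : P → ℝ} (hW : ∀ p, 0 ≤ W p) (N : ℕ) :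
    ∀ f : P → ℝ → ℂ, UnifSmooth (Icc p q) W f → (∀ r, tsupport (f r) ⊆ Icc p q) →
    ∃ C : ℝ, 0 ≤ C ∧ ∀ r (κ : ℝ), ‖∫ x, f r x * ee (κ * Real.exp x)‖ * |κ| ^ N ≤ C * W r := by
  have hcs : ∀ (g : ℝ → ℂ), tsupport g ⊆ Icc p q → HasCompactSupport g := fun g hg =>
    HasCompactSupport.of_support_subset_isCompact isCompact_Icc ((subset_tsupport g).trans hg)
  induction N with
  | zero =>
    intro f hf hs
    obtain ⟨C, hC⟩ := hf.2 0
    refine ⟨max C 0 * max (q - p) 0, by positivity, fun r κ => ?_⟩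
    have e : ∫ x, f r x * ee (κ * Real.exp x) = ∫ x in Icc p q, f r x * ee (κ * Real.exp x) := by
      refine (setIntegral_eq_integral_of_forall_compl_eq_zero fun x hx => ?_).symm
      rw [image_eq_zero_of_notMem_tsupport fun h => hx (hs r h), zero_mul]
    rw [pow_zero, mul_one, e]
    refine (norm_setIntegral_le_of_norm_le_const (C := max C 0 * W r) (by simp) ?_).trans
      (le_of_eq ?_)
    · intro x hx
      rw [norm_mul, norm_ee, mul_one]
      have := hC r x hx
      simp only [iteratedDeriv_zero] at this
      exact this.trans (mul_le_mul_of_nonneg_right (le_max_left _ _) (hW r))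
    · rw [Real.volume_real_Icc]; ring
  | succ N ih =>
    intro f hf hs
    -- Division by the derivative of exp is multiplication by the smooth function exp(-x), so no
    -- stationary point intervenes and uniform smoothness persists.
    set g : P → ℝ → ℂ := fun r x => ((Real.exp (-x) : ℝ) : ℂ) * f r x with hg
    have hexp : ContDiff ℝ ∞ (fun x : ℝ => ((Real.exp (-x) : ℝ) : ℂ)) :=
      Complex.ofRealCLM.contDiff.comp (Real.contDiff_exp.comp contDiff_neg)
    have hgu : UnifSmooth (Icc p q) W g := hf.smooth_mul isCompact_Icc hexp
    have hgs : ∀ r, tsupport (g r) ⊆ Icc p q := fun r =>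
      (tsupport_mul_subset_right (f := fun x : ℝ => ((Real.exp (-x) : ℝ) : ℂ))).trans (hs r)
    obtain ⟨C, hC0, hC⟩ := ih _ hgu.deriv fun r => tsupport_deriv_subset.trans (hgs r)
    refine ⟨C, hC0, fun r κ => ?_⟩
    have ibp := integral_mul_deriv_ee (u := g r) (u' := deriv (g r))
      (fun x => ((hgu.1 r).differentiable (by simp) x).hasDerivAt)
      (hgu.deriv.1 r).continuous (hcs _ (hgs r))
      (fun x => (Real.hasDerivAt_exp x).const_mul κ) (by fun_prop)
    have e : 2 * Real.pi * Complex.I * κ * ∫ x, f r x * ee (κ * Real.exp x) =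
        - ∫ x, deriv (g r) x * ee (κ * Real.exp x) := by
      rw [← ibp, ← integral_const_mul]
      refine integral_congr_ae (Filter.Eventually.of_forall fun x => ?_)
      simp only [hg]
      have : ((Real.exp (-x) : ℝ) : ℂ) * ((Real.exp x : ℝ) : ℂ) = 1 := by
        rw [← Complex.ofReal_mul, ← Real.exp_add]; simp
      rw [Complex.ofReal_mul]
      linear_combination (-(2 * Real.pi * Complex.I * κ * f r x * ee (κ * Real.exp x))) * this
    have e2 := congrArg norm e
    rw [norm_neg] at e2
    simp only [norm_mul, Complex.norm_I, Complex.norm_real, Real.norm_eq_abs, mul_one,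
      Complex.norm_ofNat, abs_of_pos Real.pi_pos] at e2
    have h0 : 0 ≤ |κ| * ‖∫ x, f r x * ee (κ * Real.exp x)‖ := by positivity
    have e3 : |κ| * ‖∫ x, f r x * ee (κ * Real.exp x)‖ ≤
        ‖∫ x, deriv (g r) x * ee (κ * Real.exp x)‖ := by
      rw [← e2]
      nlinarith [Real.pi_gt_three]
    calc ‖∫ x, f r x * ee (κ * Real.exp x)‖ * |κ| ^ (N + 1) =
        (|κ| * ‖∫ x, f r x * ee (κ * Real.exp x)‖) * |κ| ^ N := by ring
      _ ≤ ‖∫ x, deriv (g r) x * ee (κ * Real.exp x)‖ * |κ| ^ N := by gcongr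
      _ ≤ C * W r := hC r κ

/-! The stationary phase integral. -/

/-- `∫ f(y + η) v(y) e(Λ exp η ψ(y)) dy`. -/
def statInt (f v : ℝ → ℂ) (Λ η : ℝ) : ℂ := ∫ y, f (y + η) * v y * ee (Λ * Real.exp η * psi y)

lemma hasCompactSupport_comp_add {f : ℝ → ℂ} (hf : HasCompactSupport f) (η : ℝ) :
    HasCompactSupport (fun y => f (y + η)) :=
  hf.comp_homeomorph (Homeomorph.addRight η)

/-- Differentiating the phase brings down Λ exp(η) ψ, apparently a loss of Λ. Writing ψ = `psiQuot`
· ψ' and integrating by parts removes it, leaving integrals of the same type with new f and v. Hence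
η-derivatives to all orders obey the same bound in Λ. -/
lemma hasDerivAt_statInt {f v : ℝ → ℂ} (hf : ContDiff ℝ ∞ f) (hfc : HasCompactSupport f)
    (hv : ContDiff ℝ ∞ v) (Λ η : ℝ) :
    HasDerivAt (statInt f v Λ) (statInt (deriv f) v Λ η +
      (-statInt f (deriv fun y => v y * (psiQuot y : ℂ)) Λ η +
        -statInt (deriv f) (fun y => v y * (psiQuot y : ℂ)) Λ η)) η := by
  set w : ℝ → ℂ := fun y => v y * (psiQuot y : ℂ) with hw
  have hwc : ContDiff ℝ ∞ w := hv.mul (Complex.ofRealCLM.contDiff.comp contDiff_psiQuot)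
  have hf' : ContDiff ℝ ∞ (deriv f) := (contDiff_infty_iff_deriv.1 hf).2
  have hw' : ContDiff ℝ ∞ (deriv w) := (contDiff_infty_iff_deriv.1 hwc).2
  have c1 := hf.continuous
  have c2 := hf'.continuous
  have c3 := hv.continuous
  have c4 := contDiff_psi.continuous
  have c5 := contDiff_psi'.continuous
  have c6 := hwc.continuous
  have c7 := hw'.continuous
  have hfd : ∀ x, HasDerivAt f (deriv f x) x := fun x =>
    (hf.differentiable (by simp) x).hasDerivAt
  have hwd : ∀ x, HasDerivAt w (deriv w x) x := fun x =>
    (hwc.differentiable (by simp) x).hasDerivAt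
  have hsh : ∀ y, HasDerivAt (fun y => f (y + η)) (deriv f (y + η)) y := fun y =>
    (hfd (y + η)).comp_add_const y η
  have hcη := hasCompactSupport_comp_add hfc η
  have hcη' := hasCompactSupport_comp_add hfc.deriv η
  obtain ⟨R, hR⟩ := hfc.isCompact.isBounded.exists_norm_le
  have main := hasDerivAt_integral_of_compact (μ := (volume : Measure ℝ))
    (H := fun η y => f (y + η) * v y * ee (Λ * Real.exp η * psi y))
    (H' := fun η y => deriv f (y + η) * v y * ee (Λ * Real.exp η * psi y) +
      f (y + η) * v y * (2 * Real.pi * Complex.I * ((Λ * Real.exp η * psi y : ℝ) : ℂ) *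
        ee (Λ * Real.exp η * psi y)))
    (Metric.isOpen_ball (x := η) (ε := 1)) (Metric.mem_ball_self one_pos)
    (isCompact_closedBall (0 : ℝ) (R + |η| + 1)) ?_ ?_ (Continuous.continuousOn (by fun_prop))
    (fun x _ => by fun_prop)
  · refine HasDerivAt.congr_deriv main ?_
    have ibp := integral_mul_deriv_ee (u := fun y => f (y + η) * w y)
      (u' := fun y => deriv f (y + η) * w y + f (y + η) * deriv w y)
      (fun y => (hsh y).mul (hwd y)) (by fun_prop) hcη.mul_right
      (fun y => (hasDerivAt_psi y).const_mul (Λ * Real.exp η)) (c5.const_mul _)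
    rw [integral_add]
    · rw [statInt]
      congr 1
      have e : ∫ y, f (y + η) * v y * (2 * Real.pi * Complex.I *
          ((Λ * Real.exp η * psi y : ℝ) : ℂ) * ee (Λ * Real.exp η * psi y)) =
          ∫ y, f (y + η) * w y * (2 * Real.pi * Complex.I *
            ((Λ * Real.exp η * psi' y : ℝ) : ℂ) * ee (Λ * Real.exp η * psi y)) := by
        refine integral_congr_ae (Filter.Eventually.of_forall fun y => ?_)
        dsimp only [hw]
        rw [← psiQuot_mul_psi']
        push_cast
        ring
      rw [e, ibp, ← neg_add, neg_inj, add_comm, statInt, statInt, ← integral_add]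
      · refine integral_congr_ae (Filter.Eventually.of_forall fun y => ?_)
        dsimp only
        ring
      · exact Continuous.integrable_of_hasCompactSupport (by fun_prop) hcη'.mul_right.mul_right
      · exact Continuous.integrable_of_hasCompactSupport (by fun_prop) hcη.mul_right.mul_right
    · exact Continuous.integrable_of_hasCompactSupport (by fun_prop) hcη'.mul_right.mul_right
    · exact Continuous.integrable_of_hasCompactSupport (by fun_prop) hcη.mul_right.mul_right
  · intro x hx y hy
    have : f (y + x) = 0 := by
      refine image_eq_zero_of_notMem_tsupport fun h => hy ?_
      have h1 := hR _ h
      rw [Real.norm_eq_abs] at h1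
      rw [Metric.mem_ball, Real.dist_eq] at hx
      rw [mem_closedBall_zero_iff, Real.norm_eq_abs]
      have h2 : |y| ≤ |y + x| + |x - η| + |η| := by
        calc |y| = |(y + x) - (x - η) - η| := by ring_nf
          _ ≤ _ := (abs_sub _ _).trans (by gcongr; exact abs_sub _ _)
      linarith
    simp [this]
  · intro x hx y
    have h1 : HasDerivAt (fun x => f (y + x)) (deriv f (y + x)) x :=
      (hfd (y + x)).comp_const_add y x
    have h2 := hasDerivAt_ee (((Real.hasDerivAt_exp x).const_mul Λ).mul_const (psi y))
    refine HasDerivAt.congr_deriv ((h1.mul_const (v y)).mul h2) ?_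
    ring

lemma contDiff_statInt (Λ : ℝ) (n : ℕ) : ∀ {f v : ℝ → ℂ}, ContDiff ℝ ∞ f → HasCompactSupport f →
    ContDiff ℝ ∞ v → ContDiff ℝ n (statInt f v Λ) := by
  induction n with
  | zero =>
    intro f v hf hfc hv
    exact contDiff_zero.2 (continuous_iff_continuousAt.2 fun η =>
      (hasDerivAt_statInt hf hfc hv Λ η).continuousAt)
  | succ n ih =>
    intro f v hf hfc hv
    have hw : ContDiff ℝ ∞ (fun y => v y * (psiQuot y : ℂ)) :=
      hv.mul (Complex.ofRealCLM.contDiff.comp contDiff_psiQuot)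
    have hf' : ContDiff ℝ ∞ (deriv f) := (contDiff_infty_iff_deriv.1 hf).2
    have hw' := (contDiff_infty_iff_deriv.1 hw).2
    rw [Nat.cast_succ, contDiff_succ_iff_deriv]
    refine ⟨fun η => (hasDerivAt_statInt hf hfc hv Λ η).differentiableAt, by simp, ?_⟩
    rw [funext fun η => (hasDerivAt_statInt hf hfc hv Λ η).deriv]
    exact (ih hf' hfc.deriv hv).add ((ih hf hfc hw').neg.add (ih hf' hfc.deriv hw).neg)

lemma contDiff_infty_statInt {f v : ℝ → ℂ} (hf : ContDiff ℝ ∞ f) (hfc : HasCompactSupport f)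
    (hv : ContDiff ℝ ∞ v) (Λ : ℝ) : ContDiff ℝ ∞ (statInt f v Λ) :=
  contDiff_infty.2 fun n => contDiff_statInt Λ n hf hfc hv

/-- Van der Corput with M = Λ exp η; since |η| ≤ R, this M is comparable to Λ, at the cost of
exp|R|. -/
lemma norm_statInt_le {f v : ℝ → ℂ} (hf : ContDiff ℝ ∞ f) (hfc : HasCompactSupport f)
    (hv : ContDiff ℝ ∞ v) (R : ℝ) :
    ∃ C : ℝ, 0 ≤ C ∧ ∀ Λ η : ℝ, Λ ≠ 0 → |η| ≤ R → ‖statInt f v Λ η‖ ≤ C * (√|Λ|)⁻¹ := by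
  obtain ⟨S, hS⟩ := hfc.isCompact.isBounded.exists_norm_le
  -- The translates f(· + η) with |η| ≤ R have supports in one interval [-B, B]; the maximum with 1
  -- keeps it nondegenerate.
  set B := max (|S| + |R|) 1 with hB
  have hB0 : 0 < B := lt_of_lt_of_le one_pos (le_max_right _ _)
  obtain ⟨C, hC0, hC⟩ := vanDerCorput_psi hB0
  have hf' : ContDiff ℝ ∞ (deriv f) := (contDiff_infty_iff_deriv.1 hf).2
  have hv' : ContDiff ℝ ∞ (deriv v) := (contDiff_infty_iff_deriv.1 hv).2
  obtain ⟨F, hF⟩ := hfc.exists_bound_of_continuous hf.continuous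
  obtain ⟨F', hF'⟩ := hfc.deriv.exists_bound_of_continuous hf'.continuous
  obtain ⟨V, hV⟩ := (isCompact_Icc (a := -B) (b := B)).exists_bound_of_continuousOn
    hv.continuous.continuousOn
  obtain ⟨V', hV'⟩ := (isCompact_Icc (a := -B) (b := B)).exists_bound_of_continuousOn
    hv'.continuous.continuousOn
  have hF0 : 0 ≤ F := (norm_nonneg _).trans (hF 0)
  have hF0' : 0 ≤ F' := (norm_nonneg _).trans (hF' 0)
  have h0 : (0 : ℝ) ∈ Icc (-B) B := ⟨by linarith, hB0.le⟩
  have hV0 : 0 ≤ V := (norm_nonneg _).trans (hV 0 h0)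
  have hV0' : 0 ≤ V' := (norm_nonneg _).trans (hV' 0 h0)
  refine ⟨C * (F * V + F' * V + F * V') * Real.exp (|R|), by positivity, fun Λ η hΛ hη => ?_⟩
  have hη' : |η| ≤ |R| := hη.trans (le_abs_self _)
  have hsupp : tsupport (fun y => f (y + η)) ⊆ Icc (-B) B := by
    refine closure_minimal ?_ isClosed_Icc
    intro y hy
    have h1 := hS _ (subset_tsupport f hy)
    rw [Real.norm_eq_abs] at h1
    have h2 : |y| ≤ |y + η| + |η| := by
      calc |y| = |(y + η) - η| := by ring_nf
        _ ≤ _ := abs_sub _ _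
    exact abs_le.1 (h2.trans (le_trans (by linarith [le_abs_self S]) (le_max_left _ _)))
  have hsupp2 : tsupport (fun y => f (y + η) * v y) ⊆ Icc (-B) B :=
    tsupport_mul_subset_left.trans hsupp
  have hd : ∀ y, HasDerivAt (fun y => f (y + η) * v y)
      (deriv f (y + η) * v y + f (y + η) * deriv v y) y := fun y =>
    ((hf.differentiable (by simp) (y + η)).hasDerivAt.comp_add_const y η).mul
      (hv.differentiable (by simp) y).hasDerivAt
  have c1 := hf.continuous
  have c2 := hf'.continuous
  have c3 := hv.continuous
  have c4 := hv'.continuous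
  have hb : ∀ y, ‖f (y + η) * v y‖ ≤ F * V + F' * V + F * V' := by
    intro y
    by_cases hy : y ∈ Icc (-B) B
    · rw [norm_mul]
      have : ‖f (y + η)‖ * ‖v y‖ ≤ F * V := mul_le_mul (hF _) (hV y hy) (norm_nonneg _) hF0
      nlinarith [mul_nonneg hF0' hV0, mul_nonneg hF0 hV0']
    · rw [image_eq_zero_of_notMem_tsupport (f := fun y => f (y + η) * v y)
        fun h => hy (hsupp2 h), norm_zero]
      positivity
  have hb' : ∀ y, ‖deriv f (y + η) * v y + f (y + η) * deriv v y‖ ≤ F * V + F' * V + F * V' := by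
    intro y
    by_cases hy : y ∈ Icc (-B) B
    · have h1 : ‖deriv f (y + η)‖ * ‖v y‖ ≤ F' * V :=
        mul_le_mul (hF' _) (hV y hy) (norm_nonneg _) hF0'
      have h2 : ‖f (y + η)‖ * ‖deriv v y‖ ≤ F * V' :=
        mul_le_mul (hF _) (hV' y hy) (norm_nonneg _) hF0
      refine (norm_add_le _ _).trans ?_
      rw [norm_mul, norm_mul]
      nlinarith [mul_nonneg hF0 hV0]
    · have h1 : deriv (fun y => f (y + η) * v y) y = 0 :=
        image_eq_zero_of_notMem_tsupport fun h => hy (hsupp2 (tsupport_deriv_subset h))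
      rw [(hd y).deriv] at h1
      rw [h1, norm_zero]
      positivity
  have hM : Λ * Real.exp η ≠ 0 := mul_ne_zero hΛ (Real.exp_pos _).ne'
  have key := hC _ _ _ (Λ * Real.exp η) hd (by fun_prop) hsupp2 hb hb' hM
  have hsΛ : 0 < √|Λ| := Real.sqrt_pos.2 (abs_pos.2 hΛ)
  have hs : √|Λ| ≤ √|Λ * Real.exp η| * Real.exp |R| := by
    have h1 : √|Λ * Real.exp η| = √|Λ| * √(Real.exp η) := by
      rw [abs_mul, abs_of_pos (Real.exp_pos _), Real.sqrt_mul (abs_nonneg _)]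
    have h2 : 1 ≤ √(Real.exp η) * Real.exp |R| := by
      rw [← Real.exp_half, ← Real.exp_add]
      refine Real.one_le_exp ?_
      linarith [neg_abs_le η, abs_nonneg η]
    rw [h1, mul_assoc]
    exact le_mul_of_one_le_right hsΛ.le h2
  rw [← div_eq_mul_inv, le_div_iff₀ hsΛ]
  calc ‖statInt f v Λ η‖ * √|Λ| ≤ ‖statInt f v Λ η‖ * (√|Λ * Real.exp η| * Real.exp |R|) := by
        gcongr
    _ = (‖statInt f v Λ η‖ * √|Λ * Real.exp η|) * Real.exp |R| := by ring
    _ ≤ (C * (F * V + F' * V + F * V')) * Real.exp |R| :=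
        mul_le_mul_of_nonneg_right key (Real.exp_pos _).le

/-- The stationary phase integrals are `O(|Λ| ^ (-1/2))`, with all derivatives. -/
theorem norm_iteratedDeriv_statInt_le (R : ℝ) (j : ℕ) : ∀ {f v : ℝ → ℂ}, ContDiff ℝ ∞ f →
    HasCompactSupport f → ContDiff ℝ ∞ v → ∃ C : ℝ, 0 ≤ C ∧ ∀ Λ η : ℝ, Λ ≠ 0 → |η| ≤ R →
      ‖iteratedDeriv j (statInt f v Λ) η‖ ≤ C * (√|Λ|)⁻¹ := by
  induction j with
  | zero =>
    intro f v hf hfc hv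
    simpa using norm_statInt_le hf hfc hv R
  | succ j ih =>
    intro f v hf hfc hv
    have hw : ContDiff ℝ ∞ (fun y => v y * (psiQuot y : ℂ)) :=
      hv.mul (Complex.ofRealCLM.contDiff.comp contDiff_psiQuot)
    have hf' : ContDiff ℝ ∞ (deriv f) := (contDiff_infty_iff_deriv.1 hf).2
    have hw' := (contDiff_infty_iff_deriv.1 hw).2
    obtain ⟨C1, p1, h1⟩ := ih hf' hfc.deriv hv
    obtain ⟨C2, p2, h2⟩ := ih hf hfc hw'
    obtain ⟨C3, p3, h3⟩ := ih hf' hfc.deriv hw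
    refine ⟨C1 + (C2 + C3), by positivity, fun Λ η hΛ hη => ?_⟩
    have d1 := contDiff_statInt Λ j hf' hfc.deriv hv
    have d2 := contDiff_statInt Λ j hf hfc hw'
    have d3 := contDiff_statInt Λ j hf' hfc.deriv hw
    rw [iteratedDeriv_succ', funext fun η => (hasDerivAt_statInt hf hfc hv Λ η).deriv,
      iteratedDeriv_fun_add d1.contDiffAt (d2.neg.add d3.neg).contDiffAt,
      iteratedDeriv_fun_add d2.neg.contDiffAt d3.neg.contDiffAt, iteratedDeriv_fun_neg,
      iteratedDeriv_fun_neg, add_mul, add_mul]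
    refine (norm_add_le _ _).trans (add_le_add (h1 Λ η hΛ hη) ((norm_add_le _ _).trans ?_))
    rw [norm_neg, norm_neg]
    exact add_le_add (h2 Λ η hΛ hη) (h3 Λ η hΛ hη)

end CubicDelta

end

/-! ### Cubic integrals: critical points and the nonstationary range -/

noncomputable section

open scoped ContDiff SchwartzMap

namespace CubicDelta

open MeasureTheory Set

/-- The amplitude `χ(exp y) exp y` of the stationary phase integral attached to `χ`. -/
def expAmplitude (χ : ℝ → ℂ) (y : ℝ) : ℂ := χ (Real.exp y) * ((Real.exp y : ℝ) : ℂ)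

lemma contDiff_expAmplitude {χ : ℝ → ℂ} (hχ : ContDiff ℝ ∞ χ) :
    ContDiff ℝ ∞ (expAmplitude χ) :=
  (hχ.comp Real.contDiff_exp).mul (Complex.ofRealCLM.contDiff.comp Real.contDiff_exp)

lemma hasCompactSupport_expAmplitude {χ : ℝ → ℂ} {p q : ℝ} (hp : 0 < p)
    (hs : tsupport χ ⊆ Icc p q) : HasCompactSupport (expAmplitude χ) := by
  refine HasCompactSupport.intro (isCompact_Icc (a := Real.log p) (b := Real.log q)) fun y hy => ?_
  have : χ (Real.exp y) = 0 := by
    refine image_eq_zero_of_notMem_tsupport fun h => hy ?_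
    have h1 := hs h
    exact ⟨(Real.log_le_iff_le_exp hp).2 h1.1,
      (Real.le_log_iff_exp_le (hp.trans_le (h1.1.trans h1.2))).2 h1.2⟩
  simp [expAmplitude, this]

lemma integral_comp_exp_add (f : ℝ → ℂ) (η : ℝ) :
    ∫ x in Ioi (0 : ℝ), f x = ∫ y, ((Real.exp (y + η) : ℝ) : ℂ) * f (Real.exp (y + η)) := by
  have h1 : (fun y => Real.exp (y + η)) '' univ = Ioi 0 := by
    rw [image_univ]
    have : (fun y => Real.exp (y + η)) = Real.exp ∘ (Equiv.addRight η) := rfl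
    rw [this, (Equiv.addRight η).surjective.range_comp, Real.range_exp]
  have h2 := integral_image_eq_integral_abs_deriv_smul (s := univ)
    (f := fun y => Real.exp (y + η)) (f' := fun y => Real.exp (y + η)) MeasurableSet.univ
    (fun x _ => ((Real.hasDerivAt_exp (x + η)).comp_add_const x η).hasDerivWithinAt)
    (fun x _ y _ h => by simpa using h) f
  rw [h1] at h2
  rw [h2, setIntegral_univ]
  simp

/-- At a positive critical point `exp η`, the cubic integral is a stationary phase integral. -/
lemma cubicInt_eq_statInt {χ : ℝ → ℂ} {p q : ℝ} (hp : 0 < p) (hs : tsupport χ ⊆ Icc p q)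
    (A η : ℝ) :
    cubicInt χ A (3 * A * Real.exp η ^ 2) = ee (-2 * A * Real.exp η ^ 3) *
      statInt (expAmplitude χ) (fun _ => 1) (A * Real.exp η ^ 2) η := by
  have h1 : cubicInt χ A (3 * A * Real.exp η ^ 2) =
      ∫ x in Ioi (0 : ℝ), χ x * ee (A * x ^ 3 - 3 * A * Real.exp η ^ 2 * x) := by
    refine (setIntegral_eq_integral_of_forall_compl_eq_zero fun x hx => ?_).symm
    rw [image_eq_zero_of_notMem_tsupport fun h => hx (hp.trans_le (hs h).1), zero_mul]
  rw [h1, integral_comp_exp_add _ η, statInt, ← integral_const_mul]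
  refine integral_congr_ae (Filter.Eventually.of_forall fun y => ?_)
  dsimp only [expAmplitude, psi]
  -- With x₀ = exp η and x = x₀ exp y, the identity exp(3y) - 3 exp(y) = ψ(y) - 2 separates the
  -- critical value -2Ax₀³ from the normalized phase Ax₀³ψ(y).
  have : ee (A * Real.exp (y + η) ^ 3 - 3 * A * Real.exp η ^ 2 * Real.exp (y + η)) =
      ee (-2 * A * Real.exp η ^ 3) * ee (A * Real.exp η ^ 2 * Real.exp η *
        ((Real.exp y - 1) ^ 2 * (Real.exp y + 2))) := by
    rw [← ee_add, Real.exp_add]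
    congr 1
    ring
  rw [this]
  ring

/-- Three ways to have no critical point in [p, q]: the linear term dominates, the cubic term
dominates, or the two terms of the derivative have signs that prevent cancellation. The factor 2 to
spare in the first two leaves a definite proportion of |A| + |B|. -/
lemma exists_nonstationary_const {p q : ℝ} (hp : 0 < p) :
    ∃ c : ℝ, 0 < c ∧ ∀ A B : ℝ,
      (6 * q ^ 2 * |A| ≤ |B| ∨ 2 * |B| ≤ 3 * p ^ 2 * |A| ∨ A * B ≤ 0) →
      ∀ x ∈ Icc p q, c * (|A| + |B|) ≤ |3 * A * x ^ 2 - B| := by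
  refine ⟨min (1 / 4) (p ^ 2 / 2), by positivity, fun A B h x hx => ?_⟩
  set c := min (1 / 4) (p ^ 2 / 2) with hc
  have c1 : c ≤ 1 / 4 := min_le_left _ _
  have c2 : c ≤ p ^ 2 / 2 := min_le_right _ _
  have c0 : 0 < c := by positivity
  have hx1 : p ^ 2 ≤ x ^ 2 := by gcongr; exact hx.1
  have hx2 : x ^ 2 ≤ q ^ 2 := pow_le_pow_left₀ (hp.le.trans hx.1) hx.2 2
  have hA := abs_nonneg A
  have hB := abs_nonneg B
  have e : |3 * A * x ^ 2| = 3 * |A| * x ^ 2 := by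
    rw [abs_mul, abs_mul, abs_of_nonneg (sq_nonneg x)]; norm_num
  rcases h with h | h | h
  · have h1 : |B| - |3 * A * x ^ 2| ≤ |3 * A * x ^ 2 - B| := by
      rw [abs_sub_comm]; exact abs_sub_abs_le_abs_sub _ _
    rw [e] at h1
    nlinarith [mul_le_mul_of_nonneg_left hx2 hA, mul_le_mul_of_nonneg_left hx1 hA,
      mul_le_mul_of_nonneg_right c1 hB, mul_le_mul_of_nonneg_right c2 hA]
  · have h1 : |3 * A * x ^ 2| - |B| ≤ |3 * A * x ^ 2 - B| := abs_sub_abs_le_abs_sub _ _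
    rw [e] at h1
    nlinarith [mul_le_mul_of_nonneg_left hx1 hA,
      mul_le_mul_of_nonneg_right c1 hB, mul_le_mul_of_nonneg_right c2 hA]
  · have h1 : |3 * A * x ^ 2 - B| = 3 * |A| * x ^ 2 + |B| := by
      rcases le_total 0 A with ha | ha
      · rcases ha.eq_or_lt with rfl | ha
        · simp
        · have hb : B ≤ 0 := by
            by_contra hb; push Not at hb; exact absurd h (not_le.2 (mul_pos ha hb))
          rw [abs_of_pos ha, abs_of_nonpos hb, abs_of_nonneg]
          · ring
          · nlinarith [mul_nonneg ha.le (sq_nonneg x)]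
      · rcases ha.eq_or_lt with rfl | ha
        · simp
        · have hb : 0 ≤ B := by
            by_contra hb; push Not at hb; exact absurd h (not_le.2 (mul_pos_of_neg_of_neg ha hb))
          rw [abs_of_neg ha, abs_of_nonneg hb, abs_of_nonpos]
          · ring
          · nlinarith [mul_nonneg (neg_pos.2 ha).le (sq_nonneg x)]
    rw [h1]
    nlinarith [mul_le_mul_of_nonneg_left hx1 hA,
      mul_le_mul_of_nonneg_right c1 hB, mul_le_mul_of_nonneg_right c2 hA, mul_nonneg hA (sq_nonneg p)]

lemma exists_abs_bounds {m : ℕ} {α : Fin m → ℝ} (hα : ∀ i, α i ≠ 0) :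
    ∃ lo hi : ℝ, 0 < lo ∧ 0 < hi ∧ ∀ i, lo ≤ |α i| ∧ |α i| ≤ hi := by
  have h1 : ∀ s : Finset (Fin m), ∃ lo hi : ℝ, 0 < lo ∧ 0 < hi ∧
      ∀ i ∈ s, lo ≤ |α i| ∧ |α i| ≤ hi := by
    intro s
    induction s using Finset.induction_on with
    | empty => exact ⟨1, 1, one_pos, one_pos, by simp⟩
    | insert i s _ ih =>
      obtain ⟨lo, hi, h1, h2, h3⟩ := ih
      refine ⟨min lo |α i|, max hi |α i|, lt_min h1 (abs_pos.2 (hα i)), lt_max_of_lt_left h2, ?_⟩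
      intro j hj
      rcases Finset.mem_insert.1 hj with rfl | hj
      · exact ⟨min_le_right _ _, le_max_right _ _⟩
      · exact ⟨(min_le_left _ _).trans (h3 j hj).1, (h3 j hj).2.trans (le_max_left _ _)⟩
  obtain ⟨lo, hi, h1, h2, h3⟩ := h1 Finset.univ
  exact ⟨lo, hi, h1, h2, fun i => h3 i (Finset.mem_univ i)⟩

lemma exists_abs_eq_norm {m : ℕ} (hm : 0 < m) (v : Fin m → ℝ) : ∃ i, |v i| = ‖v‖ := by
  have : Nonempty (Fin m) := ⟨⟨0, hm⟩⟩
  obtain ⟨i, hi⟩ := Finite.exists_max fun i => |v i|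
  refine ⟨i, le_antisymm (norm_le_pi_norm v i) ?_⟩
  exact (pi_norm_le_iff_of_nonneg (abs_nonneg _)).2 hi

/-- The product of cubic integrals decays wherever one of its factors is nonstationary. -/
theorem prod_cubicInt_nonstationary {m : ℕ} (hm : 0 < m) {α : Fin m → ℝ} (hα : ∀ i, α i ≠ 0)
    {χ : ℝ → ℂ} {p q : ℝ} (hp : 0 < p) (hpq : p ≤ q) (hχ : ContDiff ℝ ∞ χ)
    (hs : tsupport χ ⊆ Icc p q) :
    ∃ τ : ℝ, 0 < τ ∧ ∀ N : ℕ, ∃ C : ℝ, 0 ≤ C ∧ ∀ (β : Fin m → ℝ) (t : ℝ),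
      (|t| ≤ τ * ‖β‖ ∨ ∃ i, (6 * q ^ 2 * |α i * t| ≤ |β i| ∨ 2 * |β i| ≤ 3 * p ^ 2 * |α i * t| ∨
        α i * t * β i ≤ 0)) →
      ‖∏ i, cubicInt χ (α i * t) (β i)‖ * (1 + |t| + ‖β‖) ^ N ≤ C := by
  obtain ⟨lo, hi, hlo, hhi, hb⟩ := exists_abs_bounds hα
  have hq : 0 < q := hp.trans_le hpq
  obtain ⟨c, hc, hcond⟩ := exists_nonstationary_const (q := q) hp
  set τ := 1 / (6 * q ^ 2 * hi) with hτ
  have hτ0 : 0 < τ := by positivity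
  refine ⟨τ, hτ0, fun N => ?_⟩
  obtain ⟨C, hC0, hC⟩ := nonstationary hc N hχ hs
  set B := max (∫ x, ‖χ x‖) 1 with hB
  have hB1 : 1 ≤ B := le_max_right _ _
  set K := (1 + τ) + (1 + 1 / τ) * (1 + 1 / lo) with hK
  have hK0 : 0 < K := by positivity
  refine ⟨K ^ N * (C * B ^ m), by positivity, fun β t h => ?_⟩
  -- A single factor carries all the decay, provided its own size |α_i t| + |β_i| controls |t| +
  -- ‖β‖. For small t the maximal coordinate of β does this; otherwise ‖β‖ is O(|t|) and any
  -- coordinate will do. The remaining factors are bounded trivially.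
  have key : ∃ i, (6 * q ^ 2 * |α i * t| ≤ |β i| ∨ 2 * |β i| ≤ 3 * p ^ 2 * |α i * t| ∨
        α i * t * β i ≤ 0) ∧ 1 + |t| + ‖β‖ ≤ K * (1 + |α i * t| + |β i|) := by
    by_cases ht : |t| ≤ τ * ‖β‖
    · obtain ⟨i, hi'⟩ := exists_abs_eq_norm hm β
      refine ⟨i, Or.inl ?_, ?_⟩
      · rw [hi', abs_mul]
        calc 6 * q ^ 2 * (|α i| * |t|) ≤ 6 * q ^ 2 * (hi * (τ * ‖β‖)) := by
              gcongr; exact (hb i).2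
          _ = ‖β‖ := by rw [hτ]; field_simp
      · rw [hi']
        have h1 : (1 + τ) ≤ K := by rw [hK]; linarith [show 0 ≤ (1 + 1 / τ) * (1 + 1 / lo) by positivity]
        calc 1 + |t| + ‖β‖ ≤ (1 + τ) * (1 + ‖β‖) := by nlinarith [norm_nonneg β]
          _ ≤ K * (1 + |α i * t| + ‖β‖) := by
            gcongr; linarith [abs_nonneg (α i * t)]
    · obtain ⟨i, hi'⟩ := h.resolve_left ht
      refine ⟨i, hi', ?_⟩
      push Not at ht
      have h1 : ‖β‖ ≤ 1 / τ * |t| := by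
        rw [one_div, inv_mul_eq_div, le_div_iff₀ hτ0]; linarith
      have h2 : |t| ≤ 1 / lo * |α i * t| := by
        rw [abs_mul, one_div, inv_mul_eq_div, le_div_iff₀ hlo]
        nlinarith [(hb i).1, abs_nonneg t]
      have h3 : (1 + 1 / τ) * (1 + 1 / lo) ≤ K := by rw [hK]; linarith
      have h4 : 0 < 1 / τ := by positivity
      have h5 : 0 < 1 / lo := by positivity
      calc 1 + |t| + ‖β‖ ≤ (1 + 1 / τ) * (1 + |t|) := by nlinarith
        _ ≤ (1 + 1 / τ) * ((1 + 1 / lo) * (1 + |α i * t|)) := by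
          refine mul_le_mul_of_nonneg_left ?_ (by positivity)
          nlinarith [abs_nonneg (α i * t)]
        _ = ((1 + 1 / τ) * (1 + 1 / lo)) * (1 + |α i * t|) := by ring
        _ ≤ K * (1 + |α i * t| + |β i|) :=
          mul_le_mul h3 (by linarith [abs_nonneg (β i)]) (by positivity) hK0.le
  obtain ⟨i, h1, h2⟩ := key
  have h3 := hC (α i * t) (β i) (hcond _ _ h1)
  have h4 : ‖∏ j, cubicInt χ (α j * t) (β j)‖ ≤ ‖cubicInt χ (α i * t) (β i)‖ * B ^ m := by
    rw [← Finset.mul_prod_erase _ _ (Finset.mem_univ i), norm_mul]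
    gcongr
    rw [norm_prod]
    calc ∏ j ∈ Finset.univ.erase i, ‖cubicInt χ (α j * t) (β j)‖
        ≤ ∏ j ∈ Finset.univ.erase i, B := Finset.prod_le_prod (fun _ _ => norm_nonneg _)
          fun j _ => (norm_cubicInt_le _ _ _).trans (le_max_left _ _)
      _ = B ^ (m - 1) := by simp
      _ ≤ B ^ m := pow_le_pow_right₀ hB1 (Nat.sub_le _ _)
  calc ‖∏ j, cubicInt χ (α j * t) (β j)‖ * (1 + |t| + ‖β‖) ^ N
      ≤ (‖cubicInt χ (α i * t) (β i)‖ * B ^ m) * (K * (1 + |α i * t| + |β i|)) ^ N := by gcongr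
    _ = K ^ N * ((‖cubicInt χ (α i * t) (β i)‖ * (1 + |α i * t| + |β i|) ^ N) * B ^ m) := by
      rw [mul_pow]; ring
    _ ≤ K ^ N * (C * B ^ m) := by gcongr

lemma SchwartzMap.exists_one_add_pow_mul_le (f : 𝓢(ℝ, ℂ)) (N : ℕ) :
    ∃ C : ℝ, 0 ≤ C ∧ ∀ x, ‖f x‖ * (1 + |x|) ^ N ≤ C := by
  refine ⟨2 ^ N * (Finset.Iic (N, 0)).sup (fun m => SchwartzMap.seminorm ℝ m.1 m.2) f,
    by positivity, fun x => ?_⟩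
  have := SchwartzMap.one_add_le_sup_seminorm_apply (𝕜 := ℝ) (m := (N, 0)) (k := N) (n := 0) le_rfl
    le_rfl f x
  simpa [mul_comm] using this

/-- The Euler derivative `x f'(x)` of a Schwartz function. -/
def eulerDeriv (f : 𝓢(ℝ, ℂ)) : 𝓢(ℝ, ℂ) :=
  SchwartzMap.smulLeftCLM ℂ (fun x : ℝ => x) (SchwartzMap.derivCLM ℝ ℂ f)

lemma eulerDeriv_apply (f : 𝓢(ℝ, ℂ)) (x : ℝ) : eulerDeriv f x = x * deriv f x := by
  rw [eulerDeriv, SchwartzMap.smulLeftCLM_apply_apply Function.HasTemperateGrowth.id']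
  simp

lemma SchwartzMap.hasDerivAt_apply (f : 𝓢(ℝ, ℂ)) (x : ℝ) : HasDerivAt f (deriv f x) x :=
  f.differentiableAt.hasDerivAt

/-- Uniform decay of the logarithmic derivatives of a Schwartz function. -/
lemma norm_iteratedDeriv_schwartz_exp_le {u v : ℝ} (N j : ℕ) : ∀ f : 𝓢(ℝ, ℂ),
    ∃ C : ℝ, ∀ x η : ℝ, 0 ≤ x → η ∈ Icc u v →
      ‖iteratedDeriv j (fun η => f (x * Real.exp (-2 * η))) η‖ ≤ C * ((1 + x) ^ N)⁻¹ := by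
  induction j with
  | zero =>
    intro f
    obtain ⟨C, hC0, hC⟩ := SchwartzMap.exists_one_add_pow_mul_le f N
    set K := max 1 (Real.exp (2 * v)) with hK
    refine ⟨K ^ N * C, fun x η hx hη => ?_⟩
    rw [iteratedDeriv_zero, ← div_eq_mul_inv, le_div_iff₀ (by positivity)]
    have h1 := hC (x * Real.exp (-2 * η))
    have hK1 : 1 ≤ K := le_max_left _ _
    have hK0 : 0 < K := by linarith
    have h2 : 1 + x ≤ K * (1 + |x * Real.exp (-2 * η)|) := by
      rw [abs_of_nonneg (by positivity)]
      have : x ≤ K * (x * Real.exp (-2 * η)) := by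
        have h3 : 1 ≤ K * Real.exp (-2 * η) := by
          calc (1 : ℝ) = Real.exp (2 * η) * Real.exp (-2 * η) := by rw [← Real.exp_add]; simp
            _ ≤ K * Real.exp (-2 * η) := by
              gcongr
              exact le_trans (Real.exp_le_exp.2 (by linarith [hη.2])) (le_max_right _ _)
        nlinarith
      linarith
    calc ‖f (x * Real.exp (-2 * η))‖ * (1 + x) ^ N
        ≤ ‖f (x * Real.exp (-2 * η))‖ * (K * (1 + |x * Real.exp (-2 * η)|)) ^ N := by gcongr
      _ = K ^ N * (‖f (x * Real.exp (-2 * η))‖ * (1 + |x * Real.exp (-2 * η)|) ^ N) := by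
        rw [mul_pow]; ring
      _ ≤ K ^ N * C := by gcongr
  | succ j ih =>
    intro f
    obtain ⟨C, hC⟩ := ih ((-2 : ℝ) • eulerDeriv f)
    refine ⟨C, fun x η hx hη => ?_⟩
    -- Dilation in the argument turns ∂_η into -2 times the Euler derivative, which is again
    -- Schwartz; this is why the induction quantifies over f.
    have e : deriv (fun η => f (x * Real.exp (-2 * η))) =
        fun η => ((-2 : ℝ) • eulerDeriv f) (x * Real.exp (-2 * η)) := by
      ext η
      have h1 : HasDerivAt (fun η => x * Real.exp (-2 * η)) (x * (Real.exp (-2 * η) * (-2))) η := by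
        have := (((hasDerivAt_id η).const_mul (-2)).exp).const_mul x
        exact HasDerivAt.congr_deriv this (by simp)
      have h2 := (SchwartzMap.hasDerivAt_apply f (x * Real.exp (-2 * η))).scomp η h1
      rw [show (fun η => f (x * Real.exp (-2 * η))) = f ∘ (fun η => x * Real.exp (-2 * η)) from rfl,
        h2.deriv, smul_apply, eulerDeriv_apply, Complex.real_smul, Complex.real_smul]
      push_cast
      ring
    rw [iteratedDeriv_succ', e]
    exact hC x η hx hη

end CubicDelta

end

/-! ### The stationary range t = ‖β‖ exp(-2η) -/

noncomputable section

open scoped ContDiff SchwartzMap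

namespace CubicDelta

open MeasureTheory Set

lemma continuous_cubicInt {χ : ℝ → ℂ} (hχ : Continuous χ) (hc : HasCompactSupport χ) :
    Continuous (fun x : ℝ × ℝ => cubicInt χ x.1 x.2) := by
  refine continuous_of_dominated (bound := fun x => ‖χ x‖) (fun x => ?_) (fun x => ?_)
    (hχ.integrable_of_hasCompactSupport hc).norm ?_
  · exact Continuous.aestronglyMeasurable (by fun_prop)
  · exact Filter.Eventually.of_forall fun y => by simp [norm_ee]
  · exact Filter.Eventually.of_forall fun y => by fun_prop

/-- Two of the M + 2 powers pay for the convergence of the t-integral through (1 + t²)⁻¹; the other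
M survive as decay in l. -/
lemma norm_integral_Ioi_mul_le {F : ℝ → ℂ} {C l : ℝ} (hl : 0 ≤ l) {M : ℕ}
    (h : ∀ t, 0 < t → ‖F t‖ * (1 + t + l) ^ (M + 2) ≤ C) :
    ‖∫ t in Ioi (0 : ℝ), F t‖ * (1 + l) ^ M ≤ C * Real.pi := by
  have hC : 0 ≤ C := le_trans (by positivity) (h 1 one_pos)
  have hb : ∀ t, 0 < t → ‖F t‖ ≤ C * ((1 + l) ^ M)⁻¹ * (1 + t ^ 2)⁻¹ := by
    intro t ht
    have h1 := h t ht
    rw [mul_assoc, ← mul_inv, ← div_eq_mul_inv, le_div_iff₀ (by positivity)]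
    refine le_trans ?_ h1
    have h2 : (1 + l) ^ M ≤ (1 + t + l) ^ M := by gcongr; linarith
    have h3 : 1 + t ^ 2 ≤ (1 + t + l) ^ 2 := by nlinarith
    rw [pow_add]
    gcongr
  have hint : Integrable fun t : ℝ => C * ((1 + l) ^ M)⁻¹ * (1 + t ^ 2)⁻¹ :=
    integrable_inv_one_add_sq.const_mul _
  have h1 : ‖∫ t in Ioi (0 : ℝ), F t‖ ≤ ∫ t in Ioi (0 : ℝ), C * ((1 + l) ^ M)⁻¹ * (1 + t ^ 2)⁻¹ :=
    norm_integral_le_of_norm_le hint.integrableOn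
      ((ae_restrict_iff' measurableSet_Ioi).2 (Filter.Eventually.of_forall hb))
  have h2 : ∫ t in Ioi (0 : ℝ), C * ((1 + l) ^ M)⁻¹ * (1 + t ^ 2)⁻¹ ≤
      C * ((1 + l) ^ M)⁻¹ * Real.pi := by
    rw [← integral_univ_inv_one_add_sq, ← integral_const_mul]
    exact setIntegral_le_integral hint (Filter.Eventually.of_forall fun t => by
      simp only [Pi.zero_apply]; positivity)
  have h3 := h1.trans h2
  calc ‖∫ t in Ioi (0 : ℝ), F t‖ * (1 + l) ^ M ≤
      (C * ((1 + l) ^ M)⁻¹ * Real.pi) * (1 + l) ^ M := by gcongr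
    _ = C * Real.pi := by field_simp

/-- The substitution t = l exp(-2η): a critical point scales like t^(-1/2), hence becomes
proportional to exp η. -/
lemma integral_Ioi_comp_exp (f : ℝ → ℂ) {l : ℝ} (hl : 0 < l) :
    ∫ t in Ioi (0 : ℝ), f t =
      l * ∫ η, (((2 * Real.exp (-2 * η)) : ℝ) : ℂ) * f (l * Real.exp (-2 * η)) := by
  rw [integral_comp_exp_add f (Real.log l), ← integral_const_mul]
  have := Measure.integral_comp_mul_left
    (fun y => ((Real.exp (y + Real.log l) : ℝ) : ℂ) * f (Real.exp (y + Real.log l))) (-2 : ℝ)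
  have e : |(-2 : ℝ)⁻¹| = 2⁻¹ := by norm_num [abs_of_neg]
  rw [e] at this
  have h2 : ∫ y, ((Real.exp (y + Real.log l) : ℝ) : ℂ) * f (Real.exp (y + Real.log l)) =
      (2 : ℝ) • ∫ η, ((Real.exp (-2 * η + Real.log l) : ℝ) : ℂ) *
        f (Real.exp (-2 * η + Real.log l)) := by
    rw [this, smul_smul]; norm_num
  rw [h2, ← integral_smul]
  refine integral_congr_ae (Filter.Eventually.of_forall fun η => ?_)
  dsimp only
  rw [Real.exp_add, Real.exp_log hl, mul_comm (Real.exp _) l, Complex.real_smul]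
  push_cast
  ring

/-- The points `β` for which every phase `α_i t x³ - β_i x` may have a critical point for
some `t` of size comparable to `‖β‖`. -/
def HasCriticalPoints {m : ℕ} (α : Fin m → ℝ) (c : ℝ) (β : Fin m → ℝ) : Prop :=
  ∀ i, 0 < α i * β i ∧ c * ‖β‖ ≤ |β i|

/-- The logarithm of the critical point, up to a shift. -/
def logCrit {m : ℕ} (α β : Fin m → ℝ) (i : Fin m) : ℝ :=
  Real.log (β i / (3 * α i * ‖β‖)) / 2

lemma exp_logCrit_sq {m : ℕ} {α β : Fin m → ℝ} {i : Fin m} (h : 0 < α i * β i)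
    (hβ : 0 < ‖β‖) : Real.exp (logCrit α β i) ^ 2 = β i / (3 * α i * ‖β‖) := by
  have hα : α i ≠ 0 := fun h0 => by simp [h0] at h
  have hpos : 0 < β i / (3 * α i * ‖β‖) := by
    have : β i / (3 * α i * ‖β‖) = (α i * β i) / (3 * α i ^ 2 * ‖β‖) := by field_simp
    rw [this]; positivity
  rw [logCrit, ← Real.exp_nat_mul]
  push_cast
  rw [mul_div_cancel₀ _ (by norm_num : (2 : ℝ) ≠ 0), Real.exp_log hpos]

/-- When t = ‖β‖ exp(-2η), the critical point is x₀ = exp(`logCrit` + η), and the product α_i t x₀²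
equals β_i/3, independent of η. So η enters the stationary phase integral only through its last
variable, and the critical value is a constant times exp η, with the same exp η for every i; this
allows the phases to be added. -/
lemma cubicInt_eq_of_crit {m : ℕ} {α β : Fin m → ℝ} {i : Fin m} (h : 0 < α i * β i)
    (hβ : 0 < ‖β‖) {χ : ℝ → ℂ} {p q : ℝ} (hp : 0 < p) (hs : tsupport χ ⊆ Icc p q) (η : ℝ) :
    cubicInt χ (α i * (‖β‖ * Real.exp (-2 * η))) (β i) =
      ee (-2 / 3 * (β i * Real.exp (logCrit α β i)) * Real.exp η) *
        statInt (expAmplitude χ) (fun _ => 1) (β i / 3) (logCrit α β i + η) := by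
  have hα : α i ≠ 0 := fun h0 => by simp [h0] at h
  have e0 : Real.exp (-2 * η) * Real.exp η ^ 2 = 1 := by
    rw [← Real.exp_nat_mul, ← Real.exp_add]; simp
  have hsq : Real.exp (logCrit α β i + η) ^ 2 = β i / (3 * α i * ‖β‖) * Real.exp η ^ 2 := by
    rw [Real.exp_add, mul_pow, exp_logCrit_sq h hβ]
  have e1 : α i * (‖β‖ * Real.exp (-2 * η)) * Real.exp (logCrit α β i + η) ^ 2 = β i / 3 := by
    rw [hsq]
    generalize Real.exp (-2 * η) = E at e0 ⊢
    field_simp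
    linear_combination (β i) * e0
  have := cubicInt_eq_statInt hp hs (α i * (‖β‖ * Real.exp (-2 * η))) (logCrit α β i + η)
  have e2 : 3 * (α i * (‖β‖ * Real.exp (-2 * η))) * Real.exp (logCrit α β i + η) ^ 2 = β i := by
    linear_combination 3 * e1
  have e3 : -2 * (α i * (‖β‖ * Real.exp (-2 * η))) * Real.exp (logCrit α β i + η) ^ 3 =
      -2 / 3 * (β i * Real.exp (logCrit α β i)) * Real.exp η := by
    rw [pow_succ, Real.exp_add (logCrit α β i)]
    rw [Real.exp_add (logCrit α β i)] at e1
    linear_combination (-2 * (Real.exp (logCrit α β i) * Real.exp η)) * e1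
  rw [e2, e3, e1] at this
  exact this

/-- The ratio |β_i|/‖β‖ lies between c and 1, so the logarithms stay bounded. The stationary phase
bounds are thereby needed only on a fixed η-interval. -/
lemma abs_logCrit_le {m : ℕ} {α : Fin m → ℝ} (hα : ∀ i, α i ≠ 0) {c : ℝ} (hc : 0 < c) :
    ∃ R : ℝ, 0 ≤ R ∧ ∀ β : Fin m → ℝ, 0 < ‖β‖ → HasCriticalPoints α c β →
      ∀ i, |logCrit α β i| ≤ R := by
  obtain ⟨lo, hi, hlo, hhi, hb⟩ := exists_abs_bounds hα
  refine ⟨(|Real.log (c / (3 * hi))| + |Real.log (1 / (3 * lo))|) / 2, by positivity,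
    fun β hβ h i => ?_⟩
  obtain ⟨h1, h2⟩ := h i
  have hαi : 0 < |α i| := abs_pos.2 (hα i)
  have e : β i / (3 * α i * ‖β‖) = |β i| / (3 * |α i| * ‖β‖) := by
    have : |α i| * |β i| = α i * β i := by rw [← abs_mul, abs_of_pos h1]
    rw [div_eq_div_iff (by have := hα i; positivity) (by positivity)]
    have h3 : |α i| * |α i| = α i * α i := abs_mul_abs_self _
    have : β i * |α i| = |β i| * α i := by
      refine mul_left_cancel₀ (hα i) ?_
      calc α i * (β i * |α i|) = (α i * β i) * |α i| := by ring
        _ = (|α i| * |β i|) * |α i| := by rw [this]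
        _ = (|α i| * |α i|) * |β i| := by ring
        _ = α i * (|β i| * α i) := by rw [h3]; ring
    linear_combination 3 * ‖β‖ * this
  have l1 : c / (3 * hi) ≤ |β i| / (3 * |α i| * ‖β‖) := by
    rw [div_le_div_iff₀ (by positivity) (by positivity)]
    have := (hb i).2
    calc c * (3 * |α i| * ‖β‖) = (c * ‖β‖) * (3 * |α i|) := by ring
      _ ≤ |β i| * (3 * hi) := by gcongr
  have l2 : |β i| / (3 * |α i| * ‖β‖) ≤ 1 / (3 * lo) := by
    rw [div_le_div_iff₀ (by positivity) (by positivity)]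
    have h3 := (hb i).1
    have h4 : |β i| ≤ ‖β‖ := norm_le_pi_norm β i
    calc |β i| * (3 * lo) ≤ ‖β‖ * (3 * |α i|) := by gcongr
      _ = _ := by ring
  have p0 : 0 < c / (3 * hi) := by positivity
  have m1 := Real.log_le_log p0 l1
  have m2 := Real.log_le_log (p0.trans_le l1) l2
  rw [logCrit, e, abs_div, abs_of_pos (by norm_num : (0 : ℝ) < 2)]
  refine div_le_div_of_nonneg_right ?_ (by norm_num)
  rw [abs_le]
  constructor
  · linarith [neg_abs_le (Real.log (c / (3 * hi))), abs_nonneg (Real.log (1 / (3 * lo)))]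
  · linarith [le_abs_self (Real.log (1 / (3 * lo))), abs_nonneg (Real.log (c / (3 * hi)))]

/-- The contribution of the stationary range, with a smooth cutoff. -/
theorem stationary_part {m : ℕ} {α : Fin m → ℝ} (hα : ∀ i, α i ≠ 0)
    {χ : ℝ → ℂ} {p q : ℝ} (hp : 0 < p) (hχ : ContDiff ℝ ∞ χ)
    (hs : tsupport χ ⊆ Icc p q) (f : 𝓢(ℝ, ℂ)) (N : ℕ) {c : ℝ} (hc : 0 < c) {R : ℝ}
    {ρ : ℝ → ℝ} (hρ : ContDiff ℝ ∞ ρ) (hρs : tsupport ρ ⊆ Icc (-R) R) (K : ℕ) :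
    ∃ C : ℝ, 0 ≤ C ∧ ∀ (r : ℝ) (β : Fin m → ℝ), 0 ≤ r → 1 ≤ ‖β‖ → HasCriticalPoints α c β →
      ‖∫ η, (((2 * Real.exp (-2 * η)) : ℝ) : ℂ) * ((ρ η : ℂ) * (f (r * (‖β‖ * Real.exp (-2 * η))) *
        ∏ i, cubicInt χ (α i * (‖β‖ * Real.exp (-2 * η))) (β i)))‖ *
        |∑ i, β i * Real.exp (logCrit α β i)| ^ K ≤
      C * (((1 + r * ‖β‖) ^ N)⁻¹ * (√‖β‖)⁻¹ ^ m) := by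
  obtain ⟨Rb, hRb0, hRb⟩ := abs_logCrit_le hα hc
  set g := expAmplitude χ with hg
  have hgc := contDiff_expAmplitude hχ
  have hgs := hasCompactSupport_expAmplitude hp hs
  -- All admissible pairs (r, β) serve as the parameter of a uniformly smooth family, so that
  -- integration by parts in η has constants independent of both.
  let P := {x : ℝ × (Fin m → ℝ) // 0 ≤ x.1 ∧ 1 ≤ ‖x.2‖ ∧ HasCriticalPoints α c x.2}
  have hstat : ∀ i ∈ (Finset.univ : Finset (Fin m)), UnifSmooth (Icc (-R) R)
      (fun x : P => (√‖x.1.2‖)⁻¹)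
      (fun x η => statInt g (fun _ => 1) (x.1.2 i / 3) (logCrit α x.1.2 i + η)) := by
    intro i _
    refine ⟨fun x => (contDiff_infty_statInt hgc hgs contDiff_const _).comp
      (contDiff_const.add contDiff_id), fun j => ?_⟩
    obtain ⟨C, hC0, hC⟩ := norm_iteratedDeriv_statInt_le (Rb + |R|) j hgc hgs
      (contDiff_const (c := (1 : ℂ)))
    refine ⟨C * (√(c / 3))⁻¹, fun x η hη => ?_⟩
    obtain ⟨⟨r, β⟩, hr, hβ, hcrit⟩ := x
    dsimp only at hr hβ hcrit ⊢
    have hβ0 : 0 < ‖β‖ := by linarith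
    have hβi : β i ≠ 0 := fun h0 => by have := (hcrit i).1; simp [h0] at this
    rw [iteratedDeriv_comp_const_add]
    have hle : |logCrit α β i + η| ≤ Rb + |R| := by
      refine (abs_add_le _ _).trans (add_le_add (hRb β hβ0 hcrit i) ?_)
      exact (abs_le.2 hη).trans (le_abs_self R)
    refine (hC (β i / 3) _ (div_ne_zero hβi (by norm_num)) hle).trans ?_
    rw [mul_assoc]
    gcongr
    rw [← mul_inv, ← Real.sqrt_mul (by positivity)]
    gcongr
    rw [abs_div, abs_of_pos (by norm_num : (0 : ℝ) < 3)]
    linarith [(hcrit i).2]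
  have hprod := UnifSmooth.prod isCompact_Icc Finset.univ hstat
  have hf : UnifSmooth (Icc (-R) R) (fun x : P => ((1 + x.1.1 * ‖x.1.2‖) ^ N)⁻¹)
      (fun x η => f (x.1.1 * ‖x.1.2‖ * Real.exp (-2 * η))) := by
    refine ⟨fun x => f.smooth'.comp (contDiff_const.mul
      (Real.contDiff_exp.comp (contDiff_const.mul contDiff_id))), fun j => ?_⟩
    obtain ⟨C, hC⟩ := norm_iteratedDeriv_schwartz_exp_le (u := -R) (v := R) N j f
    exact ⟨C, fun x η hη => hC _ η (mul_nonneg x.2.1 (norm_nonneg _)) hη⟩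
  have hu : ContDiff ℝ ∞ (fun η => (((2 * Real.exp (-2 * η)) * ρ η : ℝ) : ℂ)) :=
    Complex.ofRealCLM.contDiff.comp ((contDiff_const.mul
      (Real.contDiff_exp.comp (contDiff_const.mul contDiff_id))).mul hρ)
  have hall := (hf.mul hprod).smooth_mul isCompact_Icc hu
  have hsupp : ∀ x : P, tsupport (fun η => (((2 * Real.exp (-2 * η)) * ρ η : ℝ) : ℂ) *
      (f (x.1.1 * ‖x.1.2‖ * Real.exp (-2 * η)) *
        ∏ i, statInt g (fun _ => 1) (x.1.2 i / 3) (logCrit α x.1.2 i + η))) ⊆ Icc (-R) R := by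
    intro x
    refine closure_minimal (fun η hη => ?_) isClosed_Icc
    refine hρs (subset_tsupport ρ fun h0 => hη ?_)
    simp [h0]
  obtain ⟨C, hC0, hC⟩ := integral_ee_exp_decay (fun x : P => mul_nonneg
    (inv_nonneg.2 (pow_nonneg (add_nonneg zero_le_one (mul_nonneg x.2.1 (norm_nonneg _))) _))
    (Finset.prod_nonneg fun _ _ => by positivity)) K _ hall hsupp
  refine ⟨(3 / 2) ^ K * C, by positivity, fun r β hr hβ hcrit => ?_⟩
  have hβ0 : 0 < ‖β‖ := by linarith
  -- The critical values -(2/3)β_i exp(`logCrit`) exp η sum to κ exp η, the only oscillation left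
  -- after the amplitudes have been extracted.
  set κ : ℝ := -2 / 3 * ∑ i, β i * Real.exp (logCrit α β i) with hκ
  have hab : |∑ i, β i * Real.exp (logCrit α β i)| = 3 / 2 * |κ| := by
    rw [hκ, abs_mul]; norm_num [abs_of_neg]; ring
  have h1 := hC ⟨(r, β), hr, hβ, hcrit⟩ κ
  dsimp only at h1
  have e : ∫ η, (((2 * Real.exp (-2 * η)) : ℝ) : ℂ) * ((ρ η : ℂ) *
      (f (r * (‖β‖ * Real.exp (-2 * η))) *
        ∏ i, cubicInt χ (α i * (‖β‖ * Real.exp (-2 * η))) (β i))) =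
      ∫ η, (((2 * Real.exp (-2 * η)) * ρ η : ℝ) : ℂ) * (f (r * ‖β‖ * Real.exp (-2 * η)) *
        ∏ i, statInt g (fun _ => 1) (β i / 3) (logCrit α β i + η)) * ee (κ * Real.exp η) := by
    refine integral_congr_ae (Filter.Eventually.of_forall fun η => ?_)
    dsimp only
    rw [Finset.prod_congr rfl fun i _ => cubicInt_eq_of_crit (hcrit i).1 hβ0 hp hs η,
      Finset.prod_mul_distrib, ← ee_sum, ← Finset.sum_mul, ← Finset.mul_sum, mul_assoc r]
    push_cast
    ring
  rw [e, hab, mul_pow]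
  rw [Finset.prod_const, Finset.card_univ, Fintype.card_fin] at h1
  calc _ = (3 / 2) ^ K * (‖∫ η, (((2 * Real.exp (-2 * η)) * ρ η : ℝ) : ℂ) *
        (f (r * ‖β‖ * Real.exp (-2 * η)) *
        ∏ i, statInt g (fun _ => 1) (β i / 3) (logCrit α β i + η)) * ee (κ * Real.exp η)‖ *
        |κ| ^ K) := by ring
    _ ≤ (3 / 2) ^ K * (C * (((1 + r * ‖β‖) ^ N)⁻¹ * (√‖β‖)⁻¹ ^ m)) := by gcongr
    _ = _ := by ring

end CubicDelta

end

/-! ### Both ranges combined: the integral over t > 0 -/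

noncomputable section

open scoped ContDiff SchwartzMap

namespace CubicDelta

open MeasureTheory Set

lemma one_add_sq_le_sq {t l : ℝ} (ht : 0 ≤ t) (hl : 0 ≤ l) : 1 + t ^ 2 ≤ (1 + t + l) ^ 2 := by
  nlinarith [mul_nonneg ht hl]

/-- The expected size of an oscillatory integral over the cone `F = 0`, to order `N`. -/
def decayWeight (m N : ℕ) (G : (Fin m → ℝ) → ℝ) (r : ℝ) (v : Fin m → ℝ) : ℝ :=
  (1 + ‖v‖) ^ (1 - (m : ℝ) / 2) * (((1 + r * ‖v‖) ^ N)⁻¹ * ((1 + G v) ^ N)⁻¹)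

/-- Since r ≤ R and G is at most linear, each factor of the weight loses at most a power of 1 + ‖v‖.
Anything that decays fast enough in ‖v‖ alone is thus acceptable. -/
lemma decayWeight_ge {m N : ℕ} {G : (Fin m → ℝ) → ℝ} {L : ℝ} (hL : 0 ≤ L) (hG0 : ∀ v, 0 ≤ G v)
    (hGL : ∀ v, G v ≤ L * ‖v‖) {r R : ℝ} (hr : 0 ≤ r) (hrR : r ≤ R) (v : Fin m → ℝ) :
    ((1 + ‖v‖) ^ (2 * N + m))⁻¹ ≤ (1 + R) ^ N * (1 + L) ^ N * decayWeight m N G r v := by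
  have hv := norm_nonneg v
  have h1 : ((1 + ‖v‖) ^ m)⁻¹ ≤ (1 + ‖v‖) ^ (1 - (m : ℝ) / 2) := by
    rw [← Real.rpow_natCast, ← Real.rpow_neg (by linarith)]
    refine Real.rpow_le_rpow_of_exponent_le (by linarith) ?_
    have : (0 : ℝ) ≤ m := Nat.cast_nonneg m
    linarith
  have h2 : ((1 + ‖v‖) ^ N)⁻¹ ≤ (1 + R) ^ N * ((1 + r * ‖v‖) ^ N)⁻¹ := by
    rw [← div_eq_mul_inv, ← div_pow, ← inv_pow]
    refine pow_le_pow_left₀ (by positivity) ?_ N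
    rw [inv_eq_one_div, div_le_div_iff₀ (by positivity) (by positivity)]
    nlinarith [mul_le_mul_of_nonneg_right hrR hv, hr.trans hrR]
  have h3 : ((1 + ‖v‖) ^ N)⁻¹ ≤ (1 + L) ^ N * ((1 + G v) ^ N)⁻¹ := by
    have := hG0 v
    rw [← div_eq_mul_inv, ← div_pow, ← inv_pow]
    refine pow_le_pow_left₀ (by positivity) ?_ N
    rw [inv_eq_one_div, div_le_div_iff₀ (by positivity) (by positivity)]
    nlinarith [hGL v]
  have hG := hG0 v
  have hR : 0 ≤ R := hr.trans hrR
  calc ((1 + ‖v‖) ^ (2 * N + m))⁻¹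
      = ((1 + ‖v‖) ^ m)⁻¹ * (((1 + ‖v‖) ^ N)⁻¹ * ((1 + ‖v‖) ^ N)⁻¹) := by
        rw [← mul_inv, ← mul_inv]; congr 1; ring
    _ ≤ (1 + ‖v‖) ^ (1 - (m : ℝ) / 2) * (((1 + R) ^ N * ((1 + r * ‖v‖) ^ N)⁻¹) *
        ((1 + L) ^ N * ((1 + G v) ^ N)⁻¹)) := by gcongr
    _ = _ := by rw [decayWeight]; ring

lemma decayWeight_pos {m N : ℕ} {G : (Fin m → ℝ) → ℝ} (hG0 : ∀ v, 0 ≤ G v)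
    {r : ℝ} (hr : 0 ≤ r) (v : Fin m → ℝ) : 0 < decayWeight m N G r v := by
  have := hG0 v
  unfold decayWeight
  have h1 : 0 < 1 + ‖v‖ := by positivity
  have := Real.rpow_pos_of_pos h1 (1 - (m : ℝ) / 2)
  positivity

set_option maxHeartbeats 1600000 in
/-- Decay of the `t`-integral of a product of cubic integrals over a half line. -/
theorem integral_Ioi_prod_cubicInt {m : ℕ} (hm : 2 ≤ m) {α : Fin m → ℝ} (hα : ∀ i, α i ≠ 0)
    {χ : ℝ → ℂ} {p q : ℝ} (hp : 0 < p) (hpq : p ≤ q) (hχ : ContDiff ℝ ∞ χ)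
    (hs : tsupport χ ⊆ Icc p q) (f : 𝓢(ℝ, ℂ)) {G : (Fin m → ℝ) → ℝ} {L Cg : ℝ} (hL : 0 ≤ L)
    (hCg : 0 ≤ Cg) (hG0 : ∀ v, 0 ≤ G v) (hGL : ∀ v, G v ≤ L * ‖v‖)
    (hG : ∀ v z : Fin m → ℝ, 0 < ‖v‖ → (∀ i, 0 < z i) → (∀ i, α i * z i ^ 2 = v i / ‖v‖) →
      G v ≤ Cg * ‖v‖ * |∑ i, α i * z i ^ 3|) (N : ℕ) (R : ℝ) :
    ∃ C : ℝ, 0 ≤ C ∧ ∀ (r : ℝ) (v : Fin m → ℝ), 0 ≤ r → r ≤ R →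
      ‖∫ t in Ioi (0 : ℝ), f (r * t) * ∏ i, cubicInt χ (α i * t) (v i)‖ ≤
        C * decayWeight m N G r v := by
  have hm0 : 0 < m := by omega
  have hcs : HasCompactSupport χ := HasCompactSupport.of_support_subset_isCompact isCompact_Icc
    ((subset_tsupport χ).trans hs)
  obtain ⟨lo, hi, hlo, hhi, hb⟩ := exists_abs_bounds hα
  obtain ⟨τ, hτ, hns⟩ := prod_cubicInt_nonstationary hm0 hα hp hpq hχ hs
  obtain ⟨C1, hC10, hC1⟩ := hns (2 * N + m + 2)
  obtain ⟨Cf, hCf0, hCf⟩ := SchwartzMap.exists_one_add_pow_mul_le f 0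
  have hCf' : ∀ x, ‖f x‖ ≤ Cf := fun x => by simpa using hCf x
  -- Chosen so that the cubic term dominates in any coordinate, in particular in coordinate 0, once
  -- t ≥ τ₁‖v‖.
  set τ₁ := 2 / (3 * p ^ 2 * lo) with hτ₁
  have hτ₁0 : 0 < τ₁ := by positivity
  -- If t > τ‖v‖ and factor i is not declared nonstationary, then 2|v_i| > 3p²|α_i t| ≥ 2c‖v‖; this
  -- is the lower bound built into `HasCriticalPoints`.
  set c := 3 / 2 * p ^ 2 * lo * τ with hc
  have hc0 : 0 < c := by positivity
  set B := max (∫ x, ‖χ x‖) 1 with hB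
  have hB1 : 1 ≤ B := le_max_right _ _
  have hBm : ∀ (v : Fin m → ℝ) t, ‖∏ i, cubicInt χ (α i * t) (v i)‖ ≤ B ^ m := by
    intro v t
    rw [norm_prod]
    calc _ ≤ ∏ j : Fin m, B := Finset.prod_le_prod (fun _ _ => norm_nonneg _)
          fun j _ => (norm_cubicInt_le _ _ _).trans (le_max_left _ _)
      _ = B ^ m := by simp
  -- the nonstationary range
  have hbig : ∀ (v : Fin m → ℝ) t, 0 < t → τ₁ * ‖v‖ ≤ t →
      ‖∏ i, cubicInt χ (α i * t) (v i)‖ * (1 + |t| + ‖v‖) ^ (2 * N + m + 2) ≤ C1 := by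
    intro v t ht h
    refine hC1 v t (Or.inr ⟨⟨0, hm0⟩, Or.inr (Or.inl ?_)⟩)
    rw [abs_mul, abs_of_pos ht]
    have h1 := norm_le_pi_norm v ⟨0, hm0⟩
    rw [Real.norm_eq_abs] at h1
    have h2 := (hb ⟨0, hm0⟩).1
    calc 2 * |v ⟨0, hm0⟩| ≤ 2 * ‖v‖ := by linarith
      _ = 3 * p ^ 2 * (lo * (τ₁ * ‖v‖)) := by rw [hτ₁]; field_simp
      _ ≤ 3 * p ^ 2 * (|α ⟨0, hm0⟩| * t) := by gcongr
  have hcrit : ∀ (v : Fin m → ℝ) t, 0 < t → ¬ HasCriticalPoints α c v →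
      ‖∏ i, cubicInt χ (α i * t) (v i)‖ * (1 + |t| + ‖v‖) ^ (2 * N + m + 2) ≤ C1 := by
    intro v t ht h
    refine hC1 v t ?_
    by_cases h0 : |t| ≤ τ * ‖v‖
    · exact Or.inl h0
    · refine Or.inr ?_
      simp only [HasCriticalPoints, not_forall] at h
      obtain ⟨i, hi'⟩ := h
      refine ⟨i, ?_⟩
      by_contra hcon
      push Not at hcon
      obtain ⟨_, k2, k3⟩ := hcon
      push Not at h0
      refine hi' ⟨?_, ?_⟩
      · have : α i * t * v i = t * (α i * v i) := by ring
        rw [this] at k3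
        exact pos_of_mul_pos_right k3 ht.le
      · rw [abs_mul] at k2
        have h2 := (hb i).1
        have : 3 * p ^ 2 * (lo * (τ * ‖v‖)) ≤ 3 * p ^ 2 * (|α i| * |t|) := by gcongr
        rw [hc]; nlinarith
  -- the cutoff
  set R₀ := max (max |Real.log τ| |Real.log τ₁|) 1 with hR₀
  have hR₀0 : 0 < R₀ := lt_of_lt_of_le one_pos (le_max_right _ _)
  let ρ : ContDiffBump (0 : ℝ) := ⟨R₀, R₀ + 1, hR₀0, by linarith⟩
  have hρs : tsupport ρ ⊆ Icc (-(R₀ + 1)) (R₀ + 1) := by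
    rw [ρ.tsupport_eq, Real.closedBall_eq_Icc]; simp [ρ]
  have hρc : ContDiff ℝ ∞ ρ := ρ.contDiff
  -- The orders 0 and N of integration by parts are both kept; together they give the bound with (1
  -- + |κ|)^N.
  obtain ⟨C2, hC20, hC2⟩ := stationary_part hα hp hχ hs f N hc0 hρc hρs 0
  obtain ⟨C3, hC30, hC3⟩ := stationary_part hα hp hχ hs f N hc0 hρc hρs N
  set C4 := Cf * (C1 + B ^ m * (2 + τ₁) ^ (2 * N + m + 2)) with hC4
  have hC40 : 0 ≤ C4 := by positivity
  have hR1 : 0 ≤ 1 + |R| := by positivity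
  set D := (1 + |R|) ^ N * (1 + L) ^ N with hD
  have hD0 : 0 ≤ D := by positivity
  set C5 := (2 : ℝ) ^ ((m : ℝ) / 2 - 1) * (2 ^ N * (C2 + (2 * Cg) ^ N * C3)) with hC5
  have hC50 : 0 ≤ C5 := by positivity
  refine ⟨C4 * Real.pi * D + C5, by positivity, fun r v hr hrR => ?_⟩
  have hR : r ≤ |R| := hrR.trans (le_abs_self R)
  have hwt := decayWeight_ge (N := N) hL hG0 hGL hr hR v
  have hwpos := decayWeight_pos (N := N) hG0 hr v
  have hv0 := norm_nonneg v
  -- conclusion from pointwise decay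
  have hfinish : ∀ F : ℝ → ℂ, (∀ t, 0 < t → ‖F t‖ * (1 + t + ‖v‖) ^ (2 * N + m + 2) ≤ C4) →
      ‖∫ t in Ioi (0 : ℝ), F t‖ ≤ C4 * Real.pi * D * decayWeight m N G r v := by
    intro F hF
    have h1 := norm_integral_Ioi_mul_le hv0 hF
    rw [← le_div_iff₀ (by positivity), div_eq_mul_inv] at h1
    refine h1.trans ?_
    rw [mul_assoc (C4 * Real.pi)]
    gcongr
  have hF1 : ∀ t, 0 < t → ‖∏ i, cubicInt χ (α i * t) (v i)‖ *
      (1 + |t| + ‖v‖) ^ (2 * N + m + 2) ≤ C1 → ‖f (r * t) * ∏ i, cubicInt χ (α i * t) (v i)‖ *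
      (1 + t + ‖v‖) ^ (2 * N + m + 2) ≤ C4 := by
    intro t ht h
    rw [abs_of_pos ht] at h
    rw [norm_mul, mul_assoc]
    refine mul_le_mul (hCf' _) (h.trans ?_) (by positivity) hCf0
    have : 0 ≤ B ^ m * (2 + τ₁) ^ (2 * N + m + 2) := by positivity
    linarith
  by_cases hcr : HasCriticalPoints α c v
  swap
  · refine (hfinish _ fun t ht => hF1 t ht (hcrit v t ht hcr)).trans ?_
    gcongr
    linarith
  -- For bounded v no stationary phase is needed: large t is nonstationary, and for t ≤ τ₁ the
  -- factor 1 + t + ‖v‖ is bounded.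
  by_cases hv1 : ‖v‖ < 1
  · refine (hfinish _ fun t ht => ?_).trans
      (mul_le_mul_of_nonneg_right (by linarith) hwpos.le)
    by_cases ht1 : τ₁ * ‖v‖ ≤ t
    · exact hF1 t ht (hbig v t ht ht1)
    · rw [norm_mul, mul_assoc]
      refine mul_le_mul (hCf' _) ?_ (by positivity) hCf0
      have : t ≤ τ₁ := by nlinarith
      have h2 : (1 + t + ‖v‖) ^ (2 * N + m + 2) ≤ (2 + τ₁) ^ (2 * N + m + 2) :=
        pow_le_pow_left₀ (by linarith) (by linarith) _
      exact (mul_le_mul (hBm v t) h2 (by positivity) (by positivity)).trans (by linarith)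
  push Not at hv1
  have hvpos : 0 < ‖v‖ := by linarith
  -- The bump in η = -log(t/‖v‖)/2, read as a function of t. It equals 1 for τ‖v‖ < t < τ₁‖v‖, so
  -- only nonstationary t remain where 1 - S does not vanish.
  set S : ℝ → ℝ := fun t => ρ (-(Real.log (t / ‖v‖)) / 2) with hS
  have hSm : Measurable S := by
    refine ρ.continuous.measurable.comp ?_
    exact ((Real.measurable_log.comp (measurable_id.div_const _)).neg).div_const _
  have hS0 : ∀ t, 0 ≤ S t := fun t => ρ.nonneg
  have hS1 : ∀ t, S t ≤ 1 := fun t => ρ.le_one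
  have hSt : ∀ t, 0 < t → (τ * ‖v‖ < t ∧ t < τ₁ * ‖v‖) → S t = 1 := by
    intro t ht ⟨h1, h2⟩
    refine ρ.one_of_mem_closedBall ?_
    rw [mem_closedBall_zero_iff, Real.norm_eq_abs]
    change _ ≤ R₀
    have e1 : Real.log τ ≤ Real.log (t / ‖v‖) :=
      Real.log_le_log hτ ((le_div_iff₀ hvpos).2 h1.le)
    have e2 : Real.log (t / ‖v‖) ≤ Real.log τ₁ :=
      Real.log_le_log (by positivity) ((div_le_iff₀ hvpos).2 h2.le)
    have e3 : |Real.log (t / ‖v‖)| ≤ R₀ := by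
      refine le_trans ?_ (le_max_left _ _)
      exact abs_le_max_abs_abs e1 e2
    rw [abs_div, abs_neg, abs_of_pos (by norm_num : (0 : ℝ) < 2)]
    linarith [abs_nonneg (Real.log (t / ‖v‖))]
  set Pi : ℝ → ℂ := fun t => f (r * t) * ∏ i, cubicInt χ (α i * t) (v i) with hPi
  have hPic : Continuous Pi := by
    have hk := continuous_cubicInt hχ.continuous hcs
    have hfc := f.continuous
    refine Continuous.mul (by fun_prop) (continuous_finsetProd _ fun i _ => ?_)
    exact hk.comp (f := fun t => (α i * t, v i)) (by fun_prop)
  have hAm : AEStronglyMeasurable (fun t => (((1 - S t : ℝ)) : ℂ) * Pi t)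
      (volume.restrict (Ioi 0)) :=
    ((Complex.measurable_ofReal.comp (measurable_const.sub hSm)).aestronglyMeasurable.mul
      hPic.aestronglyMeasurable)
  have hBmeas : AEStronglyMeasurable (fun t => ((S t : ℝ) : ℂ) * Pi t)
      (volume.restrict (Ioi 0)) :=
    ((Complex.measurable_ofReal.comp hSm).aestronglyMeasurable.mul hPic.aestronglyMeasurable)
  have hAdec : ∀ t, 0 < t → ‖(((1 - S t : ℝ)) : ℂ) * Pi t‖ *
      (1 + t + ‖v‖) ^ (2 * N + m + 2) ≤ C4 := by
    intro t ht
    by_cases hst : τ * ‖v‖ < t ∧ t < τ₁ * ‖v‖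
    · rw [hSt t ht hst]; simpa using hC40
    · have hns' : ‖∏ i, cubicInt χ (α i * t) (v i)‖ *
          (1 + |t| + ‖v‖) ^ (2 * N + m + 2) ≤ C1 := by
        rcases not_and_or.1 hst with h | h
        · exact hC1 v t (Or.inl (by rw [abs_of_pos ht]; exact not_lt.1 h))
        · exact hbig v t ht (not_lt.1 h)
      have h1 := hF1 t ht hns'
      rw [norm_mul, mul_assoc, Complex.norm_real, Real.norm_eq_abs,
        abs_of_nonneg (by linarith [hS1 t])]
      have h2 : 0 ≤ ‖Pi t‖ * (1 + t + ‖v‖) ^ (2 * N + m + 2) := by positivity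
      nlinarith [hS0 t]
  have hAint : IntegrableOn (fun t => (((1 - S t : ℝ)) : ℂ) * Pi t) (Ioi 0) := by
    refine Integrable.mono' (g := fun t => C4 * (1 + t ^ 2)⁻¹)
      (integrable_inv_one_add_sq.const_mul C4).integrableOn hAm ?_
    refine (ae_restrict_iff' measurableSet_Ioi).2 (Filter.Eventually.of_forall fun t ht => ?_)
    have ht' : 0 < t := ht
    rw [← div_eq_mul_inv, le_div_iff₀ (by positivity)]
    refine le_trans ?_ (hAdec t ht')
    have h3 : 1 + t ^ 2 ≤ (1 + t + ‖v‖) ^ (2 * N + m + 2) :=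
      le_trans (one_add_sq_le_sq ht'.le hv0)
        (pow_le_pow_right₀ (by linarith) (by omega))
    gcongr
  have hSz : ∀ t, 0 < t → t ∉ Icc 0 (‖v‖ * Real.exp (2 * (R₀ + 1))) → S t = 0 := by
    intro t ht h
    have h1 : ‖v‖ * Real.exp (2 * (R₀ + 1)) < t := by
      by_contra hcon; exact h ⟨ht.le, not_lt.1 hcon⟩
    refine image_eq_zero_of_notMem_tsupport (f := ρ) fun hmem => ?_
    have h2 := (hρs hmem).1
    have h3 : 2 * (R₀ + 1) < Real.log (t / ‖v‖) := by
      rw [Real.lt_log_iff_exp_lt (by positivity), lt_div_iff₀ hvpos]; linarith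
    linarith
  have hBint : IntegrableOn (fun t => ((S t : ℝ) : ℂ) * Pi t) (Ioi 0) := by
    refine Integrable.mono' (g := (Icc 0 (‖v‖ * Real.exp (2 * (R₀ + 1)))).indicator
      fun _ => Cf * B ^ m) ?_ hBmeas ?_
    · have : Integrable ((Icc 0 (‖v‖ * Real.exp (2 * (R₀ + 1)))).indicator
          fun _ => Cf * B ^ m) :=
        (integrable_indicator_iff measurableSet_Icc).2 continuous_const.integrableOn_Icc
      exact this.integrableOn
    · refine (ae_restrict_iff' measurableSet_Ioi).2 (Filter.Eventually.of_forall fun t ht => ?_)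
      by_cases h : t ∈ Icc 0 (‖v‖ * Real.exp (2 * (R₀ + 1)))
      · rw [indicator_of_mem h, norm_mul, norm_mul, Complex.norm_real, Real.norm_eq_abs,
          abs_of_nonneg (hS0 t)]
        calc _ ≤ 1 * (Cf * B ^ m) := by
              gcongr
              · exact hS1 t
              · exact hCf' _
              · exact hBm v t
          _ = _ := one_mul _
      · rw [indicator_of_notMem h, hSz t ht h]; simp
  have hsplit : ∫ t in Ioi (0 : ℝ), Pi t = (∫ t in Ioi (0 : ℝ), (((1 - S t : ℝ)) : ℂ) * Pi t) +
      ∫ t in Ioi (0 : ℝ), ((S t : ℝ) : ℂ) * Pi t := by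
    rw [← integral_add hAint hBint]
    refine integral_congr_ae (Filter.Eventually.of_forall fun t => ?_)
    dsimp only
    push_cast; ring
  set I₂ := ∫ η, (((2 * Real.exp (-2 * η)) : ℝ) : ℂ) * ((ρ η : ℂ) *
      (f (r * (‖v‖ * Real.exp (-2 * η))) *
        ∏ i, cubicInt χ (α i * (‖v‖ * Real.exp (-2 * η))) (v i))) with hI₂
  have hB2 : ∫ t in Ioi (0 : ℝ), ((S t : ℝ) : ℂ) * Pi t = ‖v‖ * I₂ := by
    rw [integral_Ioi_comp_exp _ hvpos]
    congr 1
    refine integral_congr_ae (Filter.Eventually.of_forall fun η => ?_)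
    dsimp only
    have : S (‖v‖ * Real.exp (-2 * η)) = ρ η := by
      have h1 : -Real.log (‖v‖ * Real.exp (-2 * η) / ‖v‖) / 2 = η := by
        rw [mul_div_cancel_left₀ _ hvpos.ne', Real.log_exp]; ring
      simp only [hS, h1]
    rw [this]
  set κ := ∑ i, v i * Real.exp (logCrit α v i) with hκ
  -- The choice z_i = √3 exp(`logCrit`) gives α_i z_i² = v_i/‖v‖, and then Σ α_i z_i³ = (√3/‖v‖)κ.
  -- So the hypothesis on G is precisely a bound by |κ|.
  have hGκ : G v ≤ 2 * Cg * |κ| := by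
    have h1 := hG v (fun i => √3 * Real.exp (logCrit α v i)) hvpos (fun i => by positivity)
      (fun i => by
        rw [mul_pow, exp_logCrit_sq (hcr i).1 hvpos, Real.sq_sqrt (by norm_num)]
        have := hα i
        field_simp)
    have h2 : ∑ i, α i * (√3 * Real.exp (logCrit α v i)) ^ 3 = √3 / ‖v‖ * κ := by
      rw [hκ, Finset.mul_sum]
      refine Finset.sum_congr rfl fun i _ => ?_
      have h3 : α i * (√3 * Real.exp (logCrit α v i)) ^ 3 = α i * ((√3) ^ 2 *
          Real.exp (logCrit α v i) ^ 2) * (√3 * Real.exp (logCrit α v i)) := by ring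
      rw [h3, exp_logCrit_sq (hcr i).1 hvpos, Real.sq_sqrt (by norm_num)]
      have := hα i
      field_simp
    rw [h2, abs_mul, abs_div, abs_of_pos hvpos, abs_of_nonneg (Real.sqrt_nonneg 3)] at h1
    have h4 : √3 ≤ 2 := by rw [Real.sqrt_le_left (by norm_num)]; norm_num
    calc G v ≤ Cg * ‖v‖ * (√3 / ‖v‖ * |κ|) := h1
      _ = √3 * Cg * |κ| := by field_simp
      _ ≤ 2 * Cg * |κ| := by gcongr
  have k2 := hC2 r v hr hv1 hcr
  have k3 := hC3 r v hr hv1 hcr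
  rw [pow_zero, mul_one] at k2
  set W := ((1 + r * ‖v‖) ^ N)⁻¹ * (√‖v‖)⁻¹ ^ m with hW
  have hW0 : 0 ≤ W := by positivity
  have hGv := hG0 v
  have hIG : ‖I₂‖ * (1 + G v) ^ N ≤ 2 ^ N * (C2 + (2 * Cg) ^ N * C3) * W := by
    have h1 : (1 + G v) ^ N ≤ 2 ^ N * (1 + (2 * Cg) ^ N * |κ| ^ N) := by
      have a1 : 1 + G v ≤ 2 * max 1 (G v) := by
        linarith [le_max_left 1 (G v), le_max_right 1 (G v)]
      have a2 : max 1 (G v) ^ N ≤ 1 + (G v) ^ N := by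
        rcases max_cases 1 (G v) with ⟨h, _⟩ | ⟨h, _⟩ <;> rw [h]
        · rw [one_pow]; linarith [pow_nonneg hGv N]
        · linarith
      calc (1 + G v) ^ N ≤ (2 * max 1 (G v)) ^ N := by gcongr
        _ = 2 ^ N * max 1 (G v) ^ N := mul_pow _ _ _
        _ ≤ 2 ^ N * (1 + (G v) ^ N) := by gcongr
        _ ≤ 2 ^ N * (1 + (2 * Cg * |κ|) ^ N) := by gcongr
        _ = _ := by rw [mul_pow (2 * Cg)]
    calc ‖I₂‖ * (1 + G v) ^ N ≤ ‖I₂‖ * (2 ^ N * (1 + (2 * Cg) ^ N * |κ| ^ N)) := by gcongr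
      _ = 2 ^ N * (‖I₂‖ + (2 * Cg) ^ N * (‖I₂‖ * |κ| ^ N)) := by ring
      _ ≤ 2 ^ N * (C2 * W + (2 * Cg) ^ N * (C3 * W)) := by gcongr
      _ = _ := by ring
  -- The Jacobian ‖v‖ against m factors ‖v‖^(-1/2). As ‖v‖ ≥ 1, replacing ‖v‖ by 1 + ‖v‖ costs only
  -- a constant.
  have hpow : ‖v‖ * (√‖v‖)⁻¹ ^ m ≤ (2 : ℝ) ^ ((m : ℝ) / 2 - 1) *
      (1 + ‖v‖) ^ (1 - (m : ℝ) / 2) := by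
    have hm2 : (2 : ℝ) ≤ m := by exact_mod_cast hm
    have e1 : ‖v‖ * (√‖v‖)⁻¹ ^ m = ‖v‖ ^ (1 - (m : ℝ) / 2) := by
      rw [Real.rpow_sub hvpos, Real.rpow_one, Real.sqrt_eq_rpow, inv_pow, ← Real.rpow_mul_natCast
        hv0, div_eq_mul_inv]
      congr 3; ring
    have e2 : ‖v‖ ^ (1 - (m : ℝ) / 2) = (2 : ℝ) ^ ((m : ℝ) / 2 - 1) *
        (2 * ‖v‖) ^ (1 - (m : ℝ) / 2) := by
      rw [Real.mul_rpow (by norm_num) hv0, ← mul_assoc, ← Real.rpow_add (by norm_num)]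
      simp
    rw [e1, e2]
    refine mul_le_mul_of_nonneg_left ?_ (by positivity)
    exact Real.rpow_le_rpow_of_nonpos (by linarith) (by linarith) (by linarith)
  have hsecond : ‖‖v‖ * I₂‖ ≤ C5 * decayWeight m N G r v := by
    rw [← le_div_iff₀ (by positivity)] at hIG
    rw [norm_mul, Complex.norm_real, norm_norm]
    calc ‖v‖ * ‖I₂‖ ≤ ‖v‖ * (2 ^ N * (C2 + (2 * Cg) ^ N * C3) * W / (1 + G v) ^ N) := by gcongr
      _ = (2 ^ N * (C2 + (2 * Cg) ^ N * C3)) * (‖v‖ * (√‖v‖)⁻¹ ^ m) *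
          (((1 + r * ‖v‖) ^ N)⁻¹ * ((1 + G v) ^ N)⁻¹) := by rw [hW]; ring
      _ ≤ (2 ^ N * (C2 + (2 * Cg) ^ N * C3)) * ((2 : ℝ) ^ ((m : ℝ) / 2 - 1) *
          (1 + ‖v‖) ^ (1 - (m : ℝ) / 2)) * (((1 + r * ‖v‖) ^ N)⁻¹ * ((1 + G v) ^ N)⁻¹) := by
        gcongr
      _ = _ := by rw [hC5, decayWeight]; ring
  rw [hsplit, hB2, add_mul]
  exact (norm_add_le _ _).trans (add_le_add (hfinish _ hAdec) hsecond)

end CubicDelta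

end

/-! ### The integral over all t -/

noncomputable section

open scoped ContDiff SchwartzMap

namespace CubicDelta

open MeasureTheory Set

/-- Decay of the `t`-integral of a product of cubic integrals. -/
theorem integral_prod_cubicInt {m : ℕ} (hm : 2 ≤ m) {α : Fin m → ℝ} (hα : ∀ i, α i ≠ 0)
    {χ : ℝ → ℂ} {p q : ℝ} (hp : 0 < p) (hpq : p ≤ q) (hχ : ContDiff ℝ ∞ χ)
    (hs : tsupport χ ⊆ Icc p q) (f : 𝓢(ℝ, ℂ)) {G : (Fin m → ℝ) → ℝ} {L Cg : ℝ} (hL : 0 ≤ L)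
    (hCg : 0 ≤ Cg) (hG0 : ∀ v, 0 ≤ G v) (hGL : ∀ v, G v ≤ L * ‖v‖)
    (hG : ∀ (s : ℝ) (v z : Fin m → ℝ), s ^ 2 = 1 → 0 < ‖v‖ →
      (∀ i, α i * z i ^ 2 = s * (v i / ‖v‖)) → G v ≤ Cg * ‖v‖ * |∑ i, α i * z i ^ 3|)
    (N : ℕ) (R : ℝ) :
    ∃ C : ℝ, 0 ≤ C ∧ ∀ (r : ℝ) (v : Fin m → ℝ), 0 < r → r ≤ R →
      ‖∫ t, f (r * t) * ∏ i, cubicInt χ (α i * t) (v i)‖ ≤ C * decayWeight m N G r v := by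
  have hcs : HasCompactSupport χ := HasCompactSupport.of_support_subset_isCompact isCompact_Icc
    ((subset_tsupport χ).trans hs)
  set f' : 𝓢(ℝ, ℂ) :=
    SchwartzMap.compCLMOfContinuousLinearEquiv ℝ (ContinuousLinearEquiv.neg ℝ) f with hf'
  have hf'a : ∀ x, f' x = f (-x) := fun x => rfl
  obtain ⟨C1, hC10, hC1⟩ := integral_Ioi_prod_cubicInt hm hα hp hpq hχ hs f hL hCg hG0 hGL
    (fun v z hv _ hz => hG 1 v z (by norm_num) hv fun i => by rw [hz i, one_mul]) N R
  -- Negative t is the positive case for -α and f(-·). The sign s in the hypothesis on G exists to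
  -- serve both halves.
  obtain ⟨C2, hC20, hC2⟩ := integral_Ioi_prod_cubicInt (α := fun i => - α i) hm
    (fun i => neg_ne_zero.2 (hα i)) hp hpq hχ hs f' hL hCg hG0 hGL
    (fun v z hv _ hz => by
      have := hG (-1) v z (by norm_num) hv fun i => by rw [← hz i]; ring
      simpa only [neg_mul, Finset.sum_neg_distrib, abs_neg] using this) N R
  refine ⟨C1 + C2, by positivity, fun r v hr hrR => ?_⟩
  have k1 := hC1 r v hr.le hrR
  have k2 := hC2 r v hr.le hrR
  set F : ℝ → ℂ := fun t => f (r * t) * ∏ i, cubicInt χ (α i * t) (v i) with hF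
  have hint : Integrable F := by
    have h1 : Integrable fun t => f (r * t) := (f.integrable).comp_mul_left' hr.ne'
    have hc : Continuous fun t => ∏ i, cubicInt χ (α i * t) (v i) :=
      continuous_finsetProd _ fun i _ => (continuous_cubicInt hχ.continuous hcs).comp
        (f := fun t => (α i * t, v i)) (by fun_prop)
    refine Integrable.mul_bdd (c := (∫ x, ‖χ x‖) ^ m) h1 hc.aestronglyMeasurable ?_
    refine Filter.Eventually.of_forall fun t => ?_
    rw [norm_prod]
    calc _ ≤ ∏ i : Fin m, ∫ x, ‖χ x‖ := Finset.prod_le_prod (fun _ _ => norm_nonneg _)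
          fun i _ => norm_cubicInt_le _ _ _
      _ = _ := by simp
  have h2 : ∫ t in Iic (0 : ℝ), F t =
      ∫ t in Ioi (0 : ℝ), f' (r * t) * ∏ i, cubicInt χ (-α i * t) (v i) := by
    have := integral_comp_neg_Ioi (0 : ℝ) F
    rw [neg_zero] at this
    rw [← this]
    refine integral_congr_ae (Filter.Eventually.of_forall fun t => ?_)
    simp only [hF, hf'a]
    congr 1
    · congr 1; ring
    · refine Finset.prod_congr rfl fun i _ => ?_
      congr 1; ring
  rw [← intervalIntegral.integral_Iic_add_Ioi (b := (0 : ℝ)) hint.integrableOn hint.integrableOn, h2,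
    add_comm C1, add_mul]
  exact (norm_add_le _ _).trans (add_le_add k2 k1)

/-! The dual form near the dual variety. -/

lemma contDiff_aeval {σ : Type*} [Fintype σ] (P : MvPolynomial σ ℚ) :
    ContDiff ℝ ∞ fun x : σ → ℝ => MvPolynomial.aeval x P := by
  induction P using MvPolynomial.induction_on with
  | C a => simpa using contDiff_const
  | add p q hp hq => simpa using hp.add hq
  | mul_X p i hp =>
    simp only [map_mul, MvPolynomial.aeval_X]
    exact hp.mul (contDiff_apply ℝ ℝ i)

lemma exists_lipschitz_on_ball {m : ℕ} {f : (Fin m → ℝ) → ℝ} (hf : ContDiff ℝ ∞ f) (ρ : ℝ) :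
    ∃ L : ℝ, 0 ≤ L ∧ ∀ x y, ‖x‖ ≤ ρ → ‖y‖ ≤ ρ → |f x - f y| ≤ L * ‖x - y‖ := by
  obtain ⟨L, hL⟩ := (isCompact_closedBall (0 : Fin m → ℝ) ρ).exists_bound_of_continuousOn
    (hf.continuous_fderiv (by simp)).continuousOn
  refine ⟨max L 0, le_max_right _ _, fun x y hx hy => ?_⟩
  have := (convex_closedBall (0 : Fin m → ℝ) ρ).norm_image_sub_le_of_norm_fderiv_le (𝕜 := ℝ)
    (fun z _ => hf.differentiable (by simp) z) (fun z hz => (hL z hz).trans (le_max_left L 0))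
    (mem_closedBall_zero_iff.2 hy) (mem_closedBall_zero_iff.2 hx)
  exact this

lemma exists_cube_root (y : ℝ) : ∃ x : ℝ, x ^ 3 = y := by
  rcases le_total 0 y with h | h
  · exact ⟨y ^ ((3 : ℕ) : ℝ)⁻¹, Real.rpow_inv_natCast_pow h (by norm_num)⟩
  · refine ⟨-(-y) ^ ((3 : ℕ) : ℝ)⁻¹, ?_⟩
    rw [Odd.neg_pow (by decide), Real.rpow_inv_natCast_pow (by linarith) (by norm_num), neg_neg]

lemma pderiv_diagonalCubic {m : ℕ} (a : Fin m → ℤ) (i : Fin m) :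
    MvPolynomial.pderiv i (diagonalCubic a) =
      MvPolynomial.C (3 * a i) * MvPolynomial.X i ^ 2 := by
  classical
  unfold diagonalCubic
  rw [map_sum, Finset.sum_eq_single i]
  · simp
    ring
  · intro j _ hj
    simp [MvPolynomial.pderiv_X_of_ne hj]
  · simp

lemma aeval_diagonalCubic {m : ℕ} {A : Type*} [CommRing A] (a : Fin m → ℤ) (x : Fin m → A) :
    MvPolynomial.aeval x (diagonalCubic a) = ∑ i, (a i : A) * x i ^ 3 := by
  simp [diagonalCubic, map_sum]

/-- The dual form vanishes on the image of the real points of `F = 0` under the Gauss map. -/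
lemma aeval_dualForm_eq_zero {m : ℕ} {a : Fin m → ℤ} (ha : ∀ i, a i ≠ 0)
    {Fd : MvPolynomial (Fin m) ℚ} (hFd : IsDualForm (diagonalCubic a) Fd) {s : ℝ} (hs : s ^ 2 = 1)
    {z : Fin m → ℝ} (hz : z ≠ 0) (h : ∑ i, (a i : ℝ) * z i ^ 3 = 0) :
    MvPolynomial.aeval (fun i => s * (a i * z i ^ 2)) Fd = 0 := by
  have hs0 : s ≠ 0 := fun h0 => by simp [h0] at hs
  obtain ⟨i, hi⟩ := Function.ne_iff.1 hz
  have hc := (hFd.zero_iff (fun i => ((s * (a i * z i ^ 2) : ℝ) : ℂ)) ?_).2 ?_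
  · have h2 := MvPolynomial.aeval_algebraMap_apply ℂ (fun i => s * (a i * z i ^ 2)) Fd
    have h3 : (algebraMap ℝ ℂ ∘ fun i => s * (a i * z i ^ 2)) =
        fun i => ((s * (a i * z i ^ 2) : ℝ) : ℂ) := rfl
    rw [h3, hc] at h2
    exact (Complex.ofReal_eq_zero.1 h2.symm)
  · intro h0
    have := congrFun h0 i
    simp only [Pi.zero_apply, Complex.ofReal_eq_zero] at this
    have hai : (a i : ℝ) ≠ 0 := by exact_mod_cast ha i
    exact (mul_ne_zero hs0 (mul_ne_zero hai (pow_ne_zero 2 hi))) this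
  · refine ⟨fun i => (z i : ℂ), ?_, ?_, ?_, ?_⟩
    · intro h0
      have := congrFun h0 i
      simp only [Pi.zero_apply, Complex.ofReal_eq_zero] at this
      exact hi this
    · rw [aeval_diagonalCubic]
      exact_mod_cast h
    · have : ∑ i, s * (a i * z i ^ 2) * z i = s * ∑ i, (a i : ℝ) * z i ^ 3 := by
        rw [Finset.mul_sum]; refine Finset.sum_congr rfl fun i _ => by ring
      rw [h, mul_zero] at this
      simp only [dotProduct]
      exact_mod_cast this
    · rw [LinearIndependent.pair_iff]
      intro hli
      -- The section is singular at z because ∇F(z) = 3s·c, by s² = 1.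
      refine one_ne_zero (hli 1 (-3 * s) ?_).1
      ext j
      simp only [gradient, pderiv_diagonalCubic, Pi.add_apply, Pi.smul_apply, smul_eq_mul,
        Pi.zero_apply, map_mul, map_pow, MvPolynomial.aeval_X, MvPolynomial.aeval_C]
      have hs' : (s : ℂ) ^ 2 = 1 := by exact_mod_cast hs
      push_cast
      simp only [algebraMap_int_eq, eq_intCast]
      push_cast
      linear_combination (-3 * (a j : ℂ) * z j ^ 2) * hs'

/-- Quantitatively, the dual form at the image of `z` under the Gauss map is `O(|F(z)|)`. -/
theorem abs_dualForm_le {m : ℕ} (hm : 0 < m) {a : Fin m → ℤ} (ha : ∀ i, a i ≠ 0)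
    {Fd : MvPolynomial (Fin m) ℚ} (hFd : IsDualForm (diagonalCubic a) Fd) :
    ∃ C : ℝ, 0 ≤ C ∧ ∀ (s : ℝ) (v z : Fin m → ℝ), s ^ 2 = 1 → 0 < ‖v‖ →
      (∀ i, (a i : ℝ) * z i ^ 2 = s * (v i / ‖v‖)) →
      |MvPolynomial.aeval (‖v‖⁻¹ • v) Fd| ≤ C * |∑ i, (a i : ℝ) * z i ^ 3| := by
  have haR : ∀ i, (a i : ℝ) ≠ 0 := fun i => by exact_mod_cast ha i
  obtain ⟨lo, hi, hlo, hhi, hb⟩ := exists_abs_bounds haR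
  set Q : ℝ → (Fin m → ℝ) → ℝ := fun s z =>
    MvPolynomial.aeval (fun i => s * ((a i : ℝ) * z i ^ 2)) Fd with hQ
  have hQc : ∀ s, ContDiff ℝ ∞ (Q s) := fun s => (contDiff_aeval Fd).comp
    (contDiff_pi.2 fun i => contDiff_const.mul (contDiff_const.mul ((contDiff_apply ℝ ℝ i).pow 2)))
  set ρ := 1 / lo + 1 + 4 / 3 with hρ
  obtain ⟨L1, hL10, hL1⟩ := exists_lipschitz_on_ball (hQc 1) ρ
  obtain ⟨L2, hL20, hL2⟩ := exists_lipschitz_on_ball (hQc (-1)) ρ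
  obtain ⟨M, hM⟩ := (isCompact_closedBall (0 : Fin m → ℝ) 1).exists_bound_of_continuousOn
    (contDiff_aeval Fd).continuous.continuousOn
  have hM0 : 0 ≤ M := (norm_nonneg _).trans (hM 0 (by simp))
  -- For |F(z)| ≥ δ boundedness of the dual form suffices. Below δ, the bound 1/(2(hi+1)) is what
  -- keeps the perturbed point constructed later away from 0.
  set δ := min 1 (1 / (2 * (hi + 1))) with hδ
  have hδ0 : 0 < δ := by positivity
  refine ⟨(L1 + L2) * (4 / 3) + M / δ, by positivity, fun s v z hs hv hz => ?_⟩
  have hs1 : s = 1 ∨ s = -1 := by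
    rcases mul_eq_zero.1 (show (s - 1) * (s + 1) = 0 by linear_combination hs) with h | h
    · exact Or.inl (by linarith)
    · exact Or.inr (by linarith)
  have hval : MvPolynomial.aeval (‖v‖⁻¹ • v) Fd = Q s z := by
    simp only [hQ]
    congr 2
    ext i
    rw [hz i, ← mul_assoc, ← sq, hs, one_mul, Pi.smul_apply, smul_eq_mul, inv_mul_eq_div]
  set F := ∑ i, (a i : ℝ) * z i ^ 3 with hF
  have hv1 : ‖‖v‖⁻¹ • v‖ ≤ 1 := by rw [norm_smul, norm_inv, norm_norm, inv_mul_cancel₀ hv.ne']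
  have hMb := hM _ (mem_closedBall_zero_iff.2 hv1)
  rw [Real.norm_eq_abs] at hMb
  by_cases hlarge : δ ≤ |F|
  · calc _ ≤ M / δ * δ := by rw [div_mul_cancel₀ _ hδ0.ne']; exact hMb
      _ ≤ M / δ * |F| := by gcongr
      _ ≤ _ := by
        have : 0 ≤ (L1 + L2) * (4 / 3) * |F| := by positivity
        linarith
  push Not at hlarge
  have hF1 : |F| < 1 := hlarge.trans_le (min_le_left _ _)
  obtain ⟨i, hi'⟩ := exists_abs_eq_norm hm v
  have hzi : |(a i : ℝ)| * z i ^ 2 = 1 := by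
    have := congrArg abs (hz i)
    rw [abs_mul, abs_mul, abs_div, hi', abs_norm, div_self hv.ne', mul_one,
      abs_of_nonneg (sq_nonneg (z i))] at this
    rw [this]
    rcases hs1 with h | h <;> simp [h]
  -- Altering one coordinate moves z exactly onto F = 0, where the dual form vanishes at the Gauss
  -- image. That coordinate has |a_i|z_i² = 1, so x² + x z_i + z_i² ≥ (3/4)z_i² keeps the move at
  -- most (4/3)|F(z)|, and a Lipschitz bound finishes.
  obtain ⟨x, hx⟩ := exists_cube_root (z i ^ 3 - F / a i)
  have hai : 0 < |(a i : ℝ)| := abs_pos.2 (haR i)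
  have hdist : |x - z i| ≤ 4 / 3 * |F| := by
    have e1 : (x - z i) * (x ^ 2 + x * z i + z i ^ 2) = - (F / a i) := by
      linear_combination hx
    have e2 := congrArg abs e1
    have hq : 3 / 4 * z i ^ 2 ≤ x ^ 2 + x * z i + z i ^ 2 := by nlinarith [sq_nonneg (x + z i / 2)]
    rw [abs_mul, abs_neg, abs_div, abs_of_nonneg (le_trans (by positivity) hq)] at e2
    have e3 : |x - z i| * (3 / 4 * z i ^ 2) ≤ |F| / |(a i : ℝ)| := by
      rw [← e2]; gcongr
    have e4 : z i ^ 2 = 1 / |(a i : ℝ)| := by field_simp; linarith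
    rw [e4, le_div_iff₀ hai] at e3
    have e5 : |x - z i| * (3 / 4 * (1 / |(a i : ℝ)|)) * |(a i : ℝ)| = 3 / 4 * |x - z i| := by
      field_simp
    linarith
  have hF' : ∑ j, (a j : ℝ) * (Function.update z i x) j ^ 3 = 0 := by
    have h1 : ∀ j, (a j : ℝ) * (Function.update z i x) j ^ 3 = (a j : ℝ) * z j ^ 3 +
        (if j = i then -F else 0) := by
      intro j
      by_cases hj : j = i
      · subst hj
        have := haR j
        rw [Function.update_self, hx, if_pos rfl]
        field_simp
        ring
      · rw [Function.update_of_ne hj, if_neg hj, add_zero]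
    rw [Finset.sum_congr rfl fun j _ => h1 j, Finset.sum_add_distrib]
    simp [hF]
  have hdz : ‖z - Function.update z i x‖ ≤ 4 / 3 * |F| := by
    refine (pi_norm_le_iff_of_nonneg (by positivity)).2 fun j => ?_
    by_cases hj : j = i
    · subst hj
      rw [Pi.sub_apply, Function.update_self, Real.norm_eq_abs, abs_sub_comm]
      exact hdist
    · rw [Pi.sub_apply, Function.update_of_ne hj, sub_self, norm_zero]
      positivity
  have hzn : ‖z‖ ≤ 1 / lo + 1 := by
    refine (pi_norm_le_iff_of_nonneg (by positivity)).2 fun j => ?_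
    have h1 : |(a j : ℝ)| * z j ^ 2 ≤ 1 := by
      have := congrArg abs (hz j)
      rw [abs_mul, abs_mul, abs_div, abs_norm, abs_of_nonneg (sq_nonneg (z j))] at this
      rw [this]
      have h2 : |s| = 1 := by rcases hs1 with h | h <;> simp [h]
      rw [h2, one_mul, div_le_one hv]
      exact norm_le_pi_norm v j
    have h3 : lo * z j ^ 2 ≤ 1 := le_trans (by gcongr; exact (hb j).1) h1
    have h4 : z j ^ 2 ≤ 1 / lo := by rw [le_div_iff₀ hlo]; linarith
    rw [Real.norm_eq_abs]
    nlinarith [sq_nonneg (|z j| - 1), sq_abs (z j), abs_nonneg (z j)]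
  have hzn' : ‖Function.update z i x‖ ≤ ρ := by
    have h1 : ‖Function.update z i x‖ ≤ ‖z‖ + ‖z - Function.update z i x‖ := by
      have := norm_sub_le z (z - Function.update z i x)
      rwa [sub_sub_cancel] at this
    rw [hρ]; linarith
  -- A zero vector has no Gauss image. If x were 0, then |z_i| ≤ (4/3)|F| would be too small for
  -- |a_i|z_i² = 1.
  have hne : Function.update z i x ≠ 0 := by
    intro h0
    have hx0 : x = 0 := by have := congrFun h0 i; simpa using this
    rw [hx0, zero_sub, abs_neg] at hdist
    have h1 : |F| < 1 / (2 * (hi + 1)) := hlarge.trans_le (min_le_right _ _)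
    have h2 : |z i| < 1 / (hi + 1) := by
      have : (1 : ℝ) / (2 * (hi + 1)) = 1 / 2 * (1 / (hi + 1)) := by field_simp
      have hp : 0 < 1 / (hi + 1) := by positivity
      linarith [abs_nonneg F]
    have h3 : z i ^ 2 < (1 / (hi + 1)) ^ 2 := by
      rw [← sq_abs]; gcongr
    have h4 : |(a i : ℝ)| * z i ^ 2 ≤ hi * z i ^ 2 := by gcongr; exact (hb i).2
    have h5 : hi * (1 / (hi + 1)) ^ 2 < 1 := by
      rw [div_pow, one_pow, mul_one_div, div_lt_one (by positivity)]
      nlinarith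
    nlinarith
  have hzero := aeval_dualForm_eq_zero ha hFd hs hne hF'
  have hzρ : ‖z‖ ≤ ρ := by rw [hρ]; linarith
  have hlip : |Q s z - Q s (Function.update z i x)| ≤ (L1 + L2) * ‖z - Function.update z i x‖ := by
    rcases hs1 with h | h
    · rw [h]
      refine (hL1 _ _ hzρ hzn').trans ?_
      gcongr; linarith
    · rw [h]
      refine (hL2 _ _ hzρ hzn').trans ?_
      gcongr; linarith
  have hQ0 : Q s (Function.update z i x) = 0 := hzero
  rw [hQ0, sub_zero] at hlip
  rw [hval]
  calc |Q s z| ≤ (L1 + L2) * (4 / 3 * |F|) := hlip.trans (by gcongr)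
    _ ≤ _ := by
      have : 0 ≤ M / δ * |F| := by positivity
      linarith

/-- The size `‖v‖ |F^∨(v/‖v‖)|` of the dual form. -/
def dualSize {m : ℕ} (Fd : MvPolynomial (Fin m) ℚ) (v : Fin m → ℝ) : ℝ :=
  ‖v‖ * |MvPolynomial.aeval (‖v‖⁻¹ • v) Fd|

lemma dualSize_nonneg {m : ℕ} (Fd : MvPolynomial (Fin m) ℚ) (v : Fin m → ℝ) :
    0 ≤ dualSize Fd v := by unfold dualSize; positivity

lemma norm_inv_norm_smul_le {m : ℕ} (v : Fin m → ℝ) : ‖‖v‖⁻¹ • v‖ ≤ 1 := by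
  rw [norm_smul, norm_inv, norm_norm]
  exact inv_mul_le_one

/-- Normalizing the argument makes this homogeneous of degree one. Its Lipschitz property comes from
that of the polynomial on the unit ball and from ‖v‖ · ‖v/‖v‖ - w/‖w‖‖ ≤ 2‖v - w‖. It is what allows
v to be shifted by a Fourier frequency. -/
lemma exists_dualSize_lipschitz {m : ℕ} (Fd : MvPolynomial (Fin m) ℚ) :
    ∃ L : ℝ, 0 ≤ L ∧ (∀ v, dualSize Fd v ≤ L * ‖v‖) ∧
      ∀ v w, dualSize Fd v ≤ dualSize Fd w + L * ‖v - w‖ := by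
  obtain ⟨L, hL0, hL⟩ := exists_lipschitz_on_ball (contDiff_aeval Fd) 1
  obtain ⟨M, hM⟩ := (isCompact_closedBall (0 : Fin m → ℝ) 1).exists_bound_of_continuousOn
    (contDiff_aeval Fd).continuous.continuousOn
  have hM0 : 0 ≤ M := (norm_nonneg _).trans (hM 0 (by simp))
  have hMv : ∀ v : Fin m → ℝ, |MvPolynomial.aeval (‖v‖⁻¹ • v) Fd| ≤ M := fun v =>
    hM _ (mem_closedBall_zero_iff.2 (norm_inv_norm_smul_le v))
  have hle : ∀ v, dualSize Fd v ≤ M * ‖v‖ := fun v => by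
    rw [dualSize, mul_comm]; gcongr; exact hMv v
  refine ⟨M + 2 * L, by positivity, fun v => (hle v).trans ?_, fun v w => ?_⟩
  · gcongr; linarith
  · rcases eq_or_ne w 0 with rfl | hw
    · rw [sub_zero]
      have := dualSize_nonneg Fd 0
      have h2 : M * ‖v‖ ≤ (M + 2 * L) * ‖v‖ := by gcongr; linarith
      linarith [hle v]
    · have hw0 : 0 < ‖w‖ := norm_pos_iff.2 hw
      rcases eq_or_ne v 0 with rfl | hv
      · have h0 : dualSize Fd (0 : Fin m → ℝ) = 0 := by simp [dualSize]
        rw [h0]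
        have := dualSize_nonneg Fd w
        positivity
      have hv0 : 0 < ‖v‖ := norm_pos_iff.2 hv
      have h1 := hL _ _ (norm_inv_norm_smul_le v) (norm_inv_norm_smul_le w)
      have hn : |‖w‖ - ‖v‖| ≤ ‖v - w‖ := by rw [abs_sub_comm]; exact abs_norm_sub_norm_le v w
      have h2 : ‖v‖ * ‖‖v‖⁻¹ • v - ‖w‖⁻¹ • w‖ ≤ 2 * ‖v - w‖ := by
        have e : ‖v‖ • (‖v‖⁻¹ • v - ‖w‖⁻¹ • w) = (v - w) + (‖w‖ - ‖v‖) • (‖w‖⁻¹ • w) := by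
          rw [smul_sub, smul_smul, mul_inv_cancel₀ hv0.ne', one_smul, sub_smul,
            smul_smul ‖w‖, mul_inv_cancel₀ hw0.ne', one_smul]
          abel
        have e2 : ‖v‖ * ‖‖v‖⁻¹ • v - ‖w‖⁻¹ • w‖ = ‖‖v‖ • (‖v‖⁻¹ • v - ‖w‖⁻¹ • w)‖ := by
          rw [norm_smul, norm_norm]
        rw [e2, e]
        refine (norm_add_le _ _).trans ?_
        rw [norm_smul, Real.norm_eq_abs]
        have := mul_le_mul hn (norm_inv_norm_smul_le w) (norm_nonneg _) (norm_nonneg _)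
        linarith
      have h3 : |MvPolynomial.aeval (‖v‖⁻¹ • v) Fd| ≤ |MvPolynomial.aeval (‖w‖⁻¹ • w) Fd| +
          L * ‖‖v‖⁻¹ • v - ‖w‖⁻¹ • w‖ := by
        have := abs_sub_abs_le_abs_sub (MvPolynomial.aeval (‖v‖⁻¹ • v) Fd : ℝ)
          (MvPolynomial.aeval (‖w‖⁻¹ • w) Fd)
        linarith
      have h4 : ‖v‖ ≤ ‖w‖ + ‖v - w‖ := by
        have := norm_add_le w (v - w); rwa [add_sub_cancel] at this
      unfold dualSize
      calc ‖v‖ * |MvPolynomial.aeval (‖v‖⁻¹ • v) Fd|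
          ≤ ‖v‖ * (|MvPolynomial.aeval (‖w‖⁻¹ • w) Fd| + L * ‖‖v‖⁻¹ • v - ‖w‖⁻¹ • w‖) := by gcongr
        _ = ‖v‖ * |MvPolynomial.aeval (‖w‖⁻¹ • w) Fd| +
            L * (‖v‖ * ‖‖v‖⁻¹ • v - ‖w‖⁻¹ • w‖) := by ring
        _ ≤ (‖w‖ + ‖v - w‖) * |MvPolynomial.aeval (‖w‖⁻¹ • w) Fd| + L * (2 * ‖v - w‖) := by gcongr
        _ ≤ ‖w‖ * |MvPolynomial.aeval (‖w‖⁻¹ • w) Fd| + (M + 2 * L) * ‖v - w‖ := by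
          have := mul_le_mul_of_nonneg_left (hMv w) (norm_nonneg (v - w))
          nlinarith

end CubicDelta

end

noncomputable section

open scoped ContDiff SchwartzMap

namespace CubicDelta

open MeasureTheory Set

/-! The core oscillatory integral estimate. -/

/-- Fourier inversion on `Fin m → ℝ`. -/
lemma exists_fourier_representation {m : ℕ} {w : (Fin m → ℝ) → ℂ} (hw : ContDiff ℝ ∞ w)
    (hc : HasCompactSupport w) :
    ∃ g : 𝓢(Fin m → ℝ, ℂ), (∀ ξ, g ξ = ∫ u, w u * ee (-(ξ ⬝ᵥ u))) ∧
      ∀ u, w u = ∫ ξ, g ξ * ee (ξ ⬝ᵥ u) := by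
  -- Fourier inversion is carried out in Euclidean space and transported through the
  -- measure-preserving coordinate equivalence.
  set e := EuclideanSpace.equiv (Fin m) ℝ with he
  have hmp : MeasurePreserving e.symm volume volume := PiLp.volume_preserving_toLp (Fin m)
  have hme : MeasurableEmbedding e.symm := e.symm.toHomeomorph.measurableEmbedding
  have hS1 : ContDiff ℝ ∞ (w ∘ e) := hw.comp e.contDiff
  have hS2 : HasCompactSupport (w ∘ e) := hc.comp_homeomorph e.toHomeomorph
  set S : 𝓢(EuclideanSpace ℝ (Fin m), ℂ) := hS2.toSchwartzMap hS1 with hS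
  have hSa : ∀ x, S x = w (e x) := fun x => rfl
  have hin : ∀ x y : Fin m → ℝ, inner ℝ (e.symm x) (e.symm y) = y ⬝ᵥ x := fun x y => by
    rw [EuclideanSpace.inner_eq_star_dotProduct]; rfl
  refine ⟨SchwartzMap.compCLMOfContinuousLinearEquiv ℝ e.symm (FourierTransform.fourier S),
    fun ξ => ?_, fun u => ?_⟩
  · change (FourierTransform.fourier S) (e.symm ξ) = _
    rw [SchwartzMap.fourier_coe, Real.fourier_eq', ← hmp.integral_comp hme]
    refine integral_congr_ae (Filter.Eventually.of_forall fun x => ?_)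
    simp only [hin, hSa, ContinuousLinearEquiv.apply_symm_apply, smul_eq_mul]
    rw [mul_comm, ee]
    congr 4; ring
  · have h1 : S (e.symm u) = w u := by rw [hSa, ContinuousLinearEquiv.apply_symm_apply]
    rw [← h1]
    conv_lhs => rw [← FourierTransform.fourierInv_fourier_eq
      (F := 𝓢(EuclideanSpace ℝ (Fin m), ℂ)) S]
    rw [SchwartzMap.fourierInv_coe, Real.fourierInv_eq', ← hmp.integral_comp hme]
    refine integral_congr_ae (Filter.Eventually.of_forall fun x => ?_)
    simp only [hin, smul_eq_mul]
    rw [mul_comm, ee, dotProduct_comm]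
    rfl

/-- By scaling, one Schwartz function P serves every r; the parameter r survives only in P(rt),
which later gives the decay in r‖v‖. -/
lemma exists_fourier_representation_real (Ψ : 𝓢(ℝ, ℂ)) :
    ∃ P : 𝓢(ℝ, ℂ), ∀ r : ℝ, 0 < r → ∀ y : ℝ,
      (r : ℂ)⁻¹ * Ψ (y / r) = ∫ t, P (r * t) * ee (t * y) := by
  refine ⟨FourierTransform.fourier Ψ, fun r hr y => ?_⟩
  conv_lhs => rw [← FourierTransform.fourierInv_fourier_eq (F := 𝓢(ℝ, ℂ)) Ψ]
  rw [SchwartzMap.fourierInv_coe, Real.fourierInv_eq']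
  have h := Measure.integral_comp_mul_left
    (fun t => (FourierTransform.fourier Ψ : 𝓢(ℝ, ℂ)) t * ee (t * (y / r))) r
  rw [abs_of_pos (inv_pos.2 hr), Complex.real_smul, Complex.ofReal_inv] at h
  have e1 : ∀ t : ℝ, r * t * (y / r) = t * y := fun t => by field_simp
  simp only [e1] at h
  rw [h]
  congr 1
  refine integral_congr_ae (Filter.Eventually.of_forall fun x => ?_)
  simp only [smul_eq_mul]
  rw [mul_comm, ee]
  congr 4
  simp [mul_comm]

lemma integral_mul_integral_kernel {α β : Type*} [MeasurableSpace α] [MeasurableSpace β]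
    {μ : Measure α} {ν : Measure β} [SFinite μ] [SFinite ν] {A : α → ℂ} {B : β → ℂ}
    (hA : Integrable A μ) (hB : Integrable B ν) {k : α → β → ℂ}
    (hk : AEStronglyMeasurable (Function.uncurry k) (μ.prod ν)) (hb : ∀ x y, ‖k x y‖ ≤ 1) :
    ∫ x, A x * ∫ y, B y * k x y ∂ν ∂μ = ∫ y, B y * ∫ x, A x * k x y ∂μ ∂ν := by
  have hint : Integrable (fun p : α × β => A p.1 * B p.2 * k p.1 p.2) (μ.prod ν) :=
    (hA.mul_prod hB).mul_bdd (c := 1) hk (Filter.Eventually.of_forall fun p => hb p.1 p.2)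
  have h := integral_integral_swap (f := fun x y => A x * B y * k x y) hint
  calc _ = ∫ x, ∫ y, A x * B y * k x y ∂ν ∂μ := by
        refine integral_congr_ae (Filter.Eventually.of_forall fun x => ?_)
        simp only [← integral_const_mul, mul_assoc]
    _ = _ := by
        rw [h]
        refine integral_congr_ae (Filter.Eventually.of_forall fun y => ?_)
        simp only [← integral_const_mul]
        refine integral_congr_ae (Filter.Eventually.of_forall fun x => ?_)
        simp only; ring

lemma SchwartzMap.integrable_mul_one_add_pow {m : ℕ} (g : 𝓢(Fin m → ℝ, ℂ)) (k : ℕ) :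
    Integrable fun ξ => ‖g ξ‖ * (1 + ‖ξ‖) ^ k := by
  have h1 := (g.integrable_pow_mul volume k)
  have h2 : Integrable fun ξ => ‖g ξ‖ := g.integrable.norm
  refine ((h2.add h1).const_mul (2 ^ (k - 1))).mono' (by
    have := g.continuous
    exact Continuous.aestronglyMeasurable (by fun_prop)) (Filter.Eventually.of_forall fun ξ => ?_)
  rw [Real.norm_of_nonneg (by positivity)]
  have := add_pow_le zero_le_one (norm_nonneg ξ) k
  rw [one_pow] at this
  simp only [Pi.add_apply]
  calc ‖g ξ‖ * (1 + ‖ξ‖) ^ k ≤ ‖g ξ‖ * (2 ^ (k - 1) * (1 + ‖ξ‖ ^ k)) := by gcongr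
    _ = _ := by ring

/-- A Peetre-type inequality for `decayWeight`. -/
lemma decayWeight_sub_le {m N : ℕ} (hm : 2 ≤ m) {G : (Fin m → ℝ) → ℝ} {L R : ℝ} (hL : 0 ≤ L)
    (hG0 : ∀ v, 0 ≤ G v) (hGL : ∀ v w, G v ≤ G w + L * ‖v - w‖) {r : ℝ} (hr : 0 ≤ r)
    (hrR : r ≤ R) (v ξ : Fin m → ℝ) :
    decayWeight m N G r (v - ξ) ≤
      (1 + R) ^ N * (1 + L) ^ N * (1 + ‖ξ‖) ^ (m + 2 * N) * decayWeight m N G r v := by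
  have hξ := norm_nonneg ξ
  have hη := norm_nonneg (v - ξ)
  have hv := norm_nonneg v
  have htri : ‖v‖ ≤ ‖v - ξ‖ + ‖ξ‖ := by simpa using norm_add_le (v - ξ) ξ
  have hR : 0 ≤ R := hr.trans hrR
  have hGv := hG0 v
  have hGη := hG0 (v - ξ)
  have h1 : (1 + ‖v - ξ‖) ^ (1 - (m : ℝ) / 2) ≤
      (1 + ‖ξ‖) ^ m * (1 + ‖v‖) ^ (1 - (m : ℝ) / 2) := by
    have hm' : (2 : ℝ) ≤ m := by exact_mod_cast hm
    have e1 : (1 + ‖v - ξ‖) ^ (1 - (m : ℝ) / 2) ≤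
        ((1 + ‖ξ‖)⁻¹ * (1 + ‖v‖)) ^ (1 - (m : ℝ) / 2) := by
      refine Real.rpow_le_rpow_of_nonpos (by positivity) ?_ (by linarith)
      rw [inv_mul_le_iff₀ (by positivity)]
      nlinarith [mul_nonneg hξ hη]
    refine e1.trans ?_
    rw [Real.mul_rpow (by positivity) (by positivity), Real.inv_rpow (by positivity),
      ← Real.rpow_neg (by positivity), ← Real.rpow_natCast]
    gcongr
    · linarith
    · linarith
  have h2 : ((1 + r * ‖v - ξ‖) ^ N)⁻¹ ≤
      ((1 + R) ^ N * (1 + ‖ξ‖) ^ N) * ((1 + r * ‖v‖) ^ N)⁻¹ := by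
    rw [← div_eq_mul_inv, inv_eq_one_div, div_le_div_iff₀ (by positivity) (by positivity), one_mul,
      ← mul_pow, ← mul_pow]
    refine pow_le_pow_left₀ (by positivity) ?_ N
    have a1 : r * ‖v‖ ≤ r * ‖v - ξ‖ + r * ‖ξ‖ := by nlinarith
    have a2 : r * ‖ξ‖ ≤ R * ‖ξ‖ := by gcongr
    have a3 : 0 ≤ r * ‖v - ξ‖ := by positivity
    have a4 : (1 + R * ‖ξ‖) ≤ (1 + R) * (1 + ‖ξ‖) := by nlinarith
    have a5 : (1 + R * ‖ξ‖) * (1 + r * ‖v - ξ‖) ≤ (1 + R) * (1 + ‖ξ‖) * (1 + r * ‖v - ξ‖) := by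
      gcongr
    nlinarith [mul_nonneg (mul_nonneg hR hξ) a3]
  have h3 : ((1 + G (v - ξ)) ^ N)⁻¹ ≤
      ((1 + L) ^ N * (1 + ‖ξ‖) ^ N) * ((1 + G v) ^ N)⁻¹ := by
    rw [← div_eq_mul_inv, inv_eq_one_div, div_le_div_iff₀ (by positivity) (by positivity), one_mul,
      ← mul_pow, ← mul_pow]
    refine pow_le_pow_left₀ (by positivity) ?_ N
    have a1 := hGL v (v - ξ)
    rw [sub_sub_cancel] at a1
    have a4 : (1 + L * ‖ξ‖) ≤ (1 + L) * (1 + ‖ξ‖) := by nlinarith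
    have a5 : (1 + L * ‖ξ‖) * (1 + G (v - ξ)) ≤ (1 + L) * (1 + ‖ξ‖) * (1 + G (v - ξ)) := by gcongr
    nlinarith [mul_nonneg (mul_nonneg hL hξ) hGη]
  unfold decayWeight
  have p1 : 0 ≤ (1 + ‖v - ξ‖) ^ (1 - (m : ℝ) / 2) := by positivity
  calc _ ≤ ((1 + ‖ξ‖) ^ m * (1 + ‖v‖) ^ (1 - (m : ℝ) / 2)) *
        ((((1 + R) ^ N * (1 + ‖ξ‖) ^ N) * ((1 + r * ‖v‖) ^ N)⁻¹) *
          (((1 + L) ^ N * (1 + ‖ξ‖) ^ N) * ((1 + G v) ^ N)⁻¹)) :=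
        mul_le_mul h1 (mul_le_mul h2 h3 (by positivity) (by positivity)) (by positivity)
          (by positivity)
    _ = _ := by rw [pow_add, two_mul, pow_add]; ring

lemma integral_signed_cubic {χ : ℝ → ℂ} {e : ℝ} (he : e ^ 2 = 1) (A B : ℝ) :
    ∫ x, χ (e * x) * ee (A * x ^ 3 - B * x) = cubicInt χ (e * A) (e * B) := by
  rcases mul_eq_zero.1 (show (e - 1) * (e + 1) = 0 by linear_combination he) with h | h
  · obtain rfl : e = 1 := by linarith
    simp [cubicInt]
  · obtain rfl : e = -1 := by linarith
    rw [← integral_neg_eq_self, cubicInt]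
    refine integral_congr_ae (Filter.Eventually.of_forall fun x => ?_)
    simp only
    congr 2 <;> ring

/-- The oscillatory integral with a product weight supported in one orthant. -/
lemma integral_orthant {m : ℕ} {a : Fin m → ℤ} {χ : ℝ → ℂ} (hχ : Continuous χ)
    (hc : HasCompactSupport χ) {e : Fin m → ℝ} (he : ∀ i, e i ^ 2 = 1) {Ψ P : 𝓢(ℝ, ℂ)}
    (hP : ∀ r : ℝ, 0 < r → ∀ y : ℝ, (r : ℂ)⁻¹ * Ψ (y / r) = ∫ t, P (r * t) * ee (t * y))
    {r : ℝ} (hr : 0 < r) (v : Fin m → ℝ) :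
    ∫ u : Fin m → ℝ, (∏ i, χ (e i * u i)) *
      (((r : ℂ)⁻¹ * Ψ ((∑ i, (a i : ℝ) * u i ^ 3) / r)) * ee (-(v ⬝ᵥ u))) =
    ∫ t, P (r * t) * ∏ i, cubicInt χ (e i * a i * t) (e i * v i) := by
  have he0 : ∀ i, e i ≠ 0 := fun i h0 => by have := he i; simp [h0] at this
  have hA : Integrable fun u : Fin m → ℝ => ∏ i, χ (e i * u i) :=
    Integrable.fintype_prod (f := fun i x => χ (e i * x)) fun i =>
      (hχ.integrable_of_hasCompactSupport hc).comp_mul_left' (he0 i)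
  have hB : Integrable fun t => P (r * t) := P.integrable.comp_mul_left' hr.ne'
  have h := integral_mul_integral_kernel hA hB
    (k := fun u t => ee (t * ∑ i, (a i : ℝ) * u i ^ 3) * ee (-(v ⬝ᵥ u)))
    (Continuous.aestronglyMeasurable (by
      simp only [dotProduct]
      fun_prop)) (fun x y => by rw [norm_mul, norm_ee, norm_ee, one_mul])
  calc _ = ∫ u : Fin m → ℝ, (∏ i, χ (e i * u i)) *
        ∫ t, P (r * t) * (ee (t * ∑ i, (a i : ℝ) * u i ^ 3) * ee (-(v ⬝ᵥ u))) := by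
        refine integral_congr_ae (Filter.Eventually.of_forall fun u => ?_)
        simp only
        rw [hP r hr]
        simp only [← mul_assoc]
        rw [integral_mul_const]
        ring
    _ = _ := by
        rw [h]
        refine integral_congr_ae (Filter.Eventually.of_forall fun t => ?_)
        simp only
        congr 1
        have h2 := integral_fintype_prod_volume_eq_prod (𝕜 := ℂ)
          (fun i (x : ℝ) => χ (e i * x) * ee (a i * t * x ^ 3 - v i * x))
        simp only [integral_signed_cubic (he _)] at h2
        simp only [mul_assoc] at h2 ⊢
        rw [← h2]
        refine integral_congr_ae (Filter.Eventually.of_forall fun u => ?_)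
        simp only
        rw [Finset.prod_mul_distrib, ← ee_sum, ← ee_add]
        congr 2
        simp only [dotProduct]
        rw [Finset.sum_sub_distrib, Finset.mul_sum, sub_eq_add_neg]
        congr 1
        exact Finset.sum_congr rfl fun i _ => by ring

/-- The core estimate for weights cut off to one orthant. -/
lemma orthant_bound {m : ℕ} (hm : 2 ≤ m) {a : Fin m → ℤ} (ha : ∀ i, a i ≠ 0)
    {Fd : MvPolynomial (Fin m) ℚ} (hFd : IsDualForm (diagonalCubic a) Fd)
    {χ : ℝ → ℂ} {p q : ℝ} (hp : 0 < p) (hpq : p ≤ q) (hχ : ContDiff ℝ ∞ χ)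
    (hs : tsupport χ ⊆ Icc p q) {e : Fin m → ℝ} (he : ∀ i, e i ^ 2 = 1)
    {w : (Fin m → ℝ) → ℂ} (hw : ContDiff ℝ ∞ w) (hwc : HasCompactSupport w)
    (Ψ : 𝓢(ℝ, ℂ)) (N : ℕ) (R : ℝ) :
    ∃ C : ℝ, 0 ≤ C ∧ ∀ (r : ℝ) (v : Fin m → ℝ), 0 < r → r ≤ R →
      ‖∫ u : Fin m → ℝ, w u * ((∏ i, χ (e i * u i)) *
        (((r : ℂ)⁻¹ * Ψ ((∑ i, (a i : ℝ) * u i ^ 3) / r)) * ee (-(v ⬝ᵥ u))))‖ ≤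
        C * decayWeight m N (dualSize Fd) r v := by
  have hcs : HasCompactSupport χ := HasCompactSupport.of_support_subset_isCompact isCompact_Icc
    ((subset_tsupport χ).trans hs)
  have hm0 : 0 < m := by omega
  have haR : ∀ i, (a i : ℝ) ≠ 0 := fun i => by exact_mod_cast ha i
  have he0 : ∀ i, e i ≠ 0 := fun i h0 => by have := he i; simp [h0] at this
  have he1 : ∀ i, |e i| = 1 := fun i => by
    rw [← sq_eq_sq₀ (abs_nonneg _) zero_le_one, sq_abs, he i, one_pow]
  obtain ⟨P, hP⟩ := exists_fourier_representation_real Ψ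
  obtain ⟨g, -, hg⟩ := exists_fourier_representation hw hwc
  obtain ⟨L, hL0, hLv, hLL⟩ := exists_dualSize_lipschitz Fd
  obtain ⟨Cd, hCd0, hCd⟩ := abs_dualForm_le hm0 ha hFd
  -- Reflecting coordinates moves the orthant to the positive one. The coefficients become e_i a_i,
  -- and the dual form is pulled back through the involution T, an isometry for the maximum norm.
  set T : (Fin m → ℝ) → (Fin m → ℝ) := fun v i => e i * v i with hT
  have hTT : ∀ v, T (T v) = v := fun v => by
    ext i; simp only [hT]; rw [← mul_assoc, ← sq, he i, one_mul]
  have hTn : ∀ v, ‖T v‖ = ‖v‖ := fun v => by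
    have h1 : ∀ v, ‖T v‖ ≤ ‖v‖ := fun v => (pi_norm_le_iff_of_nonneg (norm_nonneg _)).2 fun i => by
      simp only [hT]; rw [norm_mul, Real.norm_eq_abs, he1, one_mul]; exact norm_le_pi_norm v i
    exact le_antisymm (h1 v) (by simpa [hTT] using h1 (T v))
  obtain ⟨C, hC0, hC⟩ := integral_prod_cubicInt hm (α := fun i => e i * a i)
    (fun i => mul_ne_zero (he0 i) (haR i)) hp hpq hχ hs P (G := fun v => dualSize Fd (T v)) hL0 hCd0
    (fun v => dualSize_nonneg _ _) (fun v => by simpa [hTn] using hLv (T v))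
    (fun s v z hs hv hz => by
      have hTz : ∑ i, e i * a i * z i ^ 3 = ∑ i, (a i : ℝ) * (T z) i ^ 3 := by
        refine Finset.sum_congr rfl fun i _ => ?_
        simp only [hT]
        linear_combination (-(e i) * a i * z i ^ 3) * he i
      have h1 := hCd s (T v) (T z) hs (by rwa [hTn]) fun i => by
        have := hz i
        rw [hTn]
        simp only [hT]
        have h2 : e i * (s * (v i / ‖v‖)) = s * (e i * v i / ‖v‖) := by ring
        rw [← h2, ← this]
        ring
      rw [hTz]
      unfold dualSize
      rw [hTn] at h1 ⊢
      nlinarith [norm_nonneg v]) N R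
  have hwt : ∀ r v, decayWeight m N (fun v => dualSize Fd (T v)) r (T v) =
      decayWeight m N (dualSize Fd) r v := fun r v => by simp only [decayWeight, hTn, hTT]
  -- The shift from v to v - ξ costs (1 + ‖ξ‖)^(m+2N), which the Schwartz decay of the Fourier
  -- transform of w absorbs.
  set K := ∫ ξ, ‖g ξ‖ * (1 + ‖ξ‖) ^ (m + 2 * N) with hK
  have hK0 : 0 ≤ K := integral_nonneg fun ξ => by positivity
  refine ⟨|1 + R| ^ N * (1 + L) ^ N * C * K, by positivity, fun r v hr hrR => ?_⟩
  have hR : 0 ≤ 1 + R := by linarith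
  rw [abs_of_nonneg hR]
  -- the weight is expanded by Fourier inversion
  set A : (Fin m → ℝ) → ℂ := fun u => (∏ i, χ (e i * u i)) *
    (((r : ℂ)⁻¹ * Ψ ((∑ i, (a i : ℝ) * u i ^ 3) / r))) with hAdef
  have hA0 : Integrable fun u : Fin m → ℝ => ∏ i, χ (e i * u i) :=
    Integrable.fintype_prod (f := fun i x => χ (e i * x)) fun i =>
      (hχ.continuous.integrable_of_hasCompactSupport hcs).comp_mul_left' (he0 i)
  obtain ⟨CΨ, hCΨ0, hCΨ⟩ := SchwartzMap.exists_one_add_pow_mul_le Ψ 0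
  have hA : Integrable A := hA0.mul_bdd (c := |r⁻¹| * CΨ) (by
      have := Ψ.continuous
      exact Continuous.aestronglyMeasurable (by fun_prop))
    (Filter.Eventually.of_forall fun u => by
      rw [norm_mul, ← Complex.ofReal_inv, Complex.norm_real, Real.norm_eq_abs]
      have := hCΨ ((∑ i, (a i : ℝ) * u i ^ 3) / r)
      simp only [pow_zero, mul_one] at this
      gcongr)
  have hswap := integral_mul_integral_kernel hA (g.integrable (μ := volume))
    (k := fun u ξ => ee (ξ ⬝ᵥ u) * ee (-(v ⬝ᵥ u))) (Continuous.aestronglyMeasurable (by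
      simp only [dotProduct]
      fun_prop)) (fun x y => by rw [norm_mul, norm_ee, norm_ee, one_mul])
  have hmain : ∫ u : Fin m → ℝ, w u * ((∏ i, χ (e i * u i)) *
        (((r : ℂ)⁻¹ * Ψ ((∑ i, (a i : ℝ) * u i ^ 3) / r)) * ee (-(v ⬝ᵥ u)))) =
      ∫ ξ, g ξ * ∫ t, P (r * t) * ∏ i, cubicInt χ (e i * a i * t) (e i * (v - ξ) i) := by
    calc _ = ∫ u, A u * ∫ ξ, g ξ * (ee (ξ ⬝ᵥ u) * ee (-(v ⬝ᵥ u))) := by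
          refine integral_congr_ae (Filter.Eventually.of_forall fun u => ?_)
          simp only [hAdef]
          rw [hg u]
          simp only [← mul_assoc]
          rw [integral_mul_const]
          ring
      _ = _ := by
          rw [hswap]
          refine integral_congr_ae (Filter.Eventually.of_forall fun ξ => ?_)
          simp only
          rw [← integral_orthant hχ.continuous hcs he hP hr]
          congr 1
          refine integral_congr_ae (Filter.Eventually.of_forall fun u => ?_)
          simp only [hAdef]
          rw [← ee_add, sub_dotProduct, neg_sub, sub_eq_add_neg, mul_assoc]
  rw [hmain]
  set W := decayWeight m N (dualSize Fd) r v with hW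
  refine (norm_integral_le_of_norm_le ((SchwartzMap.integrable_mul_one_add_pow g
    (m + 2 * N)).mul_const (C * ((1 + R) ^ N * (1 + L) ^ N * W)))
    (Filter.Eventually.of_forall fun ξ => ?_)).trans (le_of_eq ?_)
  · rw [norm_mul]
    have h1 := hC r (T (v - ξ)) hr hrR
    rw [hwt] at h1
    have h2 := decayWeight_sub_le (N := N) hm hL0 (dualSize_nonneg Fd) hLL hr.le hrR v ξ
    calc _ ≤ ‖g ξ‖ * (C * ((1 + R) ^ N * (1 + L) ^ N * (1 + ‖ξ‖) ^ (m + 2 * N) * W)) := by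
          refine mul_le_mul_of_nonneg_left (h1.trans ?_) (norm_nonneg _)
          gcongr
      _ = _ := by ring
  · rw [integral_mul_const, ← hK]; ring

/-- The oscillatory integral of the delta method with a Schwartz kernel. -/
theorem schwartzKernel_bound {m : ℕ} (hm : 2 ≤ m) {a : Fin m → ℤ} (ha : ∀ i, a i ≠ 0)
    {Fd : MvPolynomial (Fin m) ℚ} (hFd : IsDualForm (diagonalCubic a) Fd)
    {w : (Fin m → ℝ) → ℂ} (hw : ContDiff ℝ ∞ w) (hwc : HasCompactSupport w)
    (hw0 : ∀ u ∈ tsupport w, ∀ i, u i ≠ 0) (Ψ : 𝓢(ℝ, ℂ)) (N : ℕ) (R : ℝ) :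
    ∃ C : ℝ, 0 ≤ C ∧ ∀ (r : ℝ) (v : Fin m → ℝ), 0 < r → r ≤ R →
      ‖∫ u : Fin m → ℝ, w u *
        (((r : ℂ)⁻¹ * Ψ ((∑ i, (a i : ℝ) * u i ^ 3) / r)) * ee (-(v ⬝ᵥ u)))‖ ≤
        C * decayWeight m N (dualSize Fd) r v := by
  obtain ⟨δ, D, hδ, hδD, hb⟩ : ∃ δ D : ℝ, 0 < δ ∧ δ < D ∧
      ∀ u ∈ tsupport w, ∀ i, δ ≤ |u i| ∧ |u i| ≤ D := by
    obtain ⟨D, hD⟩ := hwc.isCompact.exists_bound_of_continuousOn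
      (f := fun u : Fin m → ℝ => u) continuous_id.continuousOn
    have h1 : ∀ s : Finset (Fin m), ∃ δ : ℝ, 0 < δ ∧ ∀ u ∈ tsupport w, ∀ i ∈ s, δ ≤ |u i| := by
      intro s
      induction s using Finset.induction_on with
      | empty => exact ⟨1, one_pos, by simp⟩
      | insert i s _ ih =>
        obtain ⟨δ, hδ, hs⟩ := ih
        obtain ⟨δ', hδ', hs'⟩ : ∃ δ' : ℝ, 0 < δ' ∧ ∀ u ∈ tsupport w, δ' ≤ |u i| := by
          rcases (tsupport w).eq_empty_or_nonempty with h0 | h0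
          · exact ⟨1, one_pos, by simp [h0]⟩
          · obtain ⟨u, hu, hmin⟩ := hwc.isCompact.exists_isMinOn h0
              (f := fun u : Fin m → ℝ => |u i|) (by fun_prop)
            exact ⟨|u i|, abs_pos.2 (hw0 u hu i), fun u' hu' => hmin hu'⟩
        refine ⟨min δ δ', lt_min hδ hδ', fun u hu j hj => ?_⟩
        rcases Finset.mem_insert.1 hj with rfl | hj
        · exact (min_le_right _ _).trans (hs' u hu)
        · exact (min_le_left _ _).trans (hs u hu j hj)
    obtain ⟨δ, hδ, hs⟩ := h1 Finset.univ
    refine ⟨δ, |D| + δ + 1, hδ, by linarith [abs_nonneg D], fun u hu i =>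
      ⟨hs u hu i (Finset.mem_univ i), ?_⟩⟩
    have := (norm_le_pi_norm u i).trans (hD u hu)
    rw [Real.norm_eq_abs] at this
    linarith [le_abs_self D]
  -- A cutoff equal to 1 on [δ, D], where the |u_i| lie, and supported in [δ/2, D + δ/2], still away
  -- from 0.
  let β : ContDiffBump ((δ + D) / 2) :=
    ⟨(D - δ) / 2 + δ / 4, (D - δ) / 2 + δ / 2, by linarith, by linarith⟩
  set χ : ℝ → ℂ := fun x => ((β x : ℝ) : ℂ) with hχdef
  have hχ : ContDiff ℝ ∞ χ := Complex.ofRealCLM.contDiff.comp β.contDiff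
  have hs : tsupport χ ⊆ Icc (δ / 2) (D + δ / 2) := by
    have h1 : tsupport χ ⊆ tsupport β :=
      closure_mono fun x hx => by
        simp only [hχdef, Function.mem_support, ne_eq, Complex.ofReal_eq_zero] at hx
        exact hx
    refine h1.trans ?_
    rw [β.tsupport_eq, Real.closedBall_eq_Icc]
    refine Icc_subset_Icc (le_of_eq ?_) (le_of_eq ?_) <;> simp only [β] <;> ring
  have hχ1 : ∀ x, δ ≤ x → x ≤ D → χ x = 1 := fun x h1 h2 => by
    have : β x = 1 := β.one_of_mem_closedBall (by
      rw [Real.closedBall_eq_Icc]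
      constructor <;> simp only [β] <;> linarith)
    simp only [hχdef, this, Complex.ofReal_one]
  have hχ0 : ∀ x, x < δ / 2 → χ x = 0 := fun x hx => by
    by_contra h
    exact absurd (hs (subset_tsupport χ h)).1 (by linarith)
  set σ : Bool → ℝ := fun b => if b then 1 else -1 with hσ
  have hσ2 : ∀ b, σ b ^ 2 = 1 := fun b => by cases b <;> simp [hσ]
  -- Σ_ε ∏ χ(ε_i u_i) = ∏ (χ(u_i) + χ(-u_i)), and on the support of w each factor is 1: one term
  -- equals 1 and the other 0.
  have hpart : ∀ u, w u = ∑ ε : Fin m → Bool, w u * ∏ i, χ (σ (ε i) * u i) := by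
    intro u
    by_cases hu : u ∈ tsupport w
    · rw [← Finset.mul_sum]
      have h1 := Finset.prod_univ_sum (fun _ : Fin m => (Finset.univ : Finset Bool))
        (fun i b => χ (σ b * u i))
      rw [Fintype.piFinset_univ] at h1
      rw [← h1, Finset.prod_eq_one, mul_one]
      intro i _
      obtain ⟨k1, k2⟩ := hb u hu i
      simp only [Fintype.sum_bool, hσ, if_true, Bool.false_eq_true, if_false, one_mul, neg_mul]
      rcases le_total 0 (u i) with h0 | h0
      · rw [abs_of_nonneg h0] at k1 k2
        rw [hχ1 _ k1 k2, hχ0 _ (by linarith), add_zero]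
      · rw [abs_of_nonpos h0] at k1 k2
        rw [hχ1 _ k1 k2, hχ0 _ (by linarith), zero_add]
    · rw [image_eq_zero_of_notMem_tsupport hu]; simp
  choose C hC0 hC using fun ε : Fin m → Bool => orthant_bound hm ha hFd (p := δ / 2)
    (q := D + δ / 2) (by linarith) (by linarith) hχ hs (e := fun i => σ (ε i))
    (fun i => hσ2 _) hw hwc Ψ N R
  refine ⟨∑ ε, C ε, Finset.sum_nonneg fun ε _ => hC0 ε, fun r v hr hrR => ?_⟩
  have hsum : ∫ u : Fin m → ℝ, w u *
      (((r : ℂ)⁻¹ * Ψ ((∑ i, (a i : ℝ) * u i ^ 3) / r)) * ee (-(v ⬝ᵥ u))) =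
      ∑ ε : Fin m → Bool, ∫ u : Fin m → ℝ, w u * ((∏ i, χ (σ (ε i) * u i)) *
        (((r : ℂ)⁻¹ * Ψ ((∑ i, (a i : ℝ) * u i ^ 3) / r)) * ee (-(v ⬝ᵥ u)))) := by
    rw [← integral_finsetSum]
    · refine integral_congr_ae (Filter.Eventually.of_forall fun u => ?_)
      simp only
      conv_lhs => rw [hpart u]
      rw [Finset.sum_mul]
      exact Finset.sum_congr rfl fun ε _ => by ring
    · intro ε _
      have h1 := hw.continuous
      have h2 := hχ.continuous
      have h3 := Ψ.continuous
      exact Continuous.integrable_of_hasCompactSupport (by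
        simp only [dotProduct]
        fun_prop) hwc.mul_right
  rw [hsum, Finset.sum_mul]
  exact (norm_sum_le _ _).trans (Finset.sum_le_sum fun ε _ => hC ε r v hr hrR)

end CubicDelta

end

noncomputable section

open scoped ContDiff SchwartzMap

namespace CubicDelta

open MeasureTheory Set

/-! The kernel of the delta method. -/

/-- Smooth functions supported in a compact subset of the positive half line. -/
structure IsPosBump (g : ℝ → ℂ) : Prop where
  contDiff : ContDiff ℝ ∞ g
  exists_support : ∃ p q : ℝ, 0 < p ∧ ∀ x, g x ≠ 0 → p ≤ x ∧ x ≤ q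

namespace IsPosBump

variable {g : ℝ → ℂ}

lemma tsupport_subset (hg : IsPosBump g) : ∃ p q : ℝ, 0 < p ∧ tsupport g ⊆ Icc p q := by
  obtain ⟨p, q, hp, h⟩ := hg.exists_support
  exact ⟨p, q, hp, closure_minimal (fun x hx => h x hx) isClosed_Icc⟩

lemma hasCompactSupport (hg : IsPosBump g) : HasCompactSupport g := by
  obtain ⟨p, q, -, h⟩ := hg.tsupport_subset
  exact HasCompactSupport.of_support_subset_isCompact isCompact_Icc ((subset_tsupport g).trans h)

lemma integrable (hg : IsPosBump g) : Integrable g :=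
  hg.contDiff.continuous.integrable_of_hasCompactSupport hg.hasCompactSupport

lemma differentiable (hg : IsPosBump g) : Differentiable ℝ g :=
  hg.contDiff.differentiable (by norm_num)

lemma euler (hg : IsPosBump g) : IsPosBump fun z => (z : ℂ) * deriv g z := by
  obtain ⟨p, q, hp, h⟩ := hg.tsupport_subset
  refine ⟨Complex.ofRealCLM.contDiff.mul (contDiff_infty_iff_deriv.1 hg.contDiff).2, p, q, hp,
    fun x hx => h (support_deriv_subset (right_ne_zero_of_mul hx))⟩

lemma add {g' : ℝ → ℂ} (hg : IsPosBump g) (hg' : IsPosBump g') :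
    IsPosBump fun z => g z + g' z := by
  obtain ⟨p, q, hp, h⟩ := hg.exists_support
  obtain ⟨p', q', hp', h'⟩ := hg'.exists_support
  refine ⟨hg.contDiff.add hg'.contDiff, min p p', max q q', lt_min hp hp', fun x hx => ?_⟩
  by_cases h0 : g x = 0
  · have := h' x (by simpa [h0] using hx)
    exact ⟨(min_le_right _ _).trans this.1, this.2.trans (le_max_right _ _)⟩
  · have := h x h0
    exact ⟨(min_le_left _ _).trans this.1, this.2.trans (le_max_left _ _)⟩

lemma const_mul (hg : IsPosBump g) (c : ℂ) : IsPosBump fun z => c * g z := by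
  obtain ⟨p, q, hp, h⟩ := hg.exists_support
  exact ⟨contDiff_const.mul hg.contDiff, p, q, hp, fun x hx => h x (right_ne_zero_of_mul hx)⟩

lemma integral_euler (hg : IsPosBump g) : ∫ z : ℝ, (z : ℂ) * deriv g z = - ∫ z, g z := by
  have hc := hg.contDiff.continuous
  have h := integral_mul_deriv_eq_deriv_mul_of_integrable (u := fun x : ℝ => (x : ℂ)) (v := g)
    (u' := fun _ => 1) (v' := deriv g) (fun x _ => Complex.ofRealCLM.hasDerivAt)
    (fun x _ => (hg.differentiable x).hasDerivAt) hg.euler.integrable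
    ((continuous_const.mul hc).integrable_of_hasCompactSupport hg.hasCompactSupport.mul_left)
    (((Complex.continuous_ofReal).mul hc).integrable_of_hasCompactSupport
      hg.hasCompactSupport.mul_left)
  simpa using h

end IsPosBump

/-- The error term in the approximation of `x⁻¹ ∫ g` by the Riemann sum `∑_{j ≥ 1} g (j x)`. -/
def riemannError (g : ℝ → ℂ) (x : ℝ) : ℂ :=
  ∑' j : ℕ, g ((j + 1) * x) - (x : ℂ)⁻¹ * ∫ z, g z

/-- One range of summation works for all x above a positive level, so the infinite sum is locally
finite and may be differentiated term by term. -/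
lemma IsPosBump.exists_finite_sum {g : ℝ → ℂ} (hg : IsPosBump g) {l : ℝ} (hl : 0 < l) :
    ∃ M : ℕ, ∀ x, l < x → ∀ j : ℕ, j ∉ Finset.range M → g ((j + 1) * x) = 0 := by
  obtain ⟨p, q, hp, h⟩ := hg.exists_support
  refine ⟨⌈q / l⌉₊, fun x hx j hj => ?_⟩
  by_contra h0
  have h1 := (h _ h0).2
  rw [Finset.mem_range, not_lt] at hj
  have h2 : q / l ≤ j := Nat.ceil_le.1 hj
  rw [div_le_iff₀ hl] at h2
  have hj0 : (0 : ℝ) ≤ j := Nat.cast_nonneg j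
  nlinarith

lemma IsPosBump.exists_riemannError_eq {g : ℝ → ℂ} (hg : IsPosBump g) {l : ℝ} (hl : 0 < l) :
    ∃ M : ℕ, ∀ x, l < x → riemannError g x =
      ∑ j ∈ Finset.range M, g ((j + 1) * x) - (x : ℂ)⁻¹ * ∫ z, g z := by
  obtain ⟨M, hM⟩ := hg.exists_finite_sum hl
  exact ⟨M, fun x hx => by rw [riemannError, tsum_eq_sum (hM x hx)]⟩

lemma IsPosBump.contDiffAt_riemannError {g : ℝ → ℂ} (hg : IsPosBump g) {x : ℝ} (hx : 0 < x) :
    ContDiffAt ℝ ∞ (riemannError g) x := by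
  obtain ⟨M, hM⟩ := hg.exists_riemannError_eq (half_pos hx)
  have he : riemannError g =ᶠ[nhds x] fun x =>
      ∑ j ∈ Finset.range M, g ((j + 1) * x) - (x : ℂ)⁻¹ * ∫ z, g z :=
    (eventually_gt_nhds (half_lt_self hx)).mono hM
  refine ContDiffAt.congr_of_eventuallyEq ?_ he
  refine ContDiffAt.sub (ContDiffAt.sum fun j _ =>
    (hg.contDiff.comp (contDiff_const.mul contDiff_id)).contDiffAt) ?_
  refine ContDiffAt.mul ?_ contDiffAt_const
  exact (Complex.ofRealCLM.contDiff.contDiffAt).inv (Complex.ofReal_ne_zero.2 hx.ne')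

/-- The operator x∂_x acts on sum and integral alike by g ↦ zg', because integration by parts gives
∫ zg' = -∫ g. The class of such errors is therefore stable under it. -/
lemma IsPosBump.hasDerivAt_riemannError {g : ℝ → ℂ} (hg : IsPosBump g) {x : ℝ} (hx : 0 < x) :
    HasDerivAt (riemannError g)
      ((x : ℂ)⁻¹ * riemannError (fun z => (z : ℂ) * deriv g z) x) x := by
  obtain ⟨M₁, hM₁⟩ := hg.exists_finite_sum (half_pos hx)
  obtain ⟨M₂, hM₂⟩ := hg.euler.exists_finite_sum (half_pos hx)
  set M := max M₁ M₂ with hMd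
  have he : riemannError g =ᶠ[nhds x] fun x =>
      ∑ j ∈ Finset.range M, g ((j + 1) * x) - (x : ℂ)⁻¹ * ∫ z, g z :=
    (eventually_gt_nhds (half_lt_self hx)).mono fun y hy => by
      rw [riemannError, tsum_eq_sum (s := Finset.range M) fun j hj => hM₁ y hy j fun h => hj
        (Finset.range_subset_range.2 (le_max_left _ _) h)]
  have hx' : (x : ℂ) ≠ 0 := by exact_mod_cast hx.ne'
  refine HasDerivAt.congr_of_eventuallyEq ?_ he
  have h1 : HasDerivAt (fun y : ℝ => ∑ j ∈ Finset.range M, g ((j + 1) * y))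
      (∑ j ∈ Finset.range M, ((j + 1 : ℝ) : ℂ) * deriv g ((j + 1) * x)) x := by
    refine HasDerivAt.fun_sum fun j _ => ?_
    have := HasDerivAt.scomp x ((hg.differentiable ((j + 1) * x)).hasDerivAt)
      ((hasDerivAt_id x).const_mul (j + 1 : ℝ))
    simpa [Function.comp_def] using this
  have h2 : HasDerivAt (fun y : ℝ => ((y : ℂ))⁻¹ * ∫ z, g z)
      (-((x : ℂ) ^ 2)⁻¹ * ∫ z, g z) x := by
    have h3 : HasDerivAt (fun y : ℝ => (y : ℂ)) 1 x := Complex.ofRealCLM.hasDerivAt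
    have := (h3.fun_inv hx').mul_const (∫ z, g z)
    refine HasDerivAt.congr_deriv this ?_
    field_simp
  refine HasDerivAt.congr_deriv (h1.sub h2) ?_
  rw [riemannError, hg.integral_euler, tsum_eq_sum (s := Finset.range M) fun j hj =>
    hM₂ x (half_lt_self hx) j fun h => hj (Finset.range_subset_range.2 (le_max_right _ _) h),
    mul_sub, Finset.mul_sum]
  congr 1
  · refine Finset.sum_congr rfl fun j _ => ?_
    push_cast
    field_simp
  · field_simp

/-- The Riemann sum of a smooth bump is extremely accurate (Poisson summation). -/
lemma IsPosBump.riemannError_le {g : ℝ → ℂ} (hg : IsPosBump g) {N : ℕ} (hN : 1 ≤ N) :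
    ∃ C : ℝ, 0 ≤ C ∧ ∀ x, 0 < x → ‖riemannError g x‖ ≤ C * x ^ N := by
  obtain ⟨p, q, hp, hsupp⟩ := hg.exists_support
  set S : 𝓢(ℝ, ℂ) := hg.hasCompactSupport.toSchwartzMap hg.contDiff with hS
  have hSa : ∀ x, S x = g x := fun x => rfl
  obtain ⟨C, hC0, hC⟩ := SchwartzMap.exists_one_add_pow_mul_le (FourierTransform.fourier S) (N + 1)
  have hsum : Summable fun n : ℤ => 1 / (n : ℝ) ^ 2 := Real.summable_one_div_int_pow.2 one_lt_two
  set Z := ∑' n : ℤ, 1 / (n : ℝ) ^ 2 with hZ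
  have hZ0 : 0 ≤ Z := tsum_nonneg fun n => by positivity
  refine ⟨C * Z, by positivity, fun x hx => ?_⟩
  have hx' : (x : ℂ) ≠ 0 := by exact_mod_cast hx.ne'
  set T : 𝓢(ℝ, ℂ) := SchwartzMap.compCLMOfContinuousLinearEquiv ℝ
    (ContinuousLinearEquiv.unitsEquivAut ℝ (Units.mk0 x hx.ne')) S with hT
  have hTa : ∀ y, T y = g (x * y) := fun y => by
    change S (y * x) = _
    rw [hSa, mul_comm]
  have hfour : ∀ n : ℝ, (FourierTransform.fourier T) n =
      (x : ℂ)⁻¹ * (FourierTransform.fourier S) (n / x) := fun n => by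
    rw [SchwartzMap.fourier_coe, SchwartzMap.fourier_coe, Real.fourier_eq', Real.fourier_eq']
    have h := Measure.integral_comp_mul_left
      (fun v => Complex.exp ((((-2 * Real.pi * inner ℝ v (n / x)) : ℝ) : ℂ) * Complex.I) • S v) x
    rw [abs_of_pos (inv_pos.2 hx), Complex.real_smul, Complex.ofReal_inv] at h
    rw [← h]
    refine integral_congr_ae (Filter.Eventually.of_forall fun v => ?_)
    simp only [hTa, hSa, RCLike.inner_apply, conj_trivial]
    congr 5
    field_simp
  have hpois := SchwartzMap.tsum_eq_tsum_fourier T 0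
  simp only [zero_add, hTa, hfour] at hpois
  -- g vanishes on the nonpositive half line, so the one-sided sum is a full lattice sum.
  have hL : ∑' j : ℕ, g ((j + 1) * x) = ∑' n : ℤ, g (x * n) := by
    have hinj : Function.Injective fun j : ℕ => (j + 1 : ℤ) := fun i j h => by
      simpa using h
    rw [← hinj.tsum_eq]
    · refine tsum_congr fun j => ?_
      push_cast; rw [mul_comm]
    · intro n hn
      have h1 := (hsupp _ hn).1
      have h2 : (0 : ℝ) < n := by
        by_contra h0
        push Not at h0
        nlinarith
      have h3 : 0 < n := by exact_mod_cast h2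
      exact ⟨(n - 1).toNat, by simp only; omega⟩
  have hbound : ∀ n : ℤ, n ≠ 0 → ‖(x : ℂ)⁻¹ * (FourierTransform.fourier S) (n / x)‖ ≤
      C * x ^ N * (1 / (n : ℝ) ^ 2) := fun n hn => by
    have hn1 : (1 : ℝ) ≤ |(n : ℝ)| := by
      exact_mod_cast Int.one_le_abs hn
    have h1 := hC (n / x)
    rw [norm_mul, norm_inv, Complex.norm_real, Real.norm_of_nonneg hx.le]
    have h2 : (|(n : ℝ)| / x) ^ (N + 1) ≤ (1 + |(n : ℝ) / x|) ^ (N + 1) := by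
      rw [abs_div, abs_of_pos hx]; gcongr; linarith
    have h3 : ‖(FourierTransform.fourier S) ((n : ℝ) / x)‖ * (|(n : ℝ)| / x) ^ (N + 1) ≤ C :=
      le_trans (by gcongr) h1
    have h4 : (n : ℝ) ^ 2 ≤ |(n : ℝ)| ^ (N + 1) := by
      rw [← sq_abs]; exact pow_le_pow_right₀ hn1 (by omega)
    have h5 : 0 < (n : ℝ) ^ 2 := by positivity
    rw [div_pow, mul_div_assoc', div_le_iff₀ (by positivity)] at h3
    rw [mul_one_div, le_div_iff₀ h5, inv_mul_eq_div, div_mul_eq_mul_div, div_le_iff₀ hx]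
    calc _ ≤ ‖(FourierTransform.fourier S) ((n : ℝ) / x)‖ * |(n : ℝ)| ^ (N + 1) := by gcongr
      _ ≤ C * x ^ (N + 1) := h3
      _ = _ := by ring
  have hsumm : Summable fun n : ℤ => (x : ℂ)⁻¹ * (FourierTransform.fourier S) (n / x) := by
    refine Summable.of_norm_bounded_eventually (hsum.mul_left (C * x ^ N)) ?_
    refine (Set.finite_singleton (0 : ℤ)).subset fun n hn => ?_
    by_contra h0
    exact hn (hbound n h0)
  have h0 : (FourierTransform.fourier S) 0 = ∫ z, g z := by
    rw [SchwartzMap.fourier_coe, Real.fourier_eq']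
    simp [hSa]
  have hone : ∀ n : ℤ, (fourier n : C(UnitAddCircle, ℂ)) ((0 : ℝ) : UnitAddCircle) = 1 :=
    fun n => by rw [fourier_coe_apply]; simp
  simp only [hone, mul_one] at hpois
  -- The zero frequency is x⁻¹∫ g and cancels the subtracted main term; the other frequencies n/x
  -- are large, and the decay of the transform supplies x^N.
  rw [riemannError, hL, hpois, hsumm.tsum_eq_add_tsum_ite 0, Int.cast_zero, zero_div, h0,
    add_sub_cancel_left]
  refine (tsum_of_norm_bounded (hsum.hasSum.mul_left (C * x ^ N)) fun n => ?_).trans (le_of_eq ?_)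
  · split_ifs with h
    · simp [h]
    · exact hbound n h
  · rw [← hZ]; ring

end CubicDelta

end

/-! ### The kernel h as a Riemann sum error plus a rescaled Schwartz profile -/

noncomputable section

open scoped ContDiff SchwartzMap

namespace CubicDelta

open MeasureTheory Set

lemma omegaZero_eq (x : ℝ) : omegaZero x = expNegInvGlue (1 - x ^ 2) := by
  have h : |x| < 1 ↔ ¬ 1 - x ^ 2 ≤ 0 := by
    rw [← sq_lt_one_iff_abs_lt_one]; constructor <;> intro h <;> linarith
  unfold omegaZero expNegInvGlue
  by_cases h1 : |x| < 1
  · rw [if_pos h1, if_neg (h.1 h1)]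
  · rw [if_neg h1, if_pos (by rw [h] at h1; push Not at h1; exact h1)]

lemma contDiff_omega : ContDiff ℝ ∞ omega := by
  have : omega = fun x => 4 * (∫ t, omegaZero t)⁻¹ * expNegInvGlue (1 - (4 * x - 3) ^ 2) :=
    funext fun x => by rw [omega, omegaZero_eq]
  rw [this]
  exact contDiff_const.mul (expNegInvGlue.contDiff.comp (by fun_prop))

lemma omega_ne_zero {x : ℝ} (h : omega x ≠ 0) : 1 / 2 < x ∧ x < 1 := by
  have h1 : omegaZero (4 * x - 3) ≠ 0 := right_ne_zero_of_mul h
  have h2 : |4 * x - 3| < 1 := by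
    by_contra h0
    exact h1 (if_neg h0)
  rw [abs_lt] at h2
  constructor <;> linarith

lemma omega_of_le {x : ℝ} (h : x ≤ 1 / 2) : omega x = 0 := by
  by_contra h0; linarith [(omega_ne_zero h0).1]

lemma omega_of_ge {x : ℝ} (h : 1 ≤ x) : omega x = 0 := by
  by_contra h0; linarith [(omega_ne_zero h0).2]

lemma contDiff_of_pos {f : ℝ → ℂ} {p : ℝ} (hp : 0 < p) (h0 : ∀ x, x < p → f x = 0)
    (h : ∀ x, 0 < x → ContDiffAt ℝ ∞ f x) : ContDiff ℝ ∞ f := by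
  rw [contDiff_iff_contDiffAt]
  intro x
  rcases lt_or_ge x p with hx | hx
  · exact (contDiffAt_const (c := (0 : ℂ))).congr_of_eventuallyEq ((eventually_lt_nhds hx).mono h0)
  · exact h x (hp.trans_le hx)

/-- `ω(z) / z`. -/
def omegaDiv (z : ℝ) : ℂ := ((omega z / z : ℝ) : ℂ)

/-- `ω(1 / z) / z`. -/
def omegaInvDiv (z : ℝ) : ℂ := ((omega z⁻¹ / z : ℝ) : ℂ)

lemma isPosBump_omegaDiv : IsPosBump omegaDiv := by
  refine ⟨contDiff_of_pos (p := 1 / 2) (by norm_num) (fun x hx => ?_) fun x hx => ?_, 1 / 2, 1,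
    by norm_num, fun x hx => ?_⟩
  · rw [omegaDiv, omega_of_le hx.le]; simp
  · exact Complex.ofRealCLM.contDiff.contDiffAt.comp x
      (contDiff_omega.contDiffAt.div contDiffAt_id hx.ne')
  · have : omega x ≠ 0 := fun h => hx (by rw [omegaDiv, h]; simp)
    have := omega_ne_zero this
    exact ⟨this.1.le, this.2.le⟩

lemma isPosBump_omegaInvDiv : IsPosBump omegaInvDiv := by
  have hs : ∀ x, omegaInvDiv x ≠ 0 → 1 < x ∧ x < 2 := fun x hx => by
    have : omega x⁻¹ ≠ 0 := fun h => hx (by rw [omegaInvDiv, h]; simp)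
    have h1 := omega_ne_zero this
    have hx0 : 0 < x := inv_pos.1 (by linarith)
    refine ⟨(inv_lt_one₀ hx0).1 h1.2, ?_⟩
    have := (lt_inv_comm₀ (by norm_num) hx0).1 h1.1
    norm_num at this
    exact this
  refine ⟨contDiff_of_pos (p := 1) one_pos (fun x hx => ?_) fun x hx => ?_, 1, 2,
    by norm_num, fun x hx => ⟨(hs x hx).1.le, (hs x hx).2.le⟩⟩
  · by_contra h; linarith [(hs x h).1]
  · exact Complex.ofRealCLM.contDiff.contDiffAt.comp x
      ((contDiff_omega.contDiffAt.comp x (contDiffAt_inv ℝ hx.ne')).div contDiffAt_id hx.ne')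

/-- Invariance of dz/z under z ↦ 1/z. It makes the same constant ∫ ω(z)/z the main term of both sums
in h. -/
lemma integral_omegaInvDiv : ∫ z, omegaInvDiv z = ∫ z, omegaDiv z := by
  have h1 : ∀ f : ℝ → ℂ, (∀ x, x ≤ 0 → f x = 0) → ∫ z, f z = ∫ z in Ioi (0 : ℝ), f z :=
    fun f hf => (setIntegral_eq_integral_of_forall_compl_eq_zero fun x hx => hf x (by
      simpa using hx)).symm
  rw [h1 omegaDiv fun x hx => by rw [omegaDiv, omega_of_le (by linarith)]; simp,
    h1 omegaInvDiv fun x hx => by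
      rw [omegaInvDiv, omega_of_le (by linarith [inv_nonpos.2 hx])]; simp,
    integral_Ioi_comp_exp _ one_pos, integral_Ioi_comp_exp _ one_pos, ← integral_neg_eq_self]
  congr 1
  refine integral_congr_ae (Filter.Eventually.of_forall fun x => ?_)
  simp only [omegaDiv, omegaInvDiv, one_mul, ← Complex.ofReal_mul]
  have e1 : (Real.exp (-2 * -x))⁻¹ = Real.exp (-2 * x) := by rw [← Real.exp_neg]; ring_nf
  rw [e1]
  have := Real.exp_pos (-2 * x)
  have := Real.exp_pos (-2 * -x)
  congr 1
  field_simp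

/-- The profile `κ - ∑_{j ≥ 1} j⁻¹ ω(|y| / j)` with `κ = ∫ ω(z) / z`. -/
def profileFun (y : ℝ) : ℂ :=
  (∫ z, omegaDiv z) - ∑' j : ℕ, ((omega (|y| / (j + 1)) / (j + 1) : ℝ) : ℂ)

lemma profileFun_neg (y : ℝ) : profileFun (-y) = profileFun y := by simp [profileFun]

lemma profileFun_of_abs_le {y : ℝ} (hy : |y| ≤ 1 / 2) : profileFun y = ∫ z, omegaDiv z := by
  have : ∀ j : ℕ, ((omega (|y| / (j + 1)) / (j + 1) : ℝ) : ℂ) = 0 := fun j => by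
    rw [omega_of_le, zero_div, Complex.ofReal_zero]
    exact (div_le_self (abs_nonneg y) (by linarith [Nat.cast_nonneg (α := ℝ) j])).trans hy
  rw [profileFun, tsum_congr this, tsum_zero, sub_zero]

/-- The numbers j⁻¹ω(y/j) are, up to the factor y, samples at the points j/y of a bump. So for large
y the profile is a Riemann sum error with small step 1/y, which explains its rapid decay. -/
lemma profileFun_of_pos {y : ℝ} (hy : 0 < y) :
    profileFun y = -((y : ℂ)⁻¹ * riemannError omegaInvDiv y⁻¹) := by
  have hy' : (y : ℂ) ≠ 0 := Complex.ofReal_ne_zero.2 hy.ne'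
  have h1 : ∀ j : ℕ, omegaInvDiv ((j + 1) * y⁻¹) =
      y * ((omega (|y| / (j + 1)) / (j + 1) : ℝ) : ℂ) := fun j => by
    have e : ((j + 1 : ℝ) * y⁻¹)⁻¹ = |y| / (j + 1) := by
      rw [abs_of_pos hy]; field_simp
    rw [omegaInvDiv, e, ← Complex.ofReal_mul]
    congr 1
    field_simp
  rw [profileFun, riemannError, tsum_congr h1, tsum_mul_left, integral_omegaInvDiv,
    Complex.ofReal_inv]
  field_simp
  ring

lemma IsPosBump.summable {g : ℝ → ℂ} (hg : IsPosBump g) {x : ℝ} (hx : 0 < x) :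
    Summable fun j : ℕ => g ((j + 1) * x) := by
  obtain ⟨M, hM⟩ := hg.exists_finite_sum (half_pos hx)
  exact summable_of_ne_finset_zero (hM x (half_lt_self hx))

lemma IsPosBump.riemannError_add {g g' : ℝ → ℂ} (hg : IsPosBump g) (hg' : IsPosBump g') {x : ℝ}
    (hx : 0 < x) : riemannError (fun z => g z + g' z) x = riemannError g x + riemannError g' x := by
  simp only [riemannError]
  rw [(hg.summable hx).tsum_add (hg'.summable hx), integral_add hg.integrable hg'.integrable]
  ring

lemma riemannError_const_mul (c : ℂ) (g : ℝ → ℂ) (x : ℝ) :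
    riemannError (fun z => c * g z) x = c * riemannError g x := by
  simp only [riemannError]
  rw [tsum_mul_left, integral_const_mul]
  ring

/-- The functions `y ↦ y⁻ᵏ riemannError g (1 / y)`, a class closed under derivatives. -/
def tailFun (k : ℕ) (g : ℝ → ℂ) (y : ℝ) : ℂ := ((y : ℂ) ^ k)⁻¹ * riemannError g y⁻¹

lemma hasDerivAt_tailFun (k : ℕ) {g : ℝ → ℂ} (hg : IsPosBump g) {y : ℝ} (hy : 0 < y) :
    HasDerivAt (tailFun k g)
      (tailFun (k + 1) (fun z => (-k : ℂ) * g z + (-1) * ((z : ℂ) * deriv g z)) y) y := by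
  have hy' : (y : ℂ) ≠ 0 := Complex.ofReal_ne_zero.2 hy.ne'
  have h1 : HasDerivAt (fun y : ℝ => ((y : ℂ) ^ k)⁻¹)
      (-(k * (y : ℂ) ^ (k - 1)) / ((y : ℂ) ^ k) ^ 2) y := by
    have h3 : HasDerivAt (fun y : ℝ => (y : ℂ)) 1 y := Complex.ofRealCLM.hasDerivAt
    have := (h3.fun_pow k).fun_inv (pow_ne_zero k hy')
    simpa using this
  have h2 : HasDerivAt (fun y : ℝ => riemannError g y⁻¹)
      (-((y : ℂ)⁻¹ * riemannError (fun z => (z : ℂ) * deriv g z) y⁻¹)) y := by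
    have := HasDerivAt.scomp y (hg.hasDerivAt_riemannError (inv_pos.2 hy)) (hasDerivAt_inv hy.ne')
    refine HasDerivAt.congr_deriv this ?_
    rw [Complex.real_smul]
    push_cast
    field_simp
  refine HasDerivAt.congr_deriv (h1.mul h2) ?_
  rw [tailFun, (hg.const_mul _).riemannError_add (hg.euler.const_mul _) (inv_pos.2 hy),
    riemannError_const_mul, riemannError_const_mul]
  rcases k with _ | k
  · simp
  · simp only [Nat.add_sub_cancel]
    field_simp
    push_cast
    ring

lemma iteratedDeriv_tailFun (n : ℕ) : ∀ (k : ℕ) {g : ℝ → ℂ}, IsPosBump g → ∃ g', IsPosBump g' ∧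
    ∀ y, 0 < y → iteratedDeriv n (tailFun k g) y = tailFun (k + n) g' y := by
  induction n with
  | zero => exact fun k g hg => ⟨g, hg, fun y _ => by simp⟩
  | succ n ih =>
    intro k g hg
    obtain ⟨g', hg', h⟩ := ih (k + 1) ((hg.const_mul (-k : ℂ)).add (hg.euler.const_mul (-1)))
    refine ⟨g', hg', fun y hy => ?_⟩
    rw [iteratedDeriv_succ', show k + (n + 1) = k + 1 + n by ring, ← h y hy]
    refine Filter.EventuallyEq.iteratedDeriv_eq n ?_
    exact (eventually_gt_nhds hy).mono fun z hz => (hasDerivAt_tailFun k hg hz).deriv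

lemma tailFun_le (k : ℕ) {g : ℝ → ℂ} (hg : IsPosBump g) (N : ℕ) :
    ∃ C : ℝ, ∀ y, 1 ≤ y → y ^ N * ‖tailFun k g y‖ ≤ C := by
  obtain ⟨C, hC0, hC⟩ := hg.riemannError_le (N := N + 1) (by omega)
  refine ⟨C, fun y hy => ?_⟩
  have hy0 : 0 < y := by linarith
  have h1 := hC y⁻¹ (inv_pos.2 hy0)
  have h2 : (y ^ k)⁻¹ ≤ 1 := inv_le_one_of_one_le₀ (one_le_pow₀ hy)
  have h3 : ‖tailFun k g y‖ ≤ 1 * (C * y⁻¹ ^ (N + 1)) := by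
    rw [tailFun, norm_mul, norm_inv, norm_pow, Complex.norm_real, Real.norm_of_nonneg hy0.le]
    exact mul_le_mul h2 h1 (norm_nonneg _) zero_le_one
  calc y ^ N * ‖tailFun k g y‖ ≤ y ^ N * (1 * (C * y⁻¹ ^ (N + 1))) := by gcongr
    _ = C * y⁻¹ := by rw [inv_pow]; field_simp; ring
    _ ≤ C * 1 := by gcongr; exact inv_le_one_of_one_le₀ hy
    _ = C := mul_one C

/-- The dependence on |y| does no harm at the origin: the profile is constant for |y| ≤ 1/2. -/
lemma contDiff_profileFun : ContDiff ℝ ∞ profileFun := by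
  rw [contDiff_iff_contDiffAt]
  intro y
  by_cases hy : |y| < 1 / 2
  · refine (contDiffAt_const (c := ∫ z, omegaDiv z)).congr_of_eventuallyEq ?_
    have : ∀ᶠ z in nhds y, |z| < 1 / 2 := continuous_abs.continuousAt.eventually (gt_mem_nhds hy)
    exact this.mono fun z hz => profileFun_of_abs_le hz.le
  · have hy0 : y ≠ 0 := fun h => hy (by rw [h]; norm_num)
    have hy1 : 0 < |y| := abs_pos.2 hy0
    have h1 : profileFun =ᶠ[nhds y] fun y => -(((|y| : ℝ) : ℂ)⁻¹ * riemannError omegaInvDiv |y|⁻¹) :=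
      (eventually_ne_nhds hy0).mono fun z hz => by
        rw [← show profileFun |z| = profileFun z by simp [profileFun]]
        exact profileFun_of_pos (abs_pos.2 hz)
    refine ContDiffAt.congr_of_eventuallyEq ?_ h1
    have h2 : ContDiffAt ℝ ∞ (fun y : ℝ => |y|⁻¹) y := (contDiffAt_abs hy0).inv hy1.ne'
    have h3 := (isPosBump_omegaInvDiv.contDiffAt_riemannError (inv_pos.2 hy1))
    have h4 : ContDiffAt ℝ ∞ (fun y : ℝ => (((|y|⁻¹ : ℝ)) : ℂ)) y :=
      Complex.ofRealCLM.contDiff.contDiffAt.comp y h2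
    have h5 : ContDiffAt ℝ ∞ (fun y : ℝ => riemannError omegaInvDiv |y|⁻¹) y :=
      ContDiffAt.comp (g := riemannError omegaInvDiv) y h3 h2
    simpa using (h4.mul h5).neg

/-- The profile of the kernel of the delta method, as a Schwartz function. -/
def profile : 𝓢(ℝ, ℂ) where
  toFun := profileFun
  smooth' := contDiff_profileFun
  decay' k n := by
    obtain ⟨g', hg', h⟩ := iteratedDeriv_tailFun n 1 (isPosBump_omegaInvDiv.const_mul (-1))
    obtain ⟨C, hC⟩ := tailFun_le (1 + n) hg' k
    have hcont : Continuous fun y => ‖y‖ ^ k * ‖iteratedFDeriv ℝ n profileFun y‖ :=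
      (continuous_norm.pow k).mul (contDiff_profileFun.continuous_iteratedFDeriv
        (by exact_mod_cast le_top)).norm
    obtain ⟨M, hM⟩ := (isCompact_Icc (a := (-1 : ℝ)) (b := 1)).exists_bound_of_continuousOn
      hcont.continuousOn
    have hpos : ∀ y, 1 ≤ y → y ^ k * ‖iteratedDeriv n profileFun y‖ ≤ C := fun y hy => by
      have hy0 : 0 < y := by linarith
      have e : profileFun =ᶠ[nhds y] tailFun 1 fun z => (-1) * omegaInvDiv z :=
        (eventually_gt_nhds hy0).mono fun z hz => by
          rw [profileFun_of_pos hz, tailFun, riemannError_const_mul]; ring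
      rw [e.iteratedDeriv_eq, h y hy0]
      exact hC y hy
    refine ⟨max C M, fun y => ?_⟩
    rcases le_or_gt |y| 1 with hy | hy
    · exact ((le_abs_self _).trans (hM y (abs_le.1 hy))).trans (le_max_right _ _)
    · refine le_trans ?_ (le_max_left _ _)
      rw [norm_iteratedFDeriv_eq_norm_iteratedDeriv]
      rcases lt_abs.1 hy with h1 | h1
      · rw [Real.norm_of_nonneg (by linarith)]
        exact hpos y h1.le
      · have h2 := iteratedDeriv_comp_neg n profileFun y
        simp only [profileFun_neg] at h2
        have h3 : ‖iteratedDeriv n profileFun y‖ = ‖iteratedDeriv n profileFun (-y)‖ := by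
          conv_lhs => rw [h2]
          rw [norm_smul, norm_pow, norm_neg, norm_one, one_pow, one_mul]
        rw [h3, Real.norm_of_nonpos (by linarith)]
        exact hpos (-y) h1.le

lemma profile_apply (y : ℝ) : profile y = profileFun y := rfl

/-- The kernel of the delta method attached to a bump and a Schwartz profile. -/
def kernelFun (g : ℝ → ℂ) (Ψ : 𝓢(ℝ, ℂ)) (x y : ℝ) : ℂ :=
  riemannError g x + (x : ℂ)⁻¹ * Ψ (y / x)

/-- Add and subtract x⁻¹∫ ω(z)/z: the sum without y becomes a Riemann sum error in x, the sum with y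
becomes x⁻¹ times the profile at y/x. -/
theorem deltaH_eq {x : ℝ} (hx : 0 < x) (y : ℝ) :
    ((deltaH x y : ℝ) : ℂ) = kernelFun omegaDiv profile x y := by
  have hx' : (x : ℂ) ≠ 0 := Complex.ofReal_ne_zero.2 hx.ne'
  have e : ∀ k : ℕ, ((((x * (k + 1 : ℝ))⁻¹ *
      (omega (x * (k + 1 : ℝ)) - omega (|y| / (x * (k + 1 : ℝ)))) : ℝ)) : ℂ) =
      omegaDiv ((k + 1) * x) -
        (x : ℂ)⁻¹ * ((omega (|y / x| / (k + 1)) / (k + 1) : ℝ) : ℂ) := fun k => by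
    rw [omegaDiv, abs_div, abs_of_pos hx, div_div, mul_comm (k + 1 : ℝ) x, ← Complex.ofReal_inv,
      ← Complex.ofReal_mul, ← Complex.ofReal_sub]
    congr 1
    field_simp
  have hs : Summable fun j : ℕ => ((omega (|y / x| / (j + 1)) / (j + 1) : ℝ) : ℂ) := by
    refine summable_of_ne_finset_zero (s := Finset.range ⌈2 * |y / x|⌉₊) fun j hj => ?_
    rw [Finset.mem_range, not_lt] at hj
    have := Nat.ceil_le.1 hj
    rw [omega_of_le, zero_div, Complex.ofReal_zero]
    rw [div_le_iff₀ (by positivity)]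
    linarith
  rw [deltaH, Complex.ofReal_tsum, tsum_congr e,
    (isPosBump_omegaDiv.summable hx).tsum_sub (hs.mul_left _), tsum_mul_left, kernelFun,
    riemannError, profile_apply, profileFun]
  ring

/-- For such x and y, every ω is evaluated outside (1/2, 1): xj ≥ 1, and |y|/(xj) ≤ 1/2. -/
lemma deltaH_eq_zero {x y : ℝ} (hx : 1 ≤ x) (hy : |y| ≤ x / 2) : deltaH x y = 0 := by
  have : ∀ k : ℕ, (x * (k + 1 : ℝ))⁻¹ *
      (omega (x * (k + 1 : ℝ)) - omega (|y| / (x * (k + 1 : ℝ)))) = 0 := fun k => by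
    have hk : (0 : ℝ) ≤ k := Nat.cast_nonneg k
    have h1 : x ≤ x * (k + 1) := by nlinarith
    rw [omega_of_ge (hx.trans h1), omega_of_le, sub_zero, mul_zero]
    rw [div_le_iff₀ (by linarith)]
    linarith
  rw [deltaH, tsum_congr this, tsum_zero]

end CubicDelta

end

noncomputable section

open scoped ContDiff SchwartzMap

namespace CubicDelta

open MeasureTheory Set

/-! Oscillatory integrals with the kernel of the delta method, and their derivatives. -/

/-- Smooth weights with compact support away from the coordinate hyperplanes. -/
structure IsCubicWeight {m : ℕ} (w : (Fin m → ℝ) → ℂ) : Prop where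
  contDiff : ContDiff ℝ ∞ w
  hasCompactSupport : HasCompactSupport w
  ne_zero : ∀ u ∈ tsupport w, ∀ i, u i ≠ 0

/-- The real diagonal cubic form. -/
def realCubic {m : ℕ} (a : Fin m → ℤ) (u : Fin m → ℝ) : ℝ := ∑ i, (a i : ℝ) * u i ^ 3

@[fun_prop] lemma continuous_realCubic {m : ℕ} (a : Fin m → ℤ) : Continuous (realCubic a) := by
  unfold realCubic; fun_prop

lemma realCubic_smul {m : ℕ} (a : Fin m → ℤ) (x : ℝ) (u : Fin m → ℝ) :
    realCubic a (x • u) = x ^ 3 * realCubic a u := by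
  simp only [realCubic, Finset.mul_sum, Pi.smul_apply, smul_eq_mul]
  exact Finset.sum_congr rfl fun i _ => by ring

/-- The integral of `w(u) k(r, F(u)) e(-(v · u))`, where `k` is the kernel given by `g`, `Ψ`. -/
def deltaOsc {m : ℕ} (a : Fin m → ℤ) (w : (Fin m → ℝ) → ℂ) (g : ℝ → ℂ) (Ψ : 𝓢(ℝ, ℂ)) (r : ℝ)
    (v : Fin m → ℝ) : ℂ :=
  ∫ u, w u * (kernelFun g Ψ r (realCubic a u) * ee (-(v ⬝ᵥ u)))

lemma continuous_kernelFun (g : ℝ → ℂ) (Ψ : 𝓢(ℝ, ℂ)) (r : ℝ) : Continuous (kernelFun g Ψ r) := by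
  have := Ψ.continuous
  unfold kernelFun; fun_prop

/-- The part of the kernel that depends on r alone multiplies the Fourier transform of w, whose
decay beats the weight; the rest is `schwartzKernel_bound`. Since r is bounded, the first power of r
is all that is used of `IsPosBump.riemannError_le`. -/
theorem deltaOsc_bound {m : ℕ} (hm : 2 ≤ m) {a : Fin m → ℤ} (ha : ∀ i, a i ≠ 0)
    {Fd : MvPolynomial (Fin m) ℚ} (hFd : IsDualForm (diagonalCubic a) Fd)
    {w : (Fin m → ℝ) → ℂ} (hw : IsCubicWeight w) {g : ℝ → ℂ} (hg : IsPosBump g)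
    (Ψ : 𝓢(ℝ, ℂ)) (N : ℕ) (R : ℝ) :
    ∃ C : ℝ, 0 ≤ C ∧ ∀ (r : ℝ) (v : Fin m → ℝ), 0 < r → r ≤ R →
      ‖deltaOsc a w g Ψ r v‖ ≤ C * decayWeight m N (dualSize Fd) r v := by
  obtain ⟨C1, hC10, hC1⟩ := schwartzKernel_bound hm ha hFd hw.contDiff hw.hasCompactSupport
    hw.ne_zero Ψ N R
  obtain ⟨C2, hC20, hC2⟩ := hg.riemannError_le le_rfl
  obtain ⟨f, hf, -⟩ := exists_fourier_representation hw.contDiff hw.hasCompactSupport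
  obtain ⟨L, hL0, hLv, -⟩ := exists_dualSize_lipschitz Fd
  obtain ⟨C3, hC30, hC3⟩ : ∃ C : ℝ, 0 ≤ C ∧ ∀ x, ‖f x‖ ≤ C * ((1 + ‖x‖) ^ (2 * N + m))⁻¹ := by
    refine ⟨2 ^ (2 * N + m) * (Finset.Iic (2 * N + m, 0)).sup
      (fun m => SchwartzMap.seminorm ℝ m.1 m.2) f, by positivity, fun x => ?_⟩
    have := SchwartzMap.one_add_le_sup_seminorm_apply (𝕜 := ℝ) (m := (2 * N + m, 0))
      (k := 2 * N + m) (n := 0) le_rfl le_rfl f x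
    rw [← div_eq_mul_inv, le_div_iff₀ (by positivity)]
    simpa [mul_comm] using this
  refine ⟨C2 * |R| * C3 * (|1 + R| ^ N * (1 + L) ^ N) + C1, by positivity, fun r v hr hrR => ?_⟩
  have hR : 0 ≤ R := hr.le.trans hrR
  have hsplit : deltaOsc a w g Ψ r v = riemannError g r * f v +
      ∫ u : Fin m → ℝ, w u *
        (((r : ℂ)⁻¹ * Ψ ((∑ i, (a i : ℝ) * u i ^ 3) / r)) * ee (-(v ⬝ᵥ u))) := by
    rw [hf, ← integral_const_mul, ← integral_add]
    · refine integral_congr_ae (Filter.Eventually.of_forall fun u => ?_)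
      simp only [kernelFun, realCubic]; ring
    · have := hw.contDiff.continuous
      refine Continuous.integrable_of_hasCompactSupport (by simp only [dotProduct]; fun_prop) ?_
      exact (hw.hasCompactSupport.mul_right).mul_left
    · have := hw.contDiff.continuous
      have h3 := Ψ.continuous
      exact Continuous.integrable_of_hasCompactSupport (by simp only [dotProduct]; fun_prop)
        hw.hasCompactSupport.mul_right
  rw [hsplit, add_mul]
  refine (norm_add_le _ _).trans (add_le_add ?_ (hC1 r v hr hrR))
  have h1 := hC2 r hr
  rw [pow_one] at h1
  have h2 := decayWeight_ge (N := N) hL0 (dualSize_nonneg Fd) hLv hr.le hrR v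
  rw [norm_mul, abs_of_nonneg hR, abs_of_nonneg (by linarith : 0 ≤ 1 + R)]
  calc _ ≤ (C2 * R) * (C3 * ((1 + R) ^ N * (1 + L) ^ N * decayWeight m N (dualSize Fd) r v)) := by
        refine mul_le_mul (h1.trans (by gcongr)) ((hC3 v).trans (by gcongr)) (norm_nonneg _)
          (by positivity)
    _ = _ := by ring

/-- In the normalized variables `r = n / Y`, `v = (X / n) c` the delta integral is free of `X`. -/
lemma deltaJ_eq_integral {m : ℕ} (a : Fin m → ℤ) (w : (Fin m → ℝ) → ℝ) {X : ℝ} (hX : 0 < X)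
    (n : ℝ) (c : Fin m → ℝ) :
    deltaJ (diagonalCubic a) w X c n =
      ∫ u, ((w u : ℝ) : ℂ) * (((deltaH (n / cutoffY X) (realCubic a u) : ℝ) : ℂ) *
        ee (-(((X / n) • c) ⬝ᵥ u))) := by
  have hY : cutoffY X ^ 2 = X ^ 3 := by
    rw [cutoffY, ← Real.rpow_natCast, ← Real.rpow_mul hX.le, ← Real.rpow_natCast]
    norm_num
  have h := Measure.integral_comp_smul (volume : Measure (Fin m → ℝ)) (fun x : Fin m → ℝ =>
    ((w (X⁻¹ • x) * deltaH (n / cutoffY X)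
      (MvPolynomial.aeval x (diagonalCubic a) / cutoffY X ^ 2) : ℝ) : ℂ) *
      Complex.exp (((-(2 * Real.pi * ((c ⬝ᵥ x) / n)) : ℝ) : ℂ) * Complex.I)) X
  have hI : deltaI (diagonalCubic a) w X (cutoffY X) c n = ((X ^ m : ℝ) : ℂ) *
      ∫ u, ((w u : ℝ) : ℂ) * (((deltaH (n / cutoffY X) (realCubic a u) : ℝ) : ℂ) *
        ee (-(((X / n) • c) ⬝ᵥ u))) := by
    rw [Module.finrank_fin_fun, abs_of_pos (by positivity), Complex.real_smul] at h
    rw [deltaI]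
    have h2 : ((X ^ m : ℝ) : ℂ) * (((X ^ m)⁻¹ : ℝ) : ℂ) = 1 := by
      rw [← Complex.ofReal_mul, mul_inv_cancel₀ (by positivity), Complex.ofReal_one]
    rw [← one_mul (integral _ _), ← h2, mul_assoc, ← h]
    congr 1
    refine integral_congr_ae (Filter.Eventually.of_forall fun u => ?_)
    simp only
    rw [inv_smul_smul₀ hX.ne', aeval_diagonalCubic, hY,
      show ∑ i, (a i : ℝ) * (X • u) i ^ 3 = realCubic a (X • u) from rfl, realCubic_smul,
      mul_div_cancel_left₀ _ (by positivity), Complex.ofReal_mul, mul_assoc, ee]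
    congr 5
    rw [dotProduct_smul, smul_dotProduct, smul_eq_mul, smul_eq_mul]
    ring
  rw [deltaJ, hI, hY]
  have hX' : (X : ℂ) ≠ 0 := Complex.ofReal_ne_zero.2 hX.ne'
  rw [zpow_sub₀ hX.ne', zpow_natCast]
  push_cast
  rw [show ((X : ℂ)) ^ (3 : ℤ) = (X : ℂ) ^ 3 by norm_cast]
  field_simp

lemma deltaJ_eq_deltaOsc {m : ℕ} (a : Fin m → ℤ) (w : (Fin m → ℝ) → ℝ) {X n : ℝ} (hX : 0 < X)
    (hn : 0 < n) (c : Fin m → ℝ) :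
    deltaJ (diagonalCubic a) w X c n =
      deltaOsc a (fun u => (w u : ℂ)) omegaDiv profile (n / cutoffY X) ((X / n) • c) := by
  have hY : 0 < cutoffY X := Real.rpow_pos_of_pos hX _
  rw [deltaJ_eq_integral a w hX n, deltaOsc]
  simp only [deltaH_eq (div_pos hn hY)]

lemma exists_deltaJ_eq_zero {m : ℕ} (a : Fin m → ℤ) {w : (Fin m → ℝ) → ℝ}
    (hwc : HasCompactSupport w) :
    ∃ C : ℝ, 0 < C ∧ ∀ (X : ℝ) (c : Fin m → ℝ) (n : ℝ), 0 < X → 0 < n → C * cutoffY X < n →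
      deltaJ (diagonalCubic a) w X c n = 0 := by
  obtain ⟨M, hM⟩ := hwc.isCompact.exists_bound_of_continuousOn
    (continuous_realCubic a).continuousOn
  -- Here M bounds |F| on the support of w, so this constant secures both r ≥ 1 and |F(u)| ≤ r/2.
  refine ⟨1 + 2 * |M|, by positivity, fun X c n hX hn hlt => ?_⟩
  have hY : 0 < cutoffY X := Real.rpow_pos_of_pos hX _
  rw [deltaJ_eq_integral a w hX n]
  have hr : 1 + 2 * |M| ≤ n / cutoffY X := by rw [le_div_iff₀ hY]; exact hlt.le
  refine integral_eq_zero_of_ae (Filter.Eventually.of_forall fun u => ?_)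
  by_cases hu : u ∈ tsupport w
  · have h1 := hM u hu
    rw [Real.norm_eq_abs] at h1
    simp only [Pi.zero_apply]
    rw [deltaH_eq_zero (by linarith [abs_nonneg M]) (by linarith [le_abs_self M]),
      Complex.ofReal_zero, zero_mul, mul_zero]
  · simp [image_eq_zero_of_notMem_tsupport hu]

/-- Dilations: the substitution `u = x z` in `deltaOsc`. -/
lemma deltaOsc_dilate {m : ℕ} (a : Fin m → ℤ) (w : (Fin m → ℝ) → ℂ) (g : ℝ → ℂ) (Ψ : 𝓢(ℝ, ℂ))
    {x : ℝ} (hx : 0 < x) (r : ℝ) (v : Fin m → ℝ) :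
    deltaOsc a w g Ψ (x * r) (x⁻¹ • v) = ∫ z, (x : ℂ) ^ m *
      (w (x • z) * (kernelFun g Ψ (x * r) (x ^ 3 * realCubic a z) * ee (-(v ⬝ᵥ z)))) := by
  have h := Measure.integral_comp_smul (volume : Measure (Fin m → ℝ)) (fun u : Fin m → ℝ =>
    w u * (kernelFun g Ψ (x * r) (realCubic a u) * ee (-((x⁻¹ • v) ⬝ᵥ u)))) x
  rw [Module.finrank_fin_fun, abs_of_pos (by positivity), Complex.real_smul] at h
  have hx' : (x : ℂ) ≠ 0 := Complex.ofReal_ne_zero.2 hx.ne'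
  rw [integral_const_mul, deltaOsc]
  have e : ∫ z, w (x • z) * (kernelFun g Ψ (x * r) (x ^ 3 * realCubic a z) * ee (-(v ⬝ᵥ z))) =
      (((x ^ m)⁻¹ : ℝ) : ℂ) *
        ∫ u, w u * (kernelFun g Ψ (x * r) (realCubic a u) * ee (-((x⁻¹ • v) ⬝ᵥ u))) := by
    rw [← h]
    refine integral_congr_ae (Filter.Eventually.of_forall fun z => ?_)
    simp only
    rw [realCubic_smul, smul_dotProduct, dotProduct_smul, smul_smul, inv_mul_cancel₀ hx.ne',
      one_smul]
  rw [e]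
  push_cast
  field_simp

/-- The operator `2 s ∂_s - 1` on Schwartz functions. -/
def profileOp (Ψ : 𝓢(ℝ, ℂ)) : 𝓢(ℝ, ℂ) := (2 : ℂ) • eulerDeriv Ψ - Ψ

lemma profileOp_apply (Ψ : 𝓢(ℝ, ℂ)) (s : ℝ) : profileOp Ψ s = 2 * (s * deriv Ψ s) - Ψ s := by
  simp only [profileOp, sub_apply, smul_apply, eulerDeriv_apply, smul_eq_mul]

/-- Along (xr, x³y) the argument of Ψ is x²y/r, and the prefactor is (xr)⁻¹. So x∂_x replaces Ψ by
2sΨ' - Ψ and g by zg', with no loss. -/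
lemma hasDerivAt_kernelFun {g : ℝ → ℂ} (hg : IsPosBump g) (Ψ : 𝓢(ℝ, ℂ)) {x r : ℝ} (hx : 0 < x)
    (hr : 0 < r) (y : ℝ) :
    HasDerivAt (fun x => kernelFun g Ψ (x * r) (x ^ 3 * y)) ((x : ℂ)⁻¹ *
      kernelFun (fun z => (z : ℂ) * deriv g z) (profileOp Ψ) (x * r) (x ^ 3 * y)) x := by
  have hx' : (x : ℂ) ≠ 0 := Complex.ofReal_ne_zero.2 hx.ne'
  have hr' : (r : ℂ) ≠ 0 := Complex.ofReal_ne_zero.2 hr.ne'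
  have h1 := HasDerivAt.scomp (h := fun x => x * r) x (hg.hasDerivAt_riemannError (mul_pos hx hr))
    ((hasDerivAt_id x).mul_const r)
  have h2 : HasDerivAt (fun x : ℝ => ((x * r : ℝ) : ℂ)⁻¹) (-((x : ℂ) ^ 2 * r)⁻¹) x := by
    have h3 : HasDerivAt (fun x : ℝ => ((x * r : ℝ) : ℂ)) r x := by
      simpa using ((hasDerivAt_id x).mul_const r).ofReal_comp
    have h4 := h3.fun_inv (Complex.ofReal_ne_zero.2 (mul_pos hx hr).ne')
    refine HasDerivAt.congr_deriv h4 ?_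
    push_cast
    field_simp
  have h5 : HasDerivAt (fun x : ℝ => x ^ 3 * y / (x * r)) (2 * x * y / r) x := by
    have h6 : HasDerivAt (fun x : ℝ => x ^ 2 * (y / r)) (2 * x * (y / r)) x := by
      simpa using (hasDerivAt_pow 2 x).mul_const (y / r)
    refine HasDerivAt.congr_of_eventuallyEq (HasDerivAt.congr_deriv h6 (by ring)) ?_
    filter_upwards [eventually_gt_nhds hx] with z hz
    field_simp
  have h7 := HasDerivAt.scomp x (SchwartzMap.hasDerivAt_apply Ψ (x ^ 3 * y / (x * r))) h5
  refine HasDerivAt.congr_deriv (h1.add (h2.mul h7)) ?_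
  simp only [kernelFun, profileOp_apply, Complex.real_smul, one_mul]
  push_cast
  field_simp
  ring

end CubicDelta

end

/-! ### Derivatives along dilations and in the coordinates of v -/

noncomputable section

open scoped ContDiff SchwartzMap

namespace CubicDelta

open MeasureTheory Set

/-- The weight produced by the dilation derivative: `m w + u · ∇ w`. -/
def eulerWeight {m : ℕ} (w : (Fin m → ℝ) → ℂ) (u : Fin m → ℝ) : ℂ := m * w u + fderiv ℝ w u u

lemma IsCubicWeight.differentiable {m : ℕ} {w : (Fin m → ℝ) → ℂ} (hw : IsCubicWeight w) :
    Differentiable ℝ w := hw.contDiff.differentiable (by norm_num)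

lemma IsCubicWeight.of_eq_zero {m : ℕ} {w w' : (Fin m → ℝ) → ℂ} (hw : IsCubicWeight w)
    (hc : ContDiff ℝ ∞ w') (h : ∀ u, u ∉ tsupport w → w' u = 0) : IsCubicWeight w' := by
  have hs : tsupport w' ⊆ tsupport w := closure_minimal (fun u hu => by
    by_contra h0; exact hu (h u h0)) (isClosed_tsupport w)
  exact ⟨hc, hw.hasCompactSupport.of_isClosed_subset (isClosed_tsupport _) hs,
    fun u hu => hw.ne_zero u (hs hu)⟩

lemma IsCubicWeight.euler {m : ℕ} {w : (Fin m → ℝ) → ℂ} (hw : IsCubicWeight w) :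
    IsCubicWeight (eulerWeight w) := by
  refine hw.of_eq_zero ((contDiff_const.mul hw.contDiff).add
    ((hw.contDiff.fderiv_right (by exact_mod_cast le_rfl)).clm_apply contDiff_id)) fun u hu => ?_
  have h2 : fderiv ℝ w u = 0 :=
    image_eq_zero_of_notMem_tsupport fun h => hu (tsupport_fderiv_subset ℝ h)
  rw [eulerWeight, image_eq_zero_of_notMem_tsupport hu, h2]
  simp

lemma IsCubicWeight.mul_coord {m : ℕ} {w : (Fin m → ℝ) → ℂ} (hw : IsCubicWeight w) (i : Fin m) :
    IsCubicWeight fun u => -(2 * Real.pi * Complex.I) * u i * w u := by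
  refine hw.of_eq_zero ((contDiff_const.mul (Complex.ofRealCLM.contDiff.comp
    (contDiff_apply ℝ ℝ i))).mul hw.contDiff) fun u hu => ?_
  rw [image_eq_zero_of_notMem_tsupport hu, mul_zero]

lemma IsCubicWeight.hasDerivAt_smul {m : ℕ} {w : (Fin m → ℝ) → ℂ} (hw : IsCubicWeight w) {x : ℝ}
    (hx : x ≠ 0) (z : Fin m → ℝ) :
    HasDerivAt (fun x : ℝ => (x : ℂ) ^ m * w (x • z))
      ((x : ℂ)⁻¹ * ((x : ℂ) ^ m * eulerWeight w (x • z))) x := by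
  have hx' : (x : ℂ) ≠ 0 := Complex.ofReal_ne_zero.2 hx
  have h0 : HasDerivAt (fun y : ℝ => (y : ℂ)) 1 x := Complex.ofRealCLM.hasDerivAt
  have h1 := h0.fun_pow m
  have h2 : HasDerivAt (fun x : ℝ => x • z) z x := by
    simpa using (hasDerivAt_id x).smul_const z
  have h3 := HasFDerivAt.comp_hasDerivAt x (hw.differentiable (x • z)).hasFDerivAt h2
  refine HasDerivAt.congr_deriv (h1.mul h3) ?_
  have e : fderiv ℝ w (x • z) (x • z) = x * fderiv ℝ w (x • z) z := by
    rw [map_smul, Complex.real_smul]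
  simp only [eulerWeight, e]
  rcases m with _ | m
  · simp; field_simp
  · simp only [Nat.add_sub_cancel]
    field_simp
    push_cast
    ring

/-- The derivative of `deltaOsc` along dilations. -/
theorem hasDerivAt_deltaOsc_dilate {m : ℕ} (a : Fin m → ℤ) {w : (Fin m → ℝ) → ℂ}
    (hw : IsCubicWeight w) {g : ℝ → ℂ} (hg : IsPosBump g) (Ψ : 𝓢(ℝ, ℂ)) {x r : ℝ} (hx : 0 < x)
    (hr : 0 < r) (v : Fin m → ℝ) :
    HasDerivAt (fun x => deltaOsc a w g Ψ (x * r) (x⁻¹ • v))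
      ((x : ℂ)⁻¹ * (deltaOsc a (eulerWeight w) g Ψ (x * r) (x⁻¹ • v) +
        deltaOsc a w (fun z => (z : ℂ) * deriv g z) (profileOp Ψ) (x * r) (x⁻¹ • v))) x := by
  obtain ⟨D, hD⟩ := hw.hasCompactSupport.isCompact.isBounded.exists_norm_le
  have hcw := hw.contDiff.continuous
  have hcw' := hw.euler.contDiff.continuous
  have hcΨ := Ψ.continuous
  have hcΨ' := (profileOp Ψ).continuous
  have hcr : ∀ {g : ℝ → ℂ}, IsPosBump g →
      ContinuousOn (fun p : ℝ × (Fin m → ℝ) => riemannError g (p.1 * r)) (Ioo (x / 2) (2 * x) ×ˢ univ) := by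
    intro g hg p hp
    have hp1 : 0 < p.1 := (half_pos hx).trans hp.1.1
    exact (ContinuousAt.comp (f := fun p : ℝ × (Fin m → ℝ) => p.1 * r)
      (hg.contDiffAt_riemannError (mul_pos hp1 hr)).continuousAt (by fun_prop)).continuousWithinAt
  have hne : ∀ p ∈ Ioo (x / 2) (2 * x) ×ˢ (univ : Set (Fin m → ℝ)), p.1 ≠ 0 := fun p hp =>
    ((half_pos hx).trans hp.1.1).ne'
  have hinv : ContinuousOn (fun p : ℝ × (Fin m → ℝ) => (p.1 : ℂ)⁻¹)
      (Ioo (x / 2) (2 * x) ×ˢ univ) :=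
    ContinuousOn.inv₀ (Continuous.continuousOn (by fun_prop)) fun p hp =>
      Complex.ofReal_ne_zero.2 (hne p hp)
  have hker : ∀ {g : ℝ → ℂ} (Ψ : 𝓢(ℝ, ℂ)), IsPosBump g →
      ContinuousOn (fun p : ℝ × (Fin m → ℝ) =>
        kernelFun g Ψ (p.1 * r) (p.1 ^ 3 * realCubic a p.2)) (Ioo (x / 2) (2 * x) ×ˢ univ) := by
    intro g Ψ hg
    unfold kernelFun
    refine (hcr hg).add (ContinuousOn.mul ?_ ?_)
    · refine ContinuousOn.inv₀ (Continuous.continuousOn (by fun_prop)) fun p hp =>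
        Complex.ofReal_ne_zero.2 (mul_ne_zero (hne p hp) hr.ne')
    · refine Ψ.continuous.comp_continuousOn (ContinuousOn.div₀
        (Continuous.continuousOn (by fun_prop)) (Continuous.continuousOn (by fun_prop)) fun p hp =>
        mul_ne_zero (hne p hp) hr.ne')
  have main := hasDerivAt_integral_of_compact (μ := (volume : Measure (Fin m → ℝ)))
    (H := fun x z => (x : ℂ) ^ m * w (x • z) *
      (kernelFun g Ψ (x * r) (x ^ 3 * realCubic a z) * ee (-(v ⬝ᵥ z))))
    (H' := fun x z => (x : ℂ)⁻¹ * ((x : ℂ) ^ m * eulerWeight w (x • z)) *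
        (kernelFun g Ψ (x * r) (x ^ 3 * realCubic a z) * ee (-(v ⬝ᵥ z))) +
      (x : ℂ) ^ m * w (x • z) * ((x : ℂ)⁻¹ * kernelFun (fun z => (z : ℂ) * deriv g z)
        (profileOp Ψ) (x * r) (x ^ 3 * realCubic a z) * ee (-(v ⬝ᵥ z))))
    (isOpen_Ioo (a := x / 2) (b := 2 * x)) (x₀ := x) ⟨by linarith, by linarith⟩
    -- For dilation factors above x/2, the supports of z ↦ w(yz) lie in this one ball.
    (isCompact_closedBall (0 : Fin m → ℝ) (D / (x / 2))) ?_ ?_ ?_ ?_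
  · refine HasDerivAt.congr_of_eventuallyEq (HasDerivAt.congr_deriv main ?_) ?_
    · rw [deltaOsc_dilate a _ g Ψ hx, deltaOsc_dilate a _ _ _ hx, ← integral_add,
        ← integral_const_mul]
      · refine integral_congr_ae (Filter.Eventually.of_forall fun z => ?_)
        simp only; ring
      · have h1 := continuous_kernelFun g Ψ (x * r)
        refine Continuous.integrable_of_hasCompactSupport
          (by simp only [dotProduct]; fun_prop) ?_
        exact ((hw.euler.hasCompactSupport.comp_smul hx.ne').mul_right).mul_left
      · have h1 := continuous_kernelFun (fun z => (z : ℂ) * deriv g z) (profileOp Ψ) (x * r)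
        refine Continuous.integrable_of_hasCompactSupport
          (by simp only [dotProduct]; fun_prop) ?_
        exact ((hw.hasCompactSupport.comp_smul hx.ne').mul_right).mul_left
    · filter_upwards [eventually_gt_nhds hx] with y hy
      rw [deltaOsc_dilate a w g Ψ hy]
      simp only [mul_assoc]
  · intro y hy z hz
    have : y • z ∉ tsupport w := fun h => hz (by
      have h1 := hD _ h
      have hy0 : 0 < y := (half_pos hx).trans hy.1
      rw [norm_smul, Real.norm_of_nonneg hy0.le] at h1
      rw [mem_closedBall_zero_iff, le_div_iff₀ (half_pos hx)]
      nlinarith [hy.1, norm_nonneg z])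
    rw [image_eq_zero_of_notMem_tsupport this]
    ring
  · intro y hy z
    have hy0 : 0 < y := (half_pos hx).trans hy.1
    refine HasDerivAt.mul (hw.hasDerivAt_smul hy0.ne' z) ?_
    exact (hasDerivAt_kernelFun hg Ψ hy0 hr _).mul_const _
  · have c1 : ContinuousOn (fun p : ℝ × (Fin m → ℝ) => ee (-(v ⬝ᵥ p.2)))
        (Ioo (x / 2) (2 * x) ×ˢ univ) :=
      Continuous.continuousOn (by simp only [dotProduct]; fun_prop)
    have c2 : ContinuousOn (fun p : ℝ × (Fin m → ℝ) => (p.1 : ℂ) ^ m)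
        (Ioo (x / 2) (2 * x) ×ˢ univ) := Continuous.continuousOn (by fun_prop)
    have c3 : ContinuousOn (fun p : ℝ × (Fin m → ℝ) => w (p.1 • p.2))
        (Ioo (x / 2) (2 * x) ×ˢ univ) := Continuous.continuousOn (by fun_prop)
    have c4 : ContinuousOn (fun p : ℝ × (Fin m → ℝ) => eulerWeight w (p.1 • p.2))
        (Ioo (x / 2) (2 * x) ×ˢ univ) := Continuous.continuousOn (by fun_prop)
    exact ((hinv.mul (c2.mul c4)).mul ((hker Ψ hg).mul c1)).add
      ((c2.mul c3).mul ((hinv.mul (hker (profileOp Ψ) hg.euler)).mul c1))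
  · intro y hy
    have h1 := continuous_kernelFun g Ψ (y * r)
    simp only [dotProduct]
    fun_prop

/-- The derivative of `deltaOsc` in a coordinate of `v`. -/
theorem hasDerivAt_deltaOsc_coord {m : ℕ} (a : Fin m → ℤ) {w : (Fin m → ℝ) → ℂ}
    (hw : IsCubicWeight w) (g : ℝ → ℂ) (Ψ : 𝓢(ℝ, ℂ)) (r : ℝ) (v : Fin m → ℝ) (i : Fin m) :
    HasDerivAt (fun t => deltaOsc a w g Ψ r (Function.update v i t))
      (deltaOsc a (fun u => -(2 * Real.pi * Complex.I) * u i * w u) g Ψ r v) (v i) := by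
  have hcw := hw.contDiff.continuous
  have h1 := continuous_kernelFun g Ψ r
  have hdot : ∀ (t : ℝ) (u : Fin m → ℝ),
      -(Function.update v i t ⬝ᵥ u) = -(v ⬝ᵥ u) - (t - v i) * u i := fun t u => by
    have : Function.update v i t = v + Pi.single i (t - v i) := by
      ext j
      by_cases hj : j = i
      · subst hj; simp
      · simp [hj]
    rw [this, add_dotProduct, single_dotProduct]; ring
  have main := hasDerivAt_integral_of_compact (μ := (volume : Measure (Fin m → ℝ)))
    (H := fun t u => w u * (kernelFun g Ψ r (realCubic a u) *
      ee (-(v ⬝ᵥ u) - (t - v i) * u i)))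
    (H' := fun t u => w u * (kernelFun g Ψ r (realCubic a u) *
      (2 * Real.pi * Complex.I * ((-(u i) : ℝ) : ℂ) * ee (-(v ⬝ᵥ u) - (t - v i) * u i))))
    isOpen_univ (x₀ := v i) (mem_univ _) hw.hasCompactSupport.isCompact ?_ ?_ ?_ ?_
  · have e : (fun t => deltaOsc a w g Ψ r (Function.update v i t)) = fun t =>
        ∫ u, w u * (kernelFun g Ψ r (realCubic a u) * ee (-(v ⬝ᵥ u) - (t - v i) * u i)) := by
      funext t; simp only [deltaOsc, hdot]
    rw [e]
    refine HasDerivAt.congr_deriv main ?_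
    rw [deltaOsc]
    refine integral_congr_ae (Filter.Eventually.of_forall fun u => ?_)
    simp only [sub_self, zero_mul, sub_zero]
    push_cast
    ring
  · intro t _ u hu
    rw [image_eq_zero_of_notMem_tsupport hu, zero_mul]
  · intro t _ u
    refine ((hasDerivAt_ee ?_).const_mul _).const_mul _
    have := (((hasDerivAt_id t).sub_const (v i)).mul_const (u i)).const_sub (-(v ⬝ᵥ u))
    simpa using this
  · refine Continuous.continuousOn ?_
    simp only [dotProduct]
    fun_prop
  · intro t _
    simp only [dotProduct]
    fun_prop

end CubicDelta

end

noncomputable section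

open scoped ContDiff SchwartzMap

namespace CubicDelta

open MeasureTheory Set

/-! Logarithmic derivatives. -/

/-- The span of the functions `v ^ γ' * deltaOsc a w g Ψ r v` with `γ' ≤ γ`. -/
def oscClass {m : ℕ} (a : Fin m → ℤ) (γ : Fin m → ℕ) : Submodule ℂ (ℝ → (Fin m → ℝ) → ℂ) :=
  Submodule.span ℂ {Φ | ∃ γ' : Fin m → ℕ, γ' ≤ γ ∧ ∃ (w : (Fin m → ℝ) → ℂ) (g : ℝ → ℂ)
    (Ψ : 𝓢(ℝ, ℂ)), IsCubicWeight w ∧ IsPosBump g ∧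
    Φ = fun r v => (∏ i, (v i : ℂ) ^ γ' i) * deltaOsc a w g Ψ r v}

lemma mem_oscClass {m : ℕ} (a : Fin m → ℤ) {γ γ' : Fin m → ℕ} (h : γ' ≤ γ)
    {w : (Fin m → ℝ) → ℂ} {g : ℝ → ℂ} (Ψ : 𝓢(ℝ, ℂ)) (hw : IsCubicWeight w) (hg : IsPosBump g) :
    (fun r v => (∏ i, (v i : ℂ) ^ γ' i) * deltaOsc a w g Ψ r v) ∈ oscClass a γ :=
  Submodule.subset_span ⟨γ', h, w, g, Ψ, hw, hg, rfl⟩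

lemma hasDerivAt_prod_smul_pow {m : ℕ} (γ : Fin m → ℕ) (v : Fin m → ℝ) {x : ℝ} (hx : 0 < x) :
    HasDerivAt (fun x : ℝ => ∏ i, (((x⁻¹ • v) i : ℝ) : ℂ) ^ γ i)
      ((x : ℂ)⁻¹ * (-(∑ i, γ i : ℕ) * ∏ i, (((x⁻¹ • v) i : ℝ) : ℂ) ^ γ i)) x := by
  have hx' : (x : ℂ) ≠ 0 := Complex.ofReal_ne_zero.2 hx.ne'
  have e : ∀ x : ℝ, ∏ i, (((x⁻¹ • v) i : ℝ) : ℂ) ^ γ i =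
      ((x : ℂ)⁻¹) ^ (∑ i, γ i) * ∏ i, (v i : ℂ) ^ γ i := fun x => by
    rw [← Finset.prod_pow_eq_pow_sum, ← Finset.prod_mul_distrib]
    refine Finset.prod_congr rfl fun i _ => ?_
    rw [← mul_pow, Pi.smul_apply, smul_eq_mul, Complex.ofReal_mul, Complex.ofReal_inv]
  simp only [e]
  have h0 : HasDerivAt (fun y : ℝ => (y : ℂ)) 1 x := Complex.ofRealCLM.hasDerivAt
  refine HasDerivAt.congr_deriv (((h0.fun_inv hx').fun_pow (∑ i, γ i)).mul_const _) ?_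
  rcases ∑ i, γ i with _ | S
  · simp
  · simp only [Nat.add_sub_cancel, pow_succ]
    field_simp

/-- By the product rule the derivative falls on the monomial, the weight or the kernel, and each
outcome stays in the class. The exponent bound γ does not grow, so n∂_n costs nothing. -/
lemma oscClass_dilate {m : ℕ} {a : Fin m → ℤ} {γ : Fin m → ℕ} {Φ : ℝ → (Fin m → ℝ) → ℂ}
    (hΦ : Φ ∈ oscClass a γ) :
    ∃ Φ' ∈ oscClass a γ, ∀ (x r : ℝ) (v : Fin m → ℝ), 0 < x → 0 < r →
      HasDerivAt (fun x => Φ (x * r) (x⁻¹ • v)) ((x : ℂ)⁻¹ * Φ' (x * r) (x⁻¹ • v)) x := by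
  induction hΦ using Submodule.span_induction with
  | mem Φ h =>
    obtain ⟨γ', hγ', w, g, Ψ, hw, hg, rfl⟩ := h
    refine ⟨(-(∑ i, γ' i : ℕ) : ℂ) • (fun r v => (∏ i, (v i : ℂ) ^ γ' i) * deltaOsc a w g Ψ r v) +
      ((fun r v => (∏ i, (v i : ℂ) ^ γ' i) * deltaOsc a (eulerWeight w) g Ψ r v) +
      fun r v => (∏ i, (v i : ℂ) ^ γ' i) *
        deltaOsc a w (fun z => (z : ℂ) * deriv g z) (profileOp Ψ) r v),
      add_mem (Submodule.smul_mem _ _ (mem_oscClass a hγ' Ψ hw hg))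
        (add_mem (mem_oscClass a hγ' Ψ hw.euler hg) (mem_oscClass a hγ' _ hw hg.euler)),
      fun x r v hx hr => ?_⟩
    refine HasDerivAt.congr_deriv ((hasDerivAt_prod_smul_pow γ' v hx).mul
      (hasDerivAt_deltaOsc_dilate a hw hg Ψ hx hr v)) ?_
    simp only [Pi.add_apply, Pi.smul_apply, smul_eq_mul]
    ring
  | zero => exact ⟨0, zero_mem _, fun x r v _ _ => by simpa using hasDerivAt_const x (0 : ℂ)⟩
  | add Φ₁ Φ₂ _ _ h₁ h₂ =>
    obtain ⟨Φ₁', m₁, h₁⟩ := h₁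
    obtain ⟨Φ₂', m₂, h₂⟩ := h₂
    refine ⟨Φ₁' + Φ₂', add_mem m₁ m₂, fun x r v hx hr => ?_⟩
    exact HasDerivAt.congr_deriv ((h₁ x r v hx hr).add (h₂ x r v hx hr))
      (by simp only [Pi.add_apply]; ring)
  | smul c Φ _ h =>
    obtain ⟨Φ', m', h'⟩ := h
    refine ⟨c • Φ', Submodule.smul_mem _ _ m', fun x r v hx hr => ?_⟩
    exact HasDerivAt.congr_deriv ((h' x r v hx hr).const_mul c)
      (by simp only [Pi.smul_apply, smul_eq_mul]; ring)

lemma hasDerivAt_prod_update_pow {m : ℕ} (γ : Fin m → ℕ) (v : Fin m → ℝ) (i : Fin m) :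
    HasDerivAt (fun t : ℝ => ∏ j, ((Function.update v i t j : ℝ) : ℂ) ^ γ j)
      (γ i * (v i : ℂ) ^ (γ i - 1) * ∏ j ∈ Finset.univ.erase i, (v j : ℂ) ^ γ j) (v i) := by
  have e : ∀ t : ℝ, ∏ j, ((Function.update v i t j : ℝ) : ℂ) ^ γ j =
      (t : ℂ) ^ γ i * ∏ j ∈ Finset.univ.erase i, (v j : ℂ) ^ γ j := fun t => by
    rw [← Finset.mul_prod_erase _ _ (Finset.mem_univ i), Function.update_self]
    congr 1
    refine Finset.prod_congr rfl fun j hj => ?_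
    rw [Function.update_of_ne (Finset.ne_of_mem_erase hj)]
  simp only [e]
  have h0 : HasDerivAt (fun y : ℝ => (y : ℂ)) 1 (v i) := Complex.ofRealCLM.hasDerivAt
  simpa using (h0.fun_pow (γ i)).mul_const (∏ j ∈ Finset.univ.erase i, (v j : ℂ) ^ γ j)

/-- v_i∂_{v_i} either reproduces the monomial or raises its i-th exponent while multiplying the
weight by -2πi u_i. The derivative D is kept apart from the factor v_i, so the statement also covers
v_i = 0. -/
lemma oscClass_coord {m : ℕ} {a : Fin m → ℤ} {γ : Fin m → ℕ} {Φ : ℝ → (Fin m → ℝ) → ℂ}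
    (hΦ : Φ ∈ oscClass a γ) (i : Fin m) :
    ∃ D : ℝ → (Fin m → ℝ) → ℂ,
      (fun r v => (v i : ℂ) * D r v) ∈ oscClass a (γ + Pi.single i 1) ∧
      ∀ (r : ℝ) (v : Fin m → ℝ),
        HasDerivAt (fun t => Φ r (Function.update v i t)) (D r v) (v i) := by
  have hle : γ ≤ γ + Pi.single i 1 := le_self_add
  induction hΦ using Submodule.span_induction with
  | mem Φ h =>
    obtain ⟨γ', hγ', w, g, Ψ, hw, hg, rfl⟩ := h
    refine ⟨_, ?_, fun r v => (hasDerivAt_prod_update_pow γ' v i).mul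
      (hasDerivAt_deltaOsc_coord a hw g Ψ r v i)⟩
    have e : (fun (r : ℝ) (v : Fin m → ℝ) => (v i : ℂ) *
        (γ' i * (v i : ℂ) ^ (γ' i - 1) * (∏ j ∈ Finset.univ.erase i, (v j : ℂ) ^ γ' j) *
          deltaOsc a w g Ψ r (Function.update v i (v i)) +
        (∏ j, ((Function.update v i (v i) j : ℝ) : ℂ) ^ γ' j) *
          deltaOsc a (fun u => -(2 * Real.pi * Complex.I) * u i * w u) g Ψ r v)) =
        (γ' i : ℂ) • (fun r v => (∏ j, (v j : ℂ) ^ γ' j) * deltaOsc a w g Ψ r v) +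
        fun r v => (∏ j, (v j : ℂ) ^ (γ' + Pi.single i 1 : Fin m → ℕ) j) *
          deltaOsc a (fun u => -(2 * Real.pi * Complex.I) * u i * w u) g Ψ r v := by
      funext r v
      simp only [Function.update_eq_self, Pi.add_apply, Pi.smul_apply, smul_eq_mul, pow_add,
        Finset.prod_mul_distrib]
      have e1 : ∏ j, (v j : ℂ) ^ (Pi.single i 1 : Fin m → ℕ) j = v i := by
        rw [Finset.prod_eq_single i]
        · simp
        · intro j _ hj; simp [hj]
        · simp
      rw [e1, ← Finset.mul_prod_erase _ _ (Finset.mem_univ i)]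
      rcases γ' i with _ | k
      · simp; ring
      · simp only [Nat.add_sub_cancel]; ring
    rw [e]
    exact add_mem (Submodule.smul_mem _ _ (mem_oscClass a (hγ'.trans hle) Ψ hw hg))
      (mem_oscClass a (add_le_add_left hγ' _) Ψ (hw.mul_coord i) hg)
  | zero =>
    refine ⟨0, ?_, fun r v => by simpa using hasDerivAt_const (v i) (0 : ℂ)⟩
    convert zero_mem (oscClass a (γ + Pi.single i 1)) using 1
    ext r v; simp
  | add Φ₁ Φ₂ _ _ h₁ h₂ =>
    obtain ⟨D₁, m₁, h₁⟩ := h₁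
    obtain ⟨D₂, m₂, h₂⟩ := h₂
    refine ⟨D₁ + D₂, ?_, fun r v => (h₁ r v).add (h₂ r v)⟩
    convert add_mem m₁ m₂ using 1
    ext r v; simp [mul_add]
  | smul c Φ _ h =>
    obtain ⟨D, m', h'⟩ := h
    refine ⟨c • D, ?_, fun r v => (h' r v).const_mul c⟩
    convert Submodule.smul_mem _ c m' using 1
    ext r v
    simp only [Pi.smul_apply, smul_eq_mul]; ring

lemma oscClass_bound {m : ℕ} (hm : 2 ≤ m) {a : Fin m → ℤ} (ha : ∀ i, a i ≠ 0)
    {Fd : MvPolynomial (Fin m) ℚ} (hFd : IsDualForm (diagonalCubic a) Fd) (N : ℕ) (R : ℝ)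
    {γ : Fin m → ℕ} {Φ : ℝ → (Fin m → ℝ) → ℂ} (hΦ : Φ ∈ oscClass a γ) :
    ∃ C : ℝ, 0 ≤ C ∧ ∀ (r : ℝ) (v : Fin m → ℝ), 0 < r → r ≤ R →
      ‖Φ r v‖ ≤ C * (∏ i, (1 + |v i|) ^ γ i) * decayWeight m N (dualSize Fd) r v := by
  induction hΦ using Submodule.span_induction with
  | mem Φ h =>
    obtain ⟨γ', hγ', w, g, Ψ, hw, hg, rfl⟩ := h
    obtain ⟨C, hC0, hC⟩ := deltaOsc_bound hm ha hFd hw hg Ψ N R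
    refine ⟨C, hC0, fun r v hr hrR => ?_⟩
    have h1 : ‖∏ i, (v i : ℂ) ^ γ' i‖ ≤ ∏ i, (1 + |v i|) ^ γ i := by
      rw [norm_prod]
      refine Finset.prod_le_prod (fun i _ => norm_nonneg _) fun i _ => ?_
      rw [norm_pow, Complex.norm_real, Real.norm_eq_abs]
      have h0 := abs_nonneg (v i)
      exact (pow_le_pow_left₀ h0 (by linarith) _).trans (pow_le_pow_right₀ (by linarith) (hγ' i))
    calc _ ≤ (∏ i, (1 + |v i|) ^ γ i) * (C * decayWeight m N (dualSize Fd) r v) := by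
          rw [norm_mul]
          exact mul_le_mul h1 (hC r v hr hrR) (norm_nonneg _) ((norm_nonneg _).trans h1)
      _ = _ := by ring
  | zero => exact ⟨0, le_rfl, fun r v _ _ => by simp⟩
  | add Φ₁ Φ₂ _ _ h₁ h₂ =>
    obtain ⟨C₁, h01, h₁⟩ := h₁
    obtain ⟨C₂, h02, h₂⟩ := h₂
    refine ⟨C₁ + C₂, by positivity, fun r v hr hrR => ?_⟩
    rw [add_mul, add_mul]
    exact (norm_add_le _ _).trans (add_le_add (h₁ r v hr hrR) (h₂ r v hr hrR))
  | smul c Φ _ h =>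
    obtain ⟨C, h0, h⟩ := h
    refine ⟨‖c‖ * C, by positivity, fun r v hr hrR => ?_⟩
    simp only [Pi.smul_apply, norm_smul]
    rw [mul_assoc, mul_assoc, ← mul_assoc C]
    exact mul_le_mul_of_nonneg_left (h r v hr hrR) (norm_nonneg c)

/-- Agreement with the class is assumed only for x > 0, since that is all that remains known of f
after one application of the operator. -/
lemma oscClass_iterate_logDerivMod {m : ℕ} {a : Fin m → ℤ} {γ : Fin m → ℕ} (j : ℕ) :
    ∀ {Φ : ℝ → (Fin m → ℝ) → ℂ}, Φ ∈ oscClass a γ → ∃ Φ' ∈ oscClass a γ,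
      ∀ (f : ℝ → ℂ) (r : ℝ) (v : Fin m → ℝ), 0 < r → (∀ x, 0 < x → f x = Φ (x * r) (x⁻¹ • v)) →
        ∀ x, 0 < x → logDerivMod^[j] f x = Φ' (x * r) (x⁻¹ • v) := by
  induction j with
  | zero => exact fun {Φ} hΦ => ⟨Φ, hΦ, fun f r v _ h x hx => h x hx⟩
  | succ j ih =>
    intro Φ hΦ
    obtain ⟨Φ₁, h₁, hd⟩ := oscClass_dilate hΦ
    obtain ⟨Φ', h', hi⟩ := ih h₁
    refine ⟨Φ', h', fun f r v hr hf x hx => ?_⟩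
    rw [Function.iterate_succ_apply]
    refine hi (logDerivMod f) r v hr (fun y hy => ?_) x hx
    have he : f =ᶠ[nhds y] fun x => Φ (x * r) (x⁻¹ • v) := (eventually_gt_nhds hy).mono hf
    rw [logDerivMod, he.deriv_eq, (hd y r v hy hr).deriv, ← mul_assoc,
      mul_inv_cancel₀ (Complex.ofReal_ne_zero.2 hy.ne'), one_mul]

/-- Euler operators commute with scaling, so passing from c to v = κc introduces no power of κ. -/
lemma oscClass_logDerivCoord {m : ℕ} {a : Fin m → ℤ} {γ : Fin m → ℕ}
    {Φ : ℝ → (Fin m → ℝ) → ℂ} (hΦ : Φ ∈ oscClass a γ) (i : Fin m) :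
    ∃ Φ' ∈ oscClass a (γ + Pi.single i 1), ∀ r κ : ℝ,
      logDerivCoord i (fun c => Φ r (κ • c)) = fun c => Φ' r (κ • c) := by
  obtain ⟨D, hD, h⟩ := oscClass_coord hΦ i
  refine ⟨_, hD, fun r κ => funext fun c => ?_⟩
  have e : (fun t : ℝ => Φ r (κ • Function.update c i t)) =
      (fun s => Φ r (Function.update (κ • c) i s)) ∘ fun t => κ * t := by
    funext t
    simp only [Function.comp_apply]
    congr 1
    ext j
    by_cases hj : j = i
    · subst hj; simp
    · simp [hj]
  have h1 := HasDerivAt.scomp (h := fun t => κ * t) (c i) (h r (κ • c))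
    (by simpa using (hasDerivAt_id (c i)).const_mul κ)
  rw [logDerivCoord, e, h1.deriv, Complex.real_smul, Pi.smul_apply, smul_eq_mul]
  push_cast
  ring

lemma oscClass_iterate_logDerivCoord {m : ℕ} {a : Fin m → ℤ} (i : Fin m) (k : ℕ) :
    ∀ {γ : Fin m → ℕ} {Φ : ℝ → (Fin m → ℝ) → ℂ}, Φ ∈ oscClass a γ →
    ∃ Φ' ∈ oscClass a (γ + Pi.single i k), ∀ r κ : ℝ,
      (logDerivCoord i)^[k] (fun c => Φ r (κ • c)) = fun c => Φ' r (κ • c) := by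
  induction k with
  | zero => exact fun {γ Φ} hΦ => ⟨Φ, by simpa using hΦ, fun r κ => rfl⟩
  | succ k ih =>
    intro γ Φ hΦ
    obtain ⟨Φ₁, h₁, hd⟩ := oscClass_logDerivCoord hΦ i
    obtain ⟨Φ', h', hi⟩ := ih h₁
    refine ⟨Φ', ?_, fun r κ => ?_⟩
    · rwa [add_assoc, ← Pi.single_add, add_comm 1 k] at h'
    · rw [Function.iterate_succ_apply, hd, hi]

lemma oscClass_logDerivMulti {m : ℕ} {a : Fin m → ℤ} (α : Fin m → ℕ)
    {Φ : ℝ → (Fin m → ℝ) → ℂ} (hΦ : Φ ∈ oscClass a 0) :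
    ∃ Φ' ∈ oscClass a α, ∀ r κ : ℝ,
      logDerivMulti α (fun c => Φ r (κ • c)) = fun c => Φ' r (κ • c) := by
  have key : ∀ l : List (Fin m), ∃ Φ' ∈ oscClass a (l.map fun i => Pi.single i (α i)).sum,
      ∀ r κ : ℝ, l.foldr (fun i H => (logDerivCoord i)^[α i] H) (fun c => Φ r (κ • c)) =
        fun c => Φ' r (κ • c) := by
    intro l
    induction l with
    | nil => exact ⟨Φ, by simpa using hΦ, fun r κ => rfl⟩
    | cons i l ih =>
      obtain ⟨Φ₁, h₁, e₁⟩ := ih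
      obtain ⟨Φ', h', e'⟩ := oscClass_iterate_logDerivCoord i (α i) h₁
      refine ⟨Φ', ?_, fun r κ => ?_⟩
      · rwa [List.map_cons, List.sum_cons, add_comm]
      · rw [List.foldr_cons, e₁, e']
  obtain ⟨Φ', h', e'⟩ := key (List.finRange m)
  rw [← Fin.sum_univ_def, Finset.univ_sum_single] at h'
  exact ⟨Φ', h', e'⟩

/-- The derivative bounds in the normalized variables. -/
theorem exists_logDeriv_bound {m : ℕ} (hm : 2 ≤ m) {a : Fin m → ℤ} (ha : ∀ i, a i ≠ 0)
    {Fd : MvPolynomial (Fin m) ℚ} (hFd : IsDualForm (diagonalCubic a) Fd)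
    {w : (Fin m → ℝ) → ℝ} (hw : IsCubicWeight fun u => ((w u : ℝ) : ℂ)) (N : ℕ) (R : ℝ) (j : ℕ)
    (α : Fin m → ℕ) :
    ∃ C : ℝ, 0 ≤ C ∧ ∀ (X : ℝ) (c : Fin m → ℝ) (n : ℝ), 0 < X → 0 < n → n / cutoffY X ≤ R →
      ‖logDerivMod^[j] (fun n' =>
          logDerivMulti α (fun c' => deltaJ (diagonalCubic a) w X c' n') c) n‖ ≤
        C * (∏ i, (1 + X * |c i| / n) ^ α i) *
          decayWeight m N (dualSize Fd) (n / cutoffY X) ((X / n) • c) := by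
  have h0 : deltaOsc a (fun u => (w u : ℂ)) omegaDiv profile ∈ oscClass a 0 := by
    simpa using mem_oscClass a (le_refl (0 : Fin m → ℕ)) profile hw isPosBump_omegaDiv
  obtain ⟨Φ₁, h₁, e₁⟩ := oscClass_logDerivMulti α h0
  obtain ⟨Φ₂, h₂, e₂⟩ := oscClass_iterate_logDerivMod j h₁
  obtain ⟨C, hC0, hC⟩ := oscClass_bound hm ha hFd N R h₂
  refine ⟨C, hC0, fun X c n hX hn hR => ?_⟩
  have hY : 0 < cutoffY X := Real.rpow_pos_of_pos hX _
  have hv : ∀ x : ℝ, x⁻¹ • X • c = (X / x) • c := fun x => by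
    rw [smul_smul, inv_mul_eq_div]
  -- With dilation parameter n and base point (Y⁻¹, Xc), the dilated point is (n/Y, (X/n)c).
  have h3 := e₂ (fun n' => logDerivMulti α (fun c' => deltaJ (diagonalCubic a) w X c' n') c)
    (cutoffY X)⁻¹ (X • c) (inv_pos.2 hY) (fun x hx => by
      have : (fun c' => deltaJ (diagonalCubic a) w X c' x) = fun c' =>
          deltaOsc a (fun u => (w u : ℂ)) omegaDiv profile (x / cutoffY X) ((X / x) • c') :=
        funext fun c' => deltaJ_eq_deltaOsc a w hX hx c'
      simp only [this]
      rw [e₁, hv, div_eq_mul_inv]) n hn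
  rw [h3, hv, ← div_eq_mul_inv]
  have h4 := hC (n / cutoffY X) ((X / n) • c) (div_pos hn hY) hR
  have h5 : ∀ i, |((X / n) • c) i| = X * |c i| / n := fun i => by
    rw [Pi.smul_apply, smul_eq_mul, abs_mul, abs_of_pos (div_pos hX hn)]; ring
  simpa only [h5] using h4

end CubicDelta

end

noncomputable section

open scoped ContDiff SchwartzMap

namespace CubicDelta

open MeasureTheory Set

/-! Schwartz majorants. -/

/-- A sum of dilated bumps with rapidly decaying coefficients is a Schwartz function. -/
lemma exists_schwartz_ge {m : ℕ} {B : ℕ → ℝ} (hB : ∀ k, 0 < B k)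
    (hBd : ∀ p : ℕ, ∃ C : ℝ, ∀ k, B k ≤ C * ((2 : ℝ) ^ (p * k))⁻¹) :
    ∃ ν : 𝓢(Fin m → ℝ, ℝ), ∀ k x, ‖x‖ ≤ 2 ^ (k + 1) → B k ≤ ν x := by
  -- Inner radius 2 makes the k-th dilate equal to 1 for ‖x‖ ≤ 2^(k+1), covering the dyadic shell.
  let φ : ContDiffBump (0 : Fin m → ℝ) := ⟨2, 4, by norm_num, by norm_num⟩
  have hφs : ContDiff ℝ ∞ φ := φ.contDiff
  have hφc : HasCompactSupport φ := φ.hasCompactSupport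
  set t : ℕ → (Fin m → ℝ) → ℝ := fun k x => B k * φ (((2 : ℝ) ^ k)⁻¹ • x) with ht
  have htc : ∀ k, ContDiff ℝ ∞ (t k) := fun k =>
    contDiff_const.mul (hφs.comp (contDiff_const_smul _))
  have hM : ∀ n : ℕ, ∃ M : ℝ, 0 ≤ M ∧ ∀ x, ‖iteratedFDeriv ℝ n φ x‖ ≤ M := fun n => by
    obtain ⟨M, hM⟩ := (hφc.iteratedFDeriv n).exists_bound_of_continuous
      (hφs.continuous_iteratedFDeriv (by exact_mod_cast le_top))
    exact ⟨M, (norm_nonneg _).trans (hM 0), hM⟩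
  have hder : ∀ k n x, iteratedFDeriv ℝ n (t k) x =
      (B k * ((2 : ℝ) ^ k)⁻¹ ^ n) • iteratedFDeriv ℝ n φ (((2 : ℝ) ^ k)⁻¹ • x) := fun k n x => by
    have h1 : t k = fun x => B k • φ (((2 : ℝ) ^ k)⁻¹ • x) := rfl
    rw [h1, iteratedFDeriv_const_smul_apply' (f := fun x => φ (((2 : ℝ) ^ k)⁻¹ • x)),
      iteratedFDeriv_comp_const_smul _ (hφs.of_le (by exact_mod_cast le_top)), smul_smul]
    exact ((hφs.comp (contDiff_const_smul _)).of_le (by exact_mod_cast le_top)).contDiffAt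
  have hz : ∀ k n x, 4 * 2 ^ k < ‖x‖ → iteratedFDeriv ℝ n (t k) x = 0 := fun k n x hx => by
    rw [hder, image_eq_zero_of_notMem_tsupport (f := iteratedFDeriv ℝ n φ), smul_zero]
    intro h
    have h1 := tsupport_iteratedFDeriv_subset (𝕜 := ℝ) n h
    rw [φ.tsupport_eq, mem_closedBall_zero_iff, norm_smul, norm_inv, Real.norm_of_nonneg
      (by positivity), inv_mul_le_iff₀ (by positivity)] at h1
    have h2 : φ.rOut = 4 := rfl
    rw [h2] at h1
    linarith
  have hbd : ∀ p n, ∃ C : ℝ, 0 ≤ C ∧ ∀ k x,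
      ‖x‖ ^ p * ‖iteratedFDeriv ℝ n (t k) x‖ ≤ C * (1 / 2) ^ k := fun p n => by
    obtain ⟨M, hM0, hM⟩ := hM n
    -- One power more than ‖x‖^p requires leaves the factor 2^(-k) that makes the series summable.
    obtain ⟨C, hC⟩ := hBd (p + 1)
    have hC0 : 0 ≤ C := by
      have := (hB 0).le.trans (hC 0)
      simpa using this
    refine ⟨4 ^ p * C * M, by positivity, fun k x => ?_⟩
    rcases lt_or_ge (4 * 2 ^ k) ‖x‖ with hx | hx
    · rw [hz k n x hx, norm_zero, mul_zero]; positivity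
    · have h1 : ‖iteratedFDeriv ℝ n (t k) x‖ ≤ (C * ((2 : ℝ) ^ ((p + 1) * k))⁻¹ * 1) * M := by
        rw [hder, norm_smul, Real.norm_of_nonneg (by have := hB k; positivity)]
        refine mul_le_mul (mul_le_mul (hC k) ?_ (by positivity) ?_) (hM _) (norm_nonneg _) ?_
        · exact pow_le_one₀ (by positivity) (inv_le_one_of_one_le₀ (one_le_pow₀ one_le_two))
        · positivity
        · positivity
      calc _ ≤ (4 * 2 ^ k) ^ p * ((C * ((2 : ℝ) ^ ((p + 1) * k))⁻¹ * 1) * M) := by gcongr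
        _ = _ := by
          rw [mul_pow, ← pow_mul, add_mul, pow_add, one_mul, mul_comm k p, one_div, inv_pow]
          field_simp
  choose C hC0 hC using hbd
  have hgeo : ∀ c : ℝ, Summable fun k : ℕ => c * (1 / 2 : ℝ) ^ k := fun c =>
    summable_geometric_two.mul_left c
  have hb0 : ∀ (n k : ℕ) x, ‖iteratedFDeriv ℝ n (t k) x‖ ≤ C 0 n * (1 / 2) ^ k := fun n k x => by
    simpa using hC 0 n k x
  have hsumm : ∀ x, Summable fun k => t k x := fun x =>
    (hgeo (C 0 0)).of_norm_bounded fun k => by simpa using hb0 0 k x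
  refine ⟨⟨fun x => ∑' k, t k x, ?_, fun p n => ?_⟩, fun k x hx => ?_⟩
  · exact contDiff_tsum htc (v := fun n k => C 0 n * (1 / 2) ^ k) (fun n _ => hgeo _)
      fun n k x _ => hb0 n k x
  · refine ⟨C p n * 2, fun x => ?_⟩
    rw [iteratedFDeriv_tsum_apply htc (v := fun n k => C 0 n * (1 / 2) ^ k) (fun n _ => hgeo _)
      (fun n k x _ => hb0 n k x) (by exact_mod_cast le_top), ← Real.norm_of_nonneg
      (show 0 ≤ ‖x‖ ^ p by positivity), ← norm_smul, ← tsum_const_smul'']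
    refine tsum_of_norm_bounded (hasSum_geometric_two.mul_left (C p n)) fun k => ?_
    rw [norm_smul, Real.norm_of_nonneg (by positivity)]
    exact hC p n k x
  · have h1 : t k x = B k := by
      simp only [ht]
      rw [φ.one_of_mem_closedBall, mul_one]
      rw [mem_closedBall_zero_iff, norm_smul, norm_inv, Real.norm_of_nonneg
        (by positivity), inv_mul_le_iff₀ (by positivity)]
      have h2 : φ.rIn = 2 := rfl
      rw [h2, ← pow_succ]
      exact hx
    rw [← h1]
    exact (hsumm x).le_tsum k fun j _ => mul_nonneg (hB j).le φ.nonneg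

/-- A single Schwartz function majorizes countably many families of polynomial decay. -/
theorem exists_schwartz_majorant (m : ℕ) {ι : Type*} [Encodable ι] (Cs : ι → ℕ → ℝ) :
    ∃ ν : 𝓢(Fin m → ℝ, ℝ), (∀ x, 0 < ν x) ∧ ∀ i, ∃ C : ℝ, 0 < C ∧ ∀ (q : ℝ) (x y : Fin m → ℝ),
      (∀ N, q ≤ Cs i N * (((1 + ‖x‖) ^ N)⁻¹ * ((1 + ‖y‖) ^ N)⁻¹)) → q ≤ C * (ν x ^ 3 * ν y) := by
  set D : ℕ → ℕ → ℝ := fun e N => match Encodable.decode (α := ι) e with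
    | some i => |Cs i N|
    | none => 0 with hD
  have hD0 : ∀ e N, 0 ≤ D e N := fun e N => by
    simp only [hD]; split <;> positivity
  -- Diagonal choice: A_N includes the N-th constant of the first N families, so each family is
  -- dominated from some N on, up to a constant for the earlier N. The term 2^(N²) keeps the infimum
  -- M_k positive, because kN ≤ k² + N².
  set A : ℕ → ℝ := fun N => 2 ^ (N ^ 2) + ∑ e ∈ Finset.range N, D e N with hA
  have hA1 : ∀ N, 2 ^ (N ^ 2) ≤ A N := fun N =>
    le_add_of_nonneg_right (Finset.sum_nonneg fun e _ => hD0 e N)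
  have hA11 : ∀ N, 1 ≤ A N := fun N => (one_le_pow₀ one_le_two).trans (hA1 N)
  have hCA : ∀ i, ∃ C : ℝ, 1 ≤ C ∧ ∀ N, Cs i N ≤ C * A N := fun i => by
    refine ⟨1 + ∑ N ∈ Finset.range (Encodable.encode i + 1), |Cs i N|,
      le_add_of_nonneg_right (Finset.sum_nonneg fun e _ => abs_nonneg _), fun N => ?_⟩
    have hs : 0 ≤ ∑ N ∈ Finset.range (Encodable.encode i + 1), |Cs i N| :=
      Finset.sum_nonneg fun e _ => abs_nonneg _
    rcases lt_or_ge N (Encodable.encode i + 1) with h | h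
    · have h1 : |Cs i N| ≤ ∑ N ∈ Finset.range (Encodable.encode i + 1), |Cs i N| :=
        Finset.single_le_sum (f := fun N => |Cs i N|) (fun e _ => abs_nonneg _)
          (Finset.mem_range.2 h)
      have := hA11 N
      nlinarith [le_abs_self (Cs i N)]
    · have h1 : D (Encodable.encode i) N ≤ ∑ e ∈ Finset.range N, D e N :=
        Finset.single_le_sum (f := fun e => D e N) (fun e _ => hD0 e N)
          (Finset.mem_range.2 (by omega))
      have h2 : D (Encodable.encode i) N = |Cs i N| := by simp [hD]
      have h3 : (0 : ℝ) < 2 ^ (N ^ 2) := by positivity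
      have h4 : Cs i N ≤ A N := by simp only [hA]; linarith [le_abs_self (Cs i N)]
      have := hA11 N
      nlinarith
  set M : ℕ → ℝ := fun k => ⨅ N, A N * ((2 : ℝ) ^ (k * N))⁻¹ with hM
  have hMlow : ∀ k N, ((2 : ℝ) ^ (k ^ 2))⁻¹ ≤ A N * ((2 : ℝ) ^ (k * N))⁻¹ := fun k N => by
    rw [← div_eq_mul_inv, le_div_iff₀ (by positivity), inv_mul_le_iff₀ (by positivity)]
    calc (2 : ℝ) ^ (k * N) ≤ 2 ^ (k ^ 2 + N ^ 2) := by
          refine pow_le_pow_right₀ one_le_two ?_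
          zify
          nlinarith [sq_nonneg ((k : ℤ) - N), sq_nonneg (k : ℤ), sq_nonneg (N : ℤ)]
      _ = 2 ^ (k ^ 2) * 2 ^ (N ^ 2) := pow_add _ _ _
      _ ≤ _ := by gcongr; exact hA1 N
  have hMpos : ∀ k, 0 < M k := fun k =>
    lt_of_lt_of_le (by positivity) (le_ciInf (hMlow k))
  have hMle : ∀ k N, M k ≤ A N * ((2 : ℝ) ^ (k * N))⁻¹ := fun k N =>
    ciInf_le ⟨_, Set.forall_mem_range.2 (hMlow k)⟩ N
  -- Sixth roots, since the majorant has ν(x)³ν(y): min(M_k, M_l) ≤ B_k³B_l³, and B_l ≤ 1 allows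
  -- B_l³ to be replaced by B_l. The root still decays faster than any power of 2^k.
  set B : ℕ → ℝ := fun k => M k ^ (6 : ℝ)⁻¹ with hB
  have hBpos : ∀ k, 0 < B k := fun k => Real.rpow_pos_of_pos (hMpos k) _
  have hB6 : ∀ k, B k ^ 6 = M k := fun k => by
    have := Real.rpow_inv_natCast_pow (hMpos k).le (n := 6) (by norm_num)
    simpa [hB] using this
  obtain ⟨ν, hν⟩ := exists_schwartz_ge (m := m) hBpos fun p => by
    refine ⟨A (6 * p), fun k => ?_⟩
    have h0 := hA11 (6 * p)
    refine (pow_le_pow_iff_left₀ (hBpos k).le (by positivity) (by norm_num : 6 ≠ 0)).1 ?_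
    rw [hB6, mul_pow, inv_pow, ← pow_mul]
    refine (hMle k (6 * p)).trans ?_
    rw [show k * (6 * p) = p * k * 6 by ring]
    gcongr
    exact le_self_pow₀ h0 (by norm_num)
  have hshell : ∀ x : Fin m → ℝ, ∃ k : ℕ, (2 : ℝ) ^ k ≤ 1 + ‖x‖ ∧ B k ≤ ν x := fun x => by
    obtain ⟨k, h1, h2⟩ := exists_nat_pow_near (x := 1 + ‖x‖) (y := 2)
      (by linarith [norm_nonneg x]) one_lt_two
    exact ⟨k, h1, hν k x (by linarith)⟩
  refine ⟨ν, fun x => ?_, fun i => ?_⟩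
  · obtain ⟨k, -, h⟩ := hshell x
    exact (hBpos k).trans_le h
  obtain ⟨C, hC1, hC⟩ := hCA i
  refine ⟨C, by linarith, fun q x y hq => ?_⟩
  obtain ⟨k, hk, hkν⟩ := hshell x
  obtain ⟨l, hl, hlν⟩ := hshell y
  have hpow : ∀ (N k : ℕ) (z : Fin m → ℝ), (2 : ℝ) ^ k ≤ 1 + ‖z‖ →
      ((1 + ‖z‖) ^ N)⁻¹ ≤ ((2 : ℝ) ^ (k * N))⁻¹ := fun N k z h => by
    rw [pow_mul]; gcongr
  have hone : ∀ (N : ℕ) (z : Fin m → ℝ), ((1 + ‖z‖) ^ N)⁻¹ ≤ 1 := fun N z =>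
    inv_le_one_of_one_le₀ (one_le_pow₀ (by linarith [norm_nonneg z]))
  have hCs : ∀ N (X Y x' y' : ℝ), 0 ≤ x' → 0 ≤ y' → 0 ≤ X → x' ≤ X → y' ≤ Y →
      Cs i N * (x' * y') ≤ C * A N * (X * Y) := fun N X Y x' y' h1 h2 h3 h4 h5 =>
    mul_le_mul (hC N) (mul_le_mul h4 h5 h2 h3) (by positivity)
      (by have := hA11 N; positivity)
  have hqk : q ≤ C * M k := by
    rw [← div_le_iff₀' (by linarith)]
    refine le_ciInf fun N => ?_
    rw [div_le_iff₀' (by linarith)]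
    refine (hq N).trans ((hCs N _ 1 _ _ (by positivity) (by positivity) (by positivity)
      (hpow N k x hk) (hone N y)).trans (le_of_eq (by ring)))
  have hql : q ≤ C * M l := by
    rw [← div_le_iff₀' (by linarith)]
    refine le_ciInf fun N => ?_
    rw [div_le_iff₀' (by linarith)]
    refine (hq N).trans ((hCs N 1 _ _ _ (by positivity) (by positivity) (by positivity)
      (hone N x) (hpow N l y hl)).trans (le_of_eq (by ring)))
  have hBl1 : B l ≤ 1 := by
    refine (pow_le_pow_iff_left₀ (hBpos l).le zero_le_one (by norm_num : 6 ≠ 0)).1 ?_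
    rw [hB6, one_pow]
    refine (hMle l 0).trans ?_
    simp [hA]
  have hB0k := hBpos k
  have hB0l := hBpos l
  have hmin : q ≤ C * (B k ^ 3 * B l ^ 3) := by
    rw [← hB6] at hqk hql
    rcases le_total (B k) (B l) with h | h
    · refine hqk.trans (mul_le_mul_of_nonneg_left ?_ (by linarith))
      calc B k ^ 6 = B k ^ 3 * B k ^ 3 := by ring
        _ ≤ _ := by gcongr
    · refine hql.trans (mul_le_mul_of_nonneg_left ?_ (by linarith))
      calc B l ^ 6 = B l ^ 3 * B l ^ 3 := by ring
        _ ≤ _ := by gcongr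
  refine hmin.trans (mul_le_mul_of_nonneg_left ?_ (by linarith))
  have h3 : B l ^ 3 ≤ B l := by
    calc B l ^ 3 ≤ B l ^ 1 := pow_le_pow_of_le_one hB0l.le hBl1 (by norm_num)
      _ = B l := pow_one _
  exact mul_le_mul (pow_le_pow_left₀ hB0k.le hkν 3) (h3.trans hlν) (by positivity)
    (pow_nonneg (hB0k.le.trans hkν) 3)

end CubicDelta

end

noncomputable section

open scoped ContDiff SchwartzMap

namespace CubicDelta

open MeasureTheory Set

/-! Smoothness of the delta integral, and the final estimates. -/

/-- Parametric integrals of smooth functions with uniformly compact support are smooth. -/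
lemma contDiffOn_integral_of_compact {P : Type*} [NormedAddCommGroup P] [NormedSpace ℝ P] {m : ℕ}
    {H : P → (Fin m → ℝ) → ℂ} {s : Set P} {K : Set (Fin m → ℝ)} (hs : IsOpen s)
    (hK : IsCompact K) (hsupp : ∀ p u, u ∉ K → H p u = 0)
    (hH : ContDiffOn ℝ ∞ (fun q : P × (Fin m → ℝ) => H q.1 q.2) (s ×ˢ univ)) :
    ContDiffOn ℝ ∞ (fun p => ∫ u, H p u) s := by
  -- The integral is the value at 0 of the convolution of H(p, ·) with the constant 1, so smoothness
  -- of parametric convolutions applies.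
  have h := contDiffOn_convolution_right_with_param_comp (μ := (volume : Measure (Fin m → ℝ)))
    (n := ⊤) (ContinuousLinearMap.lsmul ℝ ℝ (E := ℂ)) (s := s) (v := fun _ : P => (0 : Fin m → ℝ))
    contDiffOn_const (f := fun _ => (1 : ℝ)) (g := H) hs hK (fun p u _ hu => hsupp p u hu)
    (locallyIntegrable_const 1) hH
  refine h.congr fun p _ => ?_
  rw [convolution, ← integral_neg_eq_self]
  simp

theorem contDiffOn_deltaJ {m : ℕ} (a : Fin m → ℤ) {w : (Fin m → ℝ) → ℝ} (hw : ContDiff ℝ ∞ w)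
    (hwc : HasCompactSupport w) {X : ℝ} (hX : 0 < X) :
    ContDiffOn ℝ ∞ (fun p : (Fin m → ℝ) × ℝ => deltaJ (diagonalCubic a) w X p.1 p.2)
      (univ ×ˢ Ioi 0) := by
  have hY : 0 < cutoffY X := Real.rpow_pos_of_pos hX _
  have hopen : IsOpen ((univ : Set (Fin m → ℝ)) ×ˢ Ioi (0 : ℝ)) := isOpen_univ.prod isOpen_Ioi
  refine ContDiffOn.congr (f := fun p : (Fin m → ℝ) × ℝ =>
    deltaOsc a (fun u => (w u : ℂ)) omegaDiv profile (p.2 / cutoffY X) ((X / p.2) • p.1)) ?_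
    fun p hp => deltaJ_eq_deltaOsc a w hX hp.2 p.1
  unfold deltaOsc
  refine contDiffOn_integral_of_compact hopen hwc.isCompact (fun p u hu => by
    simp [image_eq_zero_of_notMem_tsupport hu]) ?_
  intro q hq
  refine ContDiffAt.contDiffWithinAt ?_
  have hq2 : 0 < q.1.2 := hq.1.2
  have c1 : ContDiffAt ℝ ∞ (fun q : ((Fin m → ℝ) × ℝ) × (Fin m → ℝ) => q.1.2) q :=
    contDiffAt_fst.snd
  have c2 : ContDiffAt ℝ ∞ (fun q : ((Fin m → ℝ) × ℝ) × (Fin m → ℝ) => q.1.1) q :=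
    contDiffAt_fst.fst
  have c3 : ContDiffAt ℝ ∞ (fun q : ((Fin m → ℝ) × ℝ) × (Fin m → ℝ) => q.2) q := contDiffAt_snd
  have cr : ContDiffAt ℝ ∞ (fun q : ((Fin m → ℝ) × ℝ) × (Fin m → ℝ) => q.1.2 / cutoffY X) q :=
    c1.div contDiffAt_const hY.ne'
  have hr : 0 < q.1.2 / cutoffY X := div_pos hq2 hY
  have c4 : ContDiffAt ℝ ∞ (fun q : ((Fin m → ℝ) × ℝ) × (Fin m → ℝ) => ((w q.2 : ℝ) : ℂ)) q :=
    (Complex.ofRealCLM.contDiff.comp hw).contDiffAt.comp q c3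
  have cF : ContDiffAt ℝ ∞ (fun q : ((Fin m → ℝ) × ℝ) × (Fin m → ℝ) => realCubic a q.2) q := by
    have : ContDiff ℝ ∞ (realCubic a) := by unfold realCubic; fun_prop
    exact this.contDiffAt.comp q c3
  have c5 : ContDiffAt ℝ ∞ (fun q : ((Fin m → ℝ) × ℝ) × (Fin m → ℝ) =>
      riemannError omegaDiv (q.1.2 / cutoffY X)) q :=
    ContDiffAt.comp (g := riemannError omegaDiv) q
      (isPosBump_omegaDiv.contDiffAt_riemannError hr) cr
  have c6 : ContDiffAt ℝ ∞ (fun q : ((Fin m → ℝ) × ℝ) × (Fin m → ℝ) =>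
      (((q.1.2 / cutoffY X)⁻¹ : ℝ) : ℂ)) q :=
    Complex.ofRealCLM.contDiff.contDiffAt.comp q (cr.inv hr.ne')
  have c7 : ContDiffAt ℝ ∞ (fun q : ((Fin m → ℝ) × ℝ) × (Fin m → ℝ) =>
      profile (realCubic a q.2 / (q.1.2 / cutoffY X))) q :=
    ContDiffAt.comp (g := profile) q (profile.smooth ⊤).contDiffAt (cF.div cr hr.ne')
  have c8 : ContDiffAt ℝ ∞ (fun q : ((Fin m → ℝ) × ℝ) × (Fin m → ℝ) =>
      ee (-(((X / q.1.2) • q.1.1) ⬝ᵥ q.2))) q := by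
    refine contDiff_ee.contDiffAt.comp q (ContDiffAt.neg ?_)
    simp only [dotProduct, Pi.smul_apply, smul_eq_mul]
    refine ContDiffAt.sum fun i _ => ((contDiffAt_const.div c1 hq2.ne').mul ?_).mul ?_
    · exact (contDiff_apply ℝ ℝ i).contDiffAt.comp q c2
    · exact (contDiff_apply ℝ ℝ i).contDiffAt.comp q c3
  refine (c4.mul ((c5.add (c6.mul c7)).mul c8)).congr_of_eventuallyEq
    (Filter.Eventually.of_forall fun q => ?_)
  simp only [kernelFun, Complex.ofReal_inv]

/-- A weight supported off the Hessian locus is supported off the coordinate hyperplanes. -/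
lemma isCubicWeight_of_inter_eq_empty {m : ℕ} {a : Fin m → ℤ} {w : (Fin m → ℝ) → ℝ}
    (hw : ContDiff ℝ ∞ w) (hwc : HasCompactSupport w)
    (hwH : tsupport w ∩ realHessianLocus (diagonalCubic a) = ∅) :
    IsCubicWeight fun u => ((w u : ℝ) : ℂ) := by
  have hs : tsupport (fun u => ((w u : ℝ) : ℂ)) ⊆ tsupport w :=
    closure_mono fun u hu h => hu (by simp [h])
  refine ⟨Complex.ofRealCLM.contDiff.comp hw,
    hwc.of_isClosed_subset (isClosed_tsupport _) hs, fun u hu i hi => ?_⟩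
  refine (Set.eq_empty_iff_forall_notMem.1 hwH u) ⟨hs hu, ?_⟩
  -- The Hessian matrix is diagonal with entries 6a_i u_i, so u_i = 0 kills row i.
  refine Matrix.det_eq_zero_of_row_eq_zero i fun j => ?_
  rw [Matrix.of_apply, pderiv_diagonalCubic]
  by_cases hij : j = i
  · subst hij
    simp [hi]
  · rw [MvPolynomial.pderiv_C_mul, Derivation.leibniz_pow, MvPolynomial.pderiv_X_of_ne hij]
    simp

lemma iterate_logDerivMod_eq_zero {f : ℝ → ℂ} {y : ℝ} (hf : ∀ x, y < x → f x = 0) (j : ℕ) :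
    ∀ x, y < x → logDerivMod^[j] f x = 0 := by
  induction j generalizing f with
  | zero => exact hf
  | succ j ih =>
    rw [Function.iterate_succ_apply]
    refine ih fun x hx => ?_
    have he : f =ᶠ[nhds x] fun _ => 0 := (eventually_gt_nhds hx).mono hf
    rw [logDerivMod, he.deriv_eq, deriv_const, mul_zero]

lemma logDerivMulti_const_zero {m : ℕ} (α : Fin m → ℕ) :
    logDerivMulti α (fun _ : Fin m → ℝ => (0 : ℂ)) = fun _ => 0 := by
  have h1 : ∀ i : Fin m, logDerivCoord i (fun _ : Fin m → ℝ => (0 : ℂ)) = fun _ => 0 :=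
    fun i => by funext c; simp [logDerivCoord]
  have h2 : ∀ (i : Fin m) (k : ℕ),
      (logDerivCoord i)^[k] (fun _ : Fin m → ℝ => (0 : ℂ)) = fun _ => 0 := fun i k => by
    induction k with
    | zero => rfl
    | succ k ih => rw [Function.iterate_succ_apply, h1, ih]
  unfold logDerivMulti
  induction List.finRange m with
  | nil => rfl
  | cons i l ih => rw [List.foldr_cons, ih, h2]

lemma logDerivMulti_zero {m : ℕ} (G : (Fin m → ℝ) → ℂ) : logDerivMulti 0 G = G := by
  unfold logDerivMulti
  induction List.finRange m with
  | nil => rfl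
  | cons i l ih => rw [List.foldr_cons, ih]; rfl

lemma le_dimensionFactor {m : ℕ} (hm : 2 ≤ m) {t : ℝ} (ht : 0 ≤ t) :
    (1 + t) ^ (1 - (m : ℝ) / 2) ≤ dimensionFactor m t := by
  have hm' : 1 - (m : ℝ) / 2 ≤ 0 := by
    have : (2 : ℝ) ≤ m := by exact_mod_cast hm
    linarith
  have h1 : (1 + t) ^ (1 - (m : ℝ) / 2) ≤ 1 :=
    Real.rpow_le_one_of_one_le_of_nonpos (by linarith) hm'
  unfold dimensionFactor
  split_ifs with h
  · exact h1
  · have ht0 : 0 < t := lt_of_le_of_ne ht (Ne.symm h)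
    exact le_min h1 (Real.rpow_le_rpow_of_nonpos ht0 (by linarith) hm')

/-- All logarithmic derivatives of the delta integral are bounded by one majorant. -/
theorem exists_majorant_bound {m : ℕ} (hm : 2 ≤ m) {a : Fin m → ℤ} (ha : ∀ i, a i ≠ 0)
    {Fd : MvPolynomial (Fin m) ℚ} (hFd : IsDualForm (diagonalCubic a) Fd)
    {w : (Fin m → ℝ) → ℝ} (hw : IsCubicWeight fun u => ((w u : ℝ) : ℂ))
    {C₀ : ℝ} (hC₀ : ∀ (X : ℝ) (c : Fin m → ℝ) (n : ℝ), 0 < X → 0 < n → C₀ * cutoffY X < n →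
      deltaJ (diagonalCubic a) w X c n = 0) (hC₀0 : 0 < C₀) :
    ∃ ν : 𝓢(Fin m → ℝ, ℝ), (∀ x, 0 < ν x) ∧ ∀ (j : ℕ) (α : Fin m → ℕ), ∃ C : ℝ, 0 < C ∧
      ∀ (X : ℝ) (c : Fin m → ℝ) (n : ℝ), 0 < X → 0 < n →
        ‖logDerivMod^[j] (fun n' =>
          logDerivMulti α (fun c' => deltaJ (diagonalCubic a) w X c' n') c) n‖ ≤
            C * (∏ i, (1 + X * |c i| / n) ^ α i) * majorant Fd ν X c n := by
  choose Cs hCs0 hCs using fun (i : ℕ × (Fin m → ℕ)) (N : ℕ) =>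
    exists_logDeriv_bound hm ha hFd hw N C₀ i.1 i.2
  obtain ⟨ν, hν, hνb⟩ := exists_schwartz_majorant m Cs
  refine ⟨ν, hν, fun j α => ?_⟩
  obtain ⟨C, hC, hCb⟩ := hνb (j, α)
  refine ⟨C, hC, fun X c n hX hn => ?_⟩
  have hY : 0 < cutoffY X := Real.rpow_pos_of_pos hX _
  set D := logDerivMod^[j] (fun n' =>
    logDerivMulti α (fun c' => deltaJ (diagonalCubic a) w X c' n') c) n with hD
  have hP : 0 < ∏ i, (1 + X * |c i| / n) ^ α i :=
    Finset.prod_pos fun i _ => by positivity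
  set P := ∏ i, (1 + X * |c i| / n) ^ α i with hPd
  set x : Fin m → ℝ := (X ^ (1 / 2 : ℝ))⁻¹ • c with hx
  set y : Fin m → ℝ := (X / n * |MvPolynomial.aeval (‖c‖⁻¹ • c) Fd|) • c with hy
  set v : Fin m → ℝ := (X / n) • c with hv
  have hXn : 0 < X / n := div_pos hX hn
  have hvn : ‖v‖ = X * ‖c‖ / n := by
    rw [hv, norm_smul, Real.norm_of_nonneg hXn.le]; ring
  have hdir : ‖v‖⁻¹ • v = ‖c‖⁻¹ • c := by
    rw [hv, norm_smul, Real.norm_of_nonneg hXn.le, smul_smul]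
    congr 1
    rw [mul_inv]
    field_simp
  have hyn : dualSize Fd v = ‖y‖ := by
    rw [dualSize, hdir, hvn, hy, norm_smul, Real.norm_of_nonneg (by positivity)]; ring
  -- Since Y = X·X^(1/2), the product r‖v‖ is free of n and equals ‖c‖/X^(1/2), the argument of the
  -- cubed Schwartz factor.
  have hxn : n / cutoffY X * ‖v‖ = ‖x‖ := by
    have e : cutoffY X = X * X ^ (1 / 2 : ℝ) := by
      rw [cutoffY]
      conv_rhs => rw [← Real.rpow_one X, ← Real.rpow_mul hX.le, ← Real.rpow_add hX]
      norm_num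
    have hs : 0 < X ^ (1 / 2 : ℝ) := Real.rpow_pos_of_pos hX _
    rw [hvn, hx, norm_smul, norm_inv, Real.norm_of_nonneg hs.le, e]
    field_simp
  have hdf := le_dimensionFactor hm (norm_nonneg v)
  set E := (1 + ‖v‖) ^ (1 - (m : ℝ) / 2) with hE
  have hE0 : 0 < E := Real.rpow_pos_of_pos (by positivity) _
  have hq : ‖D‖ / (P * E) ≤ C * (ν x ^ 3 * ν y) := by
    refine hCb _ x y fun N => ?_
    by_cases hR : n / cutoffY X ≤ C₀
    · have h1 := hCs (j, α) N X c n hX hn hR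
      rw [decayWeight, ← hv, hxn, hyn, ← hE] at h1
      rw [div_le_iff₀ (by positivity)]
      calc ‖D‖ ≤ _ := h1
        _ = _ := by ring
    · have hlt : C₀ * cutoffY X < n := by
        push Not at hR
        rwa [lt_div_iff₀ hY] at hR
      -- Beyond C₀Y the integral vanishes for all c on an open range of n, so every logarithmic
      -- derivative vanishes; only bounded r need the estimates.
      have h0 : D = 0 := iterate_logDerivMod_eq_zero (y := C₀ * cutoffY X) (fun n' hn' => by
        have : (fun c' => deltaJ (diagonalCubic a) w X c' n') = fun _ => 0 :=
          funext fun c' => hC₀ X c' n' hX ((mul_pos hC₀0 hY).trans hn') hn'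
        rw [this, logDerivMulti_const_zero]) j n hlt
      rw [h0, norm_zero, zero_div]
      have := hCs0 (j, α) N
      positivity
  rw [div_le_iff₀ (by positivity)] at hq
  have hνx := hν x
  have hνy := hν y
  rw [majorant, ← hvn, ← hx, ← hy]
  calc ‖D‖ ≤ C * (ν x ^ 3 * ν y) * (P * E) := hq
    _ ≤ C * (ν x ^ 3 * ν y) * (P * dimensionFactor m ‖v‖) := by gcongr
    _ = _ := by ring

end CubicDelta

end

/-! ### Assembly: the undifferentiated and n-derivative bounds are the cases α = 0 of the mixed
bound -/

theorem mainTheorem5 (m : ℕ) (hm : m = 4 ∨ m = 6)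
    (a : Fin m → ℤ) (ha : ∀ i, a i ≠ 0)
    (Fd : MvPolynomial (Fin m) ℚ) (hFd : IsDualForm (diagonalCubic a) Fd)
    (w : (Fin m → ℝ) → ℝ) (hw : ContDiff ℝ ∞ w) (hwc : HasCompactSupport w)
    (hwH : tsupport w ∩ realHessianLocus (diagonalCubic a) = ∅) :
    (∀ X : ℝ, 0 < X →
      ContDiffOn ℝ ∞ (fun p : (Fin m → ℝ) × ℝ => deltaJ (diagonalCubic a) w X p.1 p.2)
        (Set.univ ×ˢ Set.Ioi 0)) ∧
    ∃ ν : SchwartzMap (Fin m → ℝ) ℝ, (∀ x, 0 < ν x) ∧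
      (∃ C : ℝ, 0 < C ∧ ∀ (X : ℝ) (c : Fin m → ℝ) (n : ℝ), 0 < X → 0 < n →
        C * cutoffY X < n → deltaJ (diagonalCubic a) w X c n = 0) ∧
      (∃ C : ℝ, 0 < C ∧ ∀ (X : ℝ) (c : Fin m → ℝ) (n : ℝ), 0 < X → 0 < n →
        ‖deltaJ (diagonalCubic a) w X c n‖ ≤ C * majorant Fd ν X c n) ∧
      (∀ j : ℕ, ∃ C : ℝ, 0 < C ∧ ∀ (X : ℝ) (c : Fin m → ℝ) (n : ℝ), 0 < X → 0 < n →
        ‖logDerivMod^[j] (fun n' => deltaJ (diagonalCubic a) w X c n') n‖ ≤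
          C * majorant Fd ν X c n) ∧
      (∀ (j : ℕ) (α : Fin m → ℕ), ∃ C : ℝ, 0 < C ∧
        ∀ (X : ℝ) (c : Fin m → ℝ) (n : ℝ), 0 < X → 0 < n →
          ‖logDerivMod^[j] (fun n' =>
              logDerivMulti α (fun c' => deltaJ (diagonalCubic a) w X c' n') c) n‖ ≤
            C * (∏ i, (1 + X * |c i| / n) ^ α i) * majorant Fd ν X c n) := by
  have hm2 : 2 ≤ m := by omega
  have hW := isCubicWeight_of_inter_eq_empty hw hwc hwH
  obtain ⟨C₀, hC₀, hzero⟩ := exists_deltaJ_eq_zero a hwc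
  obtain ⟨ν, hν, hbound⟩ := exists_majorant_bound hm2 ha hFd hW hzero hC₀
  have hn : ∀ j : ℕ, ∃ C : ℝ, 0 < C ∧ ∀ (X : ℝ) (c : Fin m → ℝ) (n : ℝ), 0 < X → 0 < n →
      ‖logDerivMod^[j] (fun n' => deltaJ (diagonalCubic a) w X c n') n‖ ≤
        C * majorant Fd ν X c n := fun j => by
    obtain ⟨C, hC, h⟩ := hbound j 0
    exact ⟨C, hC, fun X c n hX hn => by simpa [logDerivMulti_zero] using h X c n hX hn⟩
  exact ⟨fun X hX => contDiffOn_deltaJ a hw hwc hX, ν, hν, ⟨C₀, hC₀, hzero⟩, hn 0, hn, hbound⟩
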